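/- Theorem. Let $p_1,\dots,p_n$ ($n\ge 1$) be points of the Euclidean plane in convex position (each is a vertex of the convex hull of all of them, and they are pairwise distinct), given by their coordinates in any order, and let $G$ be their unit-disk graph: the vertex set is $V=\{1,\dots,n\}$, and $u\ne v$ are adjacent iff $|p_u-p_v|\le 1$. Let $w:V\to\mathbb R_{\ge0}$ be vertex weights, $w(S)=\sum_{v\in S}w(v)$, let $c\in(0,1]$ and let $k\ge1$ be an integer. An independent set $S$ of $G$ is $c$-maximum if $w(S)\ge c\cdot\max\{w(T): T \text{ independent in } G\}$, and a vertex cover $S$ of $G$ is $c$-minimum if $w(S)\le \frac1c\min\{w(T): T\text{ a vertex cover of } G\}$. For a finite family $\mathcal F_c$ of subsets of $V$, an admissible collection is a $k$-tuple $(S_1,\dots,S_k)$ of members of $\mathcal F_c$ that are pairwise distinct whenever $|\mathcal F_c|\ge k$ (repetitions are allowed if $|\mathcal F_c|<k$); its diversity is $\sum_{i<j}|S_i\,\Delta\,S_j|$. (i) (Diverse $c$-maximum weight independent sets.) Let $\mathcal F_c$ be the family of all $c$-maximum independent sets of $G$. There is a deterministic algorithm that on every input $(p,w,c,k)$ as above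 outputs, in time $O(n^7k^5\log(k+1))$, an admissible collection whose diversity is at least $\left(1-\frac{2}{k+1}\right)$ times the diversity of every admissible collection. (ii) (Diverse $c$-minimum weight vertex covers.) The same holds with $\mathcal F_c$ the family of all $c$-minimum vertex covers of $G$. The constants hidden in the $O$-notation do not depend on $n$, $k$, $c$, the points or the weights. Running time is measured on a real RAM: a fixed program works on real variables and arrays with exact $+,-,\times,\div$ and comparisons, and on integer variables and arrays holding words of $\ell$ bits with the usual word arithmetic and comparisons; arrays are addressed by words, there is no rounding and no conversion between reals and words, and every operation takes unit time. For some constant $a$, the program is correct and meets the time bound for every word length $\ell$ with $2^{\ell}\ge(n+k)^a$. -/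

import Mathlib

/-! ## The machine model: a real RAM, programmed in a small imperative language

Memory consists of word variables, real variables, word arrays and real arrays; arrays are
addressed by words.  Words are `w`-bit nonnegative integers.  Words and reals do not mix: there is no
rounding and no conversion between them.  Every arithmetic operation, memory access, comparison
and assignment takes unit time. -/

namespace RealRAM

/-- The memory: scalar variables and arrays, all named by natural numbers. -/
@[ext]
structure State where
  wvar : ℕ → ℕ
  rvar : ℕ → ℝ
  warr : ℕ → ℕ → ℕ
  rarr : ℕ → ℕ → ℝ

/-- Word expressions; `get A e` reads cell `e` of the word array `A`. -/
inductive WExpr where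
  | const (m : ℕ)
  | var (x : ℕ)
  | get (A : ℕ) (e : WExpr)
  | add (e f : WExpr)
  | sub (e f : WExpr)
  | mul (e f : WExpr)
  | div (e f : WExpr)
  | mod (e f : WExpr)

/-- Real expressions; the only literals are natural numbers.
`get A e` reads cell `e` of the real array `A`. -/
inductive RExpr where
  | const (m : ℕ)
  | var (x : ℕ)
  | get (A : ℕ) (e : WExpr)
  | add (e f : RExpr)
  | sub (e f : RExpr)
  | mul (e f : RExpr)
  | div (e f : RExpr)

/-- Tests. -/
inductive BExpr where
  | wlt (e f : WExpr)
  | weq (e f : WExpr)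
  | rlt (e f : RExpr)
  | rle (e f : RExpr)
  | not (b : BExpr)
  | and (b d : BExpr)
  | or (b d : BExpr)

/-- Commands; `wput A i e` and `rput A i e` write the value of `e` into cell `i` of array `A`. -/
inductive Cmd where
  | skip
  | wset (x : ℕ) (e : WExpr)
  | rset (x : ℕ) (e : RExpr)
  | wput (A : ℕ) (i e : WExpr)
  | rput (A : ℕ) (i : WExpr) (e : RExpr)
  | seq (p q : Cmd)
  | ite (b : BExpr) (p q : Cmd)
  | loop (b : BExpr) (p : Cmd)

/-- Value of a word expression for word length `w`.  Constants, sums and products are reduced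
modulo `2 ^ w`, and subtraction is truncated at `0`. -/
def WExpr.eval (w : ℕ) (s : State) : WExpr → ℕ
  | const m => m % 2 ^ w
  | var x => s.wvar x
  | get A e => s.warr A (e.eval w s)
  | add e f => (e.eval w s + f.eval w s) % 2 ^ w
  | sub e f => e.eval w s - f.eval w s
  | mul e f => (e.eval w s * f.eval w s) % 2 ^ w
  | div e f => e.eval w s / f.eval w s
  | mod e f => e.eval w s % f.eval w s

/-- Number of operations of a word expression. -/
def WExpr.cost : WExpr → ℕ
  | const _ => 1
  | var _ => 1
  | get _ e => e.cost + 1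
  | add e f => e.cost + f.cost + 1
  | sub e f => e.cost + f.cost + 1
  | mul e f => e.cost + f.cost + 1
  | div e f => e.cost + f.cost + 1
  | mod e f => e.cost + f.cost + 1

/-- Value of a real expression, in exact real arithmetic. -/
noncomputable def RExpr.eval (w : ℕ) (s : State) : RExpr → ℝ
  | const m => (m : ℝ)
  | var x => s.rvar x
  | get A e => s.rarr A (e.eval w s)
  | add e f => e.eval w s + f.eval w s
  | sub e f => e.eval w s - f.eval w s
  | mul e f => e.eval w s * f.eval w s
  | div e f => e.eval w s / f.eval w s

/-- Number of operations of a real expression. -/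
def RExpr.cost : RExpr → ℕ
  | const _ => 1
  | var _ => 1
  | get _ e => e.cost + 1
  | add e f => e.cost + f.cost + 1
  | sub e f => e.cost + f.cost + 1
  | mul e f => e.cost + f.cost + 1
  | div e f => e.cost + f.cost + 1

/-- Truth of a test. -/
def BExpr.holds (w : ℕ) (s : State) : BExpr → Prop
  | wlt e f => e.eval w s < f.eval w s
  | weq e f => e.eval w s = f.eval w s
  | rlt e f => e.eval w s < f.eval w s
  | rle e f => e.eval w s ≤ f.eval w s
  | not b => ¬ b.holds w s
  | and b d => b.holds w s ∧ d.holds w s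
  | or b d => b.holds w s ∨ d.holds w s

/-- Number of operations of a test. -/
def BExpr.cost : BExpr → ℕ
  | wlt e f => e.cost + f.cost + 1
  | weq e f => e.cost + f.cost + 1
  | rlt e f => e.cost + f.cost + 1
  | rle e f => e.cost + f.cost + 1
  | not b => b.cost + 1
  | and b d => b.cost + d.cost + 1
  | or b d => b.cost + d.cost + 1

/-- The state after assigning `v` to the word variable `x`. -/
def State.setW (s : State) (x v : ℕ) : State :=
  { s with wvar := Function.update s.wvar x v }

/-- The state after assigning `v` to the real variable `x`. -/
def State.setR (s : State) (x : ℕ) (v : ℝ) : State :=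
  { s with rvar := Function.update s.rvar x v }

/-- The state after writing `v` into cell `i` of the word array `A`. -/
def State.putW (s : State) (A i v : ℕ) : State :=
  { s with warr := Function.update s.warr A (Function.update (s.warr A) i v) }

/-- The state after writing `v` into cell `i` of the real array `A`. -/
def State.putR (s : State) (A i : ℕ) (v : ℝ) : State :=
  { s with rarr := Function.update s.rarr A (Function.update (s.rarr A) i v) }

/-- `Exec w p s s' t`: with word length `w`, the command `p` started in state `s` halts in state
`s'` after `t` units of time. -/
inductive Exec (w : ℕ) : Cmd → State → State → ℕ → Prop
  | skip (s : State) : Exec w Cmd.skip s s 1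
  | wset (s : State) (x : ℕ) (e : WExpr) :
      Exec w (Cmd.wset x e) s (s.setW x (e.eval w s)) (e.cost + 1)
  | rset (s : State) (x : ℕ) (e : RExpr) :
      Exec w (Cmd.rset x e) s (s.setR x (e.eval w s)) (e.cost + 1)
  | wput (s : State) (A : ℕ) (i e : WExpr) :
      Exec w (Cmd.wput A i e) s (s.putW A (i.eval w s) (e.eval w s)) (i.cost + e.cost + 1)
  | rput (s : State) (A : ℕ) (i : WExpr) (e : RExpr) :
      Exec w (Cmd.rput A i e) s (s.putR A (i.eval w s) (e.eval w s)) (i.cost + e.cost + 1)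
  | seq {p q : Cmd} {s s' s'' : State} {t t' : ℕ} :
      Exec w p s s' t → Exec w q s' s'' t' → Exec w (Cmd.seq p q) s s'' (t + t')
  | ite_true {b : BExpr} {p q : Cmd} {s s' : State} {t : ℕ} :
      b.holds w s → Exec w p s s' t → Exec w (Cmd.ite b p q) s s' (b.cost + t + 1)
  | ite_false {b : BExpr} {p q : Cmd} {s s' : State} {t : ℕ} :
      ¬ b.holds w s → Exec w q s s' t → Exec w (Cmd.ite b p q) s s' (b.cost + t + 1)
  | loop_stop {b : BExpr} {p : Cmd} {s : State} :
      ¬ b.holds w s → Exec w (Cmd.loop b p) s s (b.cost + 1)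
  | loop_step {b : BExpr} {p : Cmd} {s s' s'' : State} {t t' : ℕ} :
      b.holds w s → Exec w p s s' t → Exec w (Cmd.loop b p) s' s'' t' →
      Exec w (Cmd.loop b p) s s'' (b.cost + t + t' + 1)

end RealRAM

/-! ## Diverse and nice optimization -/

namespace DiverseOpt

/-- The `c`-optimal solutions of a maximization problem with feasible family `F` and
objective `σ`: objective at least `c` times the maximum. -/
def cMax {V : Type*} (F : Set (Finset V)) (σ : Finset V → ℝ) (c : ℝ) : Set (Finset V) :=
  {S | S ∈ F ∧ ∃ M, IsGreatest (σ '' F) M ∧ c * M ≤ σ S}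

/-- The `c`-optimal solutions of a minimization problem with feasible family `F` and
objective `σ`: objective at most `1 / c` times the minimum. -/
def cMin {V : Type*} (F : Set (Finset V)) (σ : Finset V → ℝ) (c : ℝ) : Set (Finset V) :=
  {S | S ∈ F ∧ ∃ m, IsLeast (σ '' F) m ∧ σ S ≤ (1 / c) * m}

/-- The diversity `∑_{i < j} |S i ∆ S j|` of a collection. -/
def diversity {V : Type*} [DecidableEq V] {k : ℕ} (S : Fin k → Finset V) : ℕ :=
  ∑ i : Fin k, ∑ j ∈ Finset.Ioi i, (symmDiff (S i) (S j)).card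

/-- An admissible collection of `k` members of `Fc`: pairwise distinct whenever `Fc` has at least
`k` members, and otherwise a multiset. -/
def IsCollection {V : Type*} (Fc : Set (Finset V)) {k : ℕ} (S : Fin k → Finset V) : Prop :=
  (∀ i, S i ∈ Fc) ∧ (k ≤ Fc.ncard → Function.Injective S)

/-- An admissible collection whose diversity is at least `β` times the diversity of every
admissible collection. -/
def IsApprox {V : Type*} [DecidableEq V] (Fc : Set (Finset V)) (β : ℝ) {k : ℕ}
    (S : Fin k → Finset V) : Prop :=
  IsCollection Fc S ∧
    ∀ S' : Fin k → Finset V, IsCollection Fc S' →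
      β * (diversity S' : ℝ) ≤ (diversity S : ℝ)

/-- The unit-disk graph of a family of points in the Euclidean plane: two vertices are adjacent
when their points are at distance at most `1`. -/
def unitDiskGraph {V : Type*} (p : V → EuclideanSpace ℝ (Fin 2)) : SimpleGraph V where
  Adj u v := u ≠ v ∧ dist (p u) (p v) ≤ 1
  symm := ⟨fun _ _ h => ⟨h.1.symm, by rw [dist_comm]; exact h.2⟩⟩
  loopless := ⟨fun _ h => h.1 rfl⟩

/-- An instance on `n` vertices: points in convex position (listed in any order), nonnegative
weights, a niceness factor and the number of solutions asked for. -/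
structure UDGInput (n : ℕ) where
  pt : Fin n → EuclideanSpace ℝ (Fin 2)
  convexPosition : ConvexIndependent ℝ pt
  weight : Fin n → ℝ
  weight_nonneg : ∀ v, 0 ≤ weight v
  c : ℝ
  c_pos : 0 < c
  c_le_one : c ≤ 1
  k : ℕ
  one_le_k : 1 ≤ k

namespace UDGInput

variable {n : ℕ} (I : UDGInput n)

/-- The unit-disk graph of the instance. -/
def graph : SimpleGraph (Fin n) := unitDiskGraph I.pt

/-- The total weight of a set of vertices. -/
def totalWeight (S : Finset (Fin n)) : ℝ := ∑ v ∈ S, I.weight v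

/-- The `c`-maximum weight independent sets. -/
def cMWIS : Set (Finset (Fin n)) :=
  cMax {S : Finset (Fin n) | I.graph.IsIndepSet (S : Set (Fin n))} I.totalWeight I.c

/-- The `c`-minimum weight vertex covers. -/
def cMWVC : Set (Finset (Fin n)) :=
  cMin {S : Finset (Fin n) | I.graph.IsVertexCover (S : Set (Fin n))} I.totalWeight I.c

/-- The memory at the start: `n` and `k` in word variables `0` and `1`, the niceness factor in real
variable `0`, and the two coordinates and the weights of the vertices in the first `n` cells of the
real arrays `0`, `1`, `2`; everything else is `0`. -/
noncomputable def initialState : RealRAM.State where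
  wvar x := if x = 0 then n else if x = 1 then I.k else 0
  rvar x := if x = 0 then I.c else 0
  warr _ _ := 0
  rarr A i :=
    if h : i < n then
      if A = 0 then I.pt ⟨i, h⟩ 0
      else if A = 1 then I.pt ⟨i, h⟩ 1
      else if A = 2 then I.weight ⟨i, h⟩
      else 0
    else 0

end UDGInput

/-- The `k` sets written in word array `0`, as a `k × n` incidence matrix stored row by row. -/
def outputSets (n k : ℕ) (s : RealRAM.State) : Fin k → Finset (Fin n) :=
  fun i => Finset.univ.filter fun j : Fin n => s.warr 0 ((i : ℕ) * n + (j : ℕ)) ≠ 0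

/-- The program `P` is a `(1 - 2 / (k + 1))`-approximation algorithm for diverse members of the
solution spaces `Fc`, of running time `O(n ^ 7 * k ^ 5 * log (k + 1))`, on all instances with at
least one vertex.  It works for every word length of at least `a * log₂ (n + k)` bits, `a` being
a constant. -/
def IsApproxAlgorithm (Fc : ∀ {n : ℕ}, UDGInput n → Set (Finset (Fin n)))
    (P : RealRAM.Cmd) : Prop :=
  ∃ (a : ℕ) (C : ℝ), ∀ (n : ℕ) (I : UDGInput n) (w : ℕ), 1 ≤ n → (n + I.k) ^ a ≤ 2 ^ w →
    ∃ (s : RealRAM.State) (t : ℕ),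
      RealRAM.Exec w P I.initialState s t ∧
      (t : ℝ) ≤ C * (n : ℝ) ^ 7 * (I.k : ℝ) ^ 5 * Real.log ((I.k : ℝ) + 1) ∧
      IsApprox (Fc I) (1 - 2 / ((I.k : ℝ) + 1)) (outputSets n I.k s)

end DiverseOpt

/-! ## Program logic -/

namespace RealRAM

/-! Reduction to independent sets. Vertex covers are the complements of independent sets, and
complementation preserves symmetric differences. If W is the total weight and opt the largest weight
of an independent set, a cover is `c`-minimum iff its complement weighs at least W - (W - opt)/c.
Hence both halves of the theorem concern one family F, the independent sets whose weight reaches a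
threshold (`Placed.verticesAt_mem_iff`, `IsApprox.image`).

Approximation ratio. The size of a symmetric difference is the squared Euclidean distance of
indicator vectors, hence of negative type (`sum_card_symmDiff_negType`). Let A be a collection that
no replacement of a single member improves, and let O be any competitor. Adding the local
inequalities over all pairs (member of A, member of O) and bounding the cross sum from below by
negative type gives (k-1) div(O) ≤ (k+1) div(A), which is the factor 1 - 2/(k+1). When members must
be distinct, only members of O outside A may be swapped in; the same summation is done on A \ O and
O \ A, and the triangle inequality pays for the common members
(`SwapOptimal.diversity_le_of_injective`).

One improvement step. With the other members fixed, one needs a set in F maximising the sum of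
distances to them. This sum is additive over vertices, so dynamic programming applies once
independence can be checked with little memory. Here geometry enters. A diametral pair s, t splits
the points into two convex chains, and the points are sorted along st. When a point is added to an
independent set of earlier points, it suffices to test it against the last chosen point of each
chain and the first chosen point of the other chain (`DiametralFrame.far_of_neighbours`). Two facts
carry this. On one chain, the outer two of three points are never strictly the closest pair, because
the angle at the middle point is at least the angle under which it sees st, which is at least 60
degrees. Across chains, a point beyond the segment joining two others, seen from q under an angle of
at most 90 degrees, cannot be closer to q than to both of them. So independent sets are recognised
by an automaton with (n+1)^4 states: the first and the last chosen point on each chain.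

To avoid the other members, a second automaton remembers one of them that agrees with the bits read
so far, or that there is none (`TrieStep`); it has k+1 states. The product automaton has O(n^4 k)
states. A table indexed by the number of remaining bits, the state and the exact gain stores the
largest weight of a completion. Gains are integers of size at most nk and can be an index, while the
weights are arbitrary reals and must be the stored value. The table has O(n^6 k^2) entries, each
computed in constant time, and an optimal set is read off by walking through it.

Running time. An initial collection is built greedily; if no new set is found, F has fewer than k
members and repetitions are allowed. The diversity is at most n k^2 and grows in every round of k
improvement steps except the last, so the total is O(n k^2 · k · n^6 k^2) = O(n^7 k^5); log(k+1) is
merely bounded below by 1/2. All addresses stay below (n+k)^9, which fixes the exponent `a`.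

On the machine, each program fragment gets a `Run` statement (termination, time bound,
postcondition), and memory that is not touched is tracked syntactically by `Frame`. -/

/-- Value of a word expression when no operation overflows. -/
@[simp] def WExpr.nat (s : State) : WExpr → ℕ
  | const m => m
  | var x => s.wvar x
  | get A e => s.warr A (e.nat s)
  | add e f => e.nat s + f.nat s
  | sub e f => e.nat s - f.nat s
  | mul e f => e.nat s * f.nat s
  | div e f => e.nat s / f.nat s
  | mod e f => e.nat s % f.nat s

/-- No operation of a word expression overflows. -/
@[simp] def WExpr.Ok (w : ℕ) (s : State) : WExpr → Prop
  | const m => m < 2 ^ w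
  | var _ => True
  | get _ e => e.Ok w s
  | add e f => e.Ok w s ∧ f.Ok w s ∧ e.nat s + f.nat s < 2 ^ w
  | sub e f => e.Ok w s ∧ f.Ok w s
  | mul e f => e.Ok w s ∧ f.Ok w s ∧ e.nat s * f.nat s < 2 ^ w
  | div e f => e.Ok w s ∧ f.Ok w s
  | mod e f => e.Ok w s ∧ f.Ok w s

theorem WExpr.eval_eq {w : ℕ} {s : State} {e : WExpr} (h : e.Ok w s) :
    e.eval w s = e.nat s := by
  induction e with
  | const m => exact Nat.mod_eq_of_lt h
  | var x => rfl
  | get A e ih => simp only [eval, nat, ih h]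
  | add e f ihe ihf =>
    simp only [eval, nat, ihe h.1, ihf h.2.1]; exact Nat.mod_eq_of_lt h.2.2
  | sub e f ihe ihf => simp only [eval, nat, ihe h.1, ihf h.2]
  | mul e f ihe ihf =>
    simp only [eval, nat, ihe h.1, ihf h.2.1]; exact Nat.mod_eq_of_lt h.2.2
  | div e f ihe ihf => simp only [eval, nat, ihe h.1, ihf h.2]
  | mod e f ihe ihf => simp only [eval, nat, ihe h.1, ihf h.2]

/-- Value of a real expression when no address computation overflows. -/
@[simp] noncomputable def RExpr.val (s : State) : RExpr → ℝ
  | const m => (m : ℝ)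
  | var x => s.rvar x
  | get A e => s.rarr A (e.nat s)
  | add e f => e.val s + f.val s
  | sub e f => e.val s - f.val s
  | mul e f => e.val s * f.val s
  | div e f => e.val s / f.val s

/-- No address computation of a real expression overflows. -/
@[simp] def RExpr.Ok (w : ℕ) (s : State) : RExpr → Prop
  | const _ => True
  | var _ => True
  | get _ e => e.Ok w s
  | add e f => e.Ok w s ∧ f.Ok w s
  | sub e f => e.Ok w s ∧ f.Ok w s
  | mul e f => e.Ok w s ∧ f.Ok w s
  | div e f => e.Ok w s ∧ f.Ok w s

theorem RExpr.eval_eq {w : ℕ} {s : State} {e : RExpr} (h : e.Ok w s) :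
    e.eval w s = e.val s := by
  induction e with
  | const m => rfl
  | var x => rfl
  | get A e => simp only [eval, val, WExpr.eval_eq h]
  | add e f ihe ihf => simp only [eval, val, ihe h.1, ihf h.2]
  | sub e f ihe ihf => simp only [eval, val, ihe h.1, ihf h.2]
  | mul e f ihe ihf => simp only [eval, val, ihe h.1, ihf h.2]
  | div e f ihe ihf => simp only [eval, val, ihe h.1, ihf h.2]

/-- Truth of a test when nothing overflows. -/
@[simp] def BExpr.val (s : State) : BExpr → Prop
  | wlt e f => e.nat s < f.nat s
  | weq e f => e.nat s = f.nat s
  | rlt e f => e.val s < f.val s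
  | rle e f => e.val s ≤ f.val s
  | not b => ¬ b.val s
  | and b d => b.val s ∧ d.val s
  | or b d => b.val s ∨ d.val s

/-- Nothing that decides a test overflows. -/
@[simp] def BExpr.Ok (w : ℕ) (s : State) : BExpr → Prop
  | wlt e f => e.Ok w s ∧ f.Ok w s
  | weq e f => e.Ok w s ∧ f.Ok w s
  | rlt e f => e.Ok w s ∧ f.Ok w s
  | rle e f => e.Ok w s ∧ f.Ok w s
  | not b => b.Ok w s
  | and b d => b.Ok w s ∧ (b.val s → d.Ok w s)
  | or b d => b.Ok w s ∧ (¬ b.val s → d.Ok w s)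

theorem BExpr.holds_iff {w : ℕ} {s : State} {b : BExpr} (h : b.Ok w s) :
    b.holds w s ↔ b.val s := by
  induction b with
  | wlt e f => simp only [holds, val, WExpr.eval_eq h.1, WExpr.eval_eq h.2]
  | weq e f => simp only [holds, val, WExpr.eval_eq h.1, WExpr.eval_eq h.2]
  | rlt e f => simp only [holds, val, RExpr.eval_eq h.1, RExpr.eval_eq h.2]
  | rle e f => simp only [holds, val, RExpr.eval_eq h.1, RExpr.eval_eq h.2]
  | not b ih => simp only [holds, val, ih h]
  | and b d ihb ihd =>
    simp only [holds, val, ihb h.1]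
    -- A wrapped-around value in the second operand is harmless when the first operand already
    -- decides the test.
    exact and_congr_right fun hb => ihd (h.2 hb)
  | or b d ihb ihd =>
    simp only [holds, val, ihb h.1]
    by_cases hb : b.val s
    · simp [hb]
    · simp [hb, ihd (h.2 hb)]

/-! ### Weakest preconditions and timed runs. -/

/-- Weakest precondition of a loop-free program, including the absence of overflow. -/
@[simp] def Cmd.wp (w : ℕ) : Cmd → (State → Prop) → State → Prop
  | skip, Q, s => Q s
  | wset x e, Q, s => e.Ok w s ∧ Q (s.setW x (e.nat s))
  | rset x e, Q, s => e.Ok w s ∧ Q (s.setR x (e.val s))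
  | wput A i e, Q, s => i.Ok w s ∧ e.Ok w s ∧ Q (s.putW A (i.nat s) (e.nat s))
  | rput A i e, Q, s => i.Ok w s ∧ e.Ok w s ∧ Q (s.putR A (i.nat s) (e.val s))
  | seq p q, Q, s => p.wp w (q.wp w Q) s
  | ite b p q, Q, s => b.Ok w s ∧ (b.val s → p.wp w Q s) ∧ (¬ b.val s → q.wp w Q s)
  | loop _ _, _, _ => False

theorem Cmd.wp_mono {w : ℕ} {p : Cmd} {Q Q' : State → Prop} {s : State}
    (h : p.wp w Q s) (hQ : ∀ s', Q s' → Q' s') : p.wp w Q' s := by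
  induction p generalizing Q Q' s with
  | skip => exact hQ _ h
  | wset x e => exact ⟨h.1, hQ _ h.2⟩
  | rset x e => exact ⟨h.1, hQ _ h.2⟩
  | wput A i e => exact ⟨h.1, h.2.1, hQ _ h.2.2⟩
  | rput A i e => exact ⟨h.1, h.2.1, hQ _ h.2.2⟩
  | seq p q ihp ihq => exact ihp h fun s' h' => ihq h' hQ
  | ite b p q ihp ihq => exact ⟨h.1, fun hb => ihp (h.2.1 hb) hQ, fun hb => ihq (h.2.2 hb) hQ⟩
  | loop b p => exact h.elim

/-- Upper bound on the running time of a loop-free program. -/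
def Cmd.cst : Cmd → ℕ
  | skip => 1
  | wset _ e => e.cost + 1
  | rset _ e => e.cost + 1
  | wput _ i e => i.cost + e.cost + 1
  | rput _ i e => i.cost + e.cost + 1
  | seq p q => p.cst + q.cst
  | ite b p q => b.cost + max p.cst q.cst + 1
  | loop _ _ => 0

/-- The program halts within time `T` in a state satisfying `Q`. -/
def Run (w : ℕ) (p : Cmd) (s : State) (T : ℕ) (Q : State → Prop) : Prop :=
  ∃ s' t, Exec w p s s' t ∧ t ≤ T ∧ Q s'

/-- The bound charges the dearer branch of every test, so it does not depend on the state and can be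
evaluated by `decide` for concrete programs. -/
theorem Run.of_wp {w : ℕ} {p : Cmd} {s : State} {T : ℕ} {Q : State → Prop}
    (h : p.wp w Q s) (hT : p.cst ≤ T) : Run w p s T Q := by
  induction p generalizing s T Q with
  | skip => exact ⟨s, 1, .skip s, hT, h⟩
  | wset x e => exact ⟨_, _, .wset s x e, hT, by rw [WExpr.eval_eq h.1]; exact h.2⟩
  | rset x e => exact ⟨_, _, .rset s x e, hT, by rw [RExpr.eval_eq h.1]; exact h.2⟩
  | wput A i e =>
    exact ⟨_, _, .wput s A i e, hT, by rw [WExpr.eval_eq h.1, WExpr.eval_eq h.2.1]; exact h.2.2⟩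
  | rput A i e =>
    exact ⟨_, _, .rput s A i e, hT, by rw [WExpr.eval_eq h.1, RExpr.eval_eq h.2.1]; exact h.2.2⟩
  | seq p q ihp ihq =>
    obtain ⟨s₁, t₁, e₁, l₁, h₁⟩ := ihp h le_rfl
    obtain ⟨s₂, t₂, e₂, l₂, h₂⟩ := ihq h₁ le_rfl
    exact ⟨s₂, _, .seq e₁ e₂, (add_le_add l₁ l₂).trans hT, h₂⟩
  | ite b p q ihp ihq =>
    simp only [Cmd.cst] at hT
    by_cases hb : b.val s
    · obtain ⟨s₁, t₁, e₁, l₁, h₁⟩ := ihp (h.2.1 hb) le_rfl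
      exact ⟨s₁, _, .ite_true ((BExpr.holds_iff h.1).2 hb) e₁, by omega, h₁⟩
    · obtain ⟨s₁, t₁, e₁, l₁, h₁⟩ := ihq (h.2.2 hb) le_rfl
      exact ⟨s₁, _, .ite_false (fun hh => hb ((BExpr.holds_iff h.1).1 hh)) e₁, by omega, h₁⟩
  | loop b p => exact h.elim

theorem Run.mono {w : ℕ} {p : Cmd} {s : State} {T T' : ℕ} {Q Q' : State → Prop}
    (h : Run w p s T Q) (hT : T ≤ T') (hQ : ∀ s', Q s' → Q' s') : Run w p s T' Q' := by
  obtain ⟨s', t, e, l, q⟩ := h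
  exact ⟨s', t, e, l.trans hT, hQ _ q⟩

/-! ### Frames: the memory a program cannot change. -/

/-- Does the program assign to word variable `x`? -/
def Cmd.writesW (x : ℕ) : Cmd → Bool
  | wset y _ => x == y
  | seq p q => p.writesW x || q.writesW x
  | ite _ p q => p.writesW x || q.writesW x
  | loop _ p => p.writesW x
  | _ => false

/-- Does the program assign to real variable `x`? -/
def Cmd.writesR (x : ℕ) : Cmd → Bool
  | rset y _ => x == y
  | seq p q => p.writesR x || q.writesR x
  | ite _ p q => p.writesR x || q.writesR x
  | loop _ p => p.writesR x
  | _ => false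

/-- Does the program write to word array `A`? -/
def Cmd.writesWA (A : ℕ) : Cmd → Bool
  | wput B _ _ => A == B
  | seq p q => p.writesWA A || q.writesWA A
  | ite _ p q => p.writesWA A || q.writesWA A
  | loop _ p => p.writesWA A
  | _ => false

/-- Does the program write to real array `A`? -/
def Cmd.writesRA (A : ℕ) : Cmd → Bool
  | rput B _ _ => A == B
  | seq p q => p.writesRA A || q.writesRA A
  | ite _ p q => p.writesRA A || q.writesRA A
  | loop _ p => p.writesRA A
  | _ => false

/-- The memory outside what `p` may write is unchanged. -/
structure Frame (p : Cmd) (s s' : State) : Prop where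
  w : ∀ x, p.writesW x = false → s'.wvar x = s.wvar x
  r : ∀ x, p.writesR x = false → s'.rvar x = s.rvar x
  wa : ∀ A, p.writesWA A = false → s'.warr A = s.warr A
  ra : ∀ A, p.writesRA A = false → s'.rarr A = s.rarr A

theorem Frame.refl (p : Cmd) (s : State) : Frame p s s :=
  ⟨fun _ _ => rfl, fun _ _ => rfl, fun _ _ => rfl, fun _ _ => rfl⟩

theorem Frame.trans {p : Cmd} {s s' s'' : State} (h : Frame p s s') (h' : Frame p s' s'') :
    Frame p s s'' :=
  ⟨fun x hx => (h'.w x hx).trans (h.w x hx), fun x hx => (h'.r x hx).trans (h.r x hx),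
    fun x hx => (h'.wa x hx).trans (h.wa x hx), fun x hx => (h'.ra x hx).trans (h.ra x hx)⟩

theorem Frame.mono {p q : Cmd} {s s' : State} (h : Frame p s s')
    (hw : ∀ x, q.writesW x = false → p.writesW x = false)
    (hr : ∀ x, q.writesR x = false → p.writesR x = false)
    (hwa : ∀ x, q.writesWA x = false → p.writesWA x = false)
    (hra : ∀ x, q.writesRA x = false → p.writesRA x = false) : Frame q s s' :=
  ⟨fun x hx => h.w x (hw x hx), fun x hx => h.r x (hr x hx),
    fun x hx => h.wa x (hwa x hx), fun x hx => h.ra x (hra x hx)⟩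

/-- Write sets are computed from the syntax, so for concrete programs the side conditions of a frame
hold by `rfl`. -/
theorem Exec.frame {w : ℕ} {p : Cmd} {s s' : State} {t : ℕ} (h : Exec w p s s' t) :
    Frame p s s' := by
  induction h with
  | skip s => exact .refl _ _
  | wset s x e =>
    refine ⟨fun y hy => ?_, fun _ _ => rfl, fun _ _ => rfl, fun _ _ => rfl⟩
    simp only [Cmd.writesW, beq_eq_false_iff_ne] at hy
    simp [State.setW, hy]
  | rset s x e =>
    refine ⟨fun _ _ => rfl, fun y hy => ?_, fun _ _ => rfl, fun _ _ => rfl⟩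
    simp only [Cmd.writesR, beq_eq_false_iff_ne] at hy
    simp [State.setR, hy]
  | wput s A i e =>
    refine ⟨fun _ _ => rfl, fun _ _ => rfl, fun y hy => ?_, fun _ _ => rfl⟩
    simp only [Cmd.writesWA, beq_eq_false_iff_ne] at hy
    simp [State.putW, hy]
  | rput s A i e =>
    refine ⟨fun _ _ => rfl, fun _ _ => rfl, fun _ _ => rfl, fun y hy => ?_⟩
    simp only [Cmd.writesRA, beq_eq_false_iff_ne] at hy
    simp [State.putR, hy]
  | seq _ _ ih₁ ih₂ =>
    refine (ih₁.mono ?_ ?_ ?_ ?_).trans (ih₂.mono ?_ ?_ ?_ ?_) <;> intro x hx <;>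
      simp_all [Cmd.writesW, Cmd.writesR, Cmd.writesWA, Cmd.writesRA]
  | ite_true _ _ ih =>
    refine ih.mono ?_ ?_ ?_ ?_ <;> intro x hx <;>
      simp_all [Cmd.writesW, Cmd.writesR, Cmd.writesWA, Cmd.writesRA]
  | ite_false _ _ ih =>
    refine ih.mono ?_ ?_ ?_ ?_ <;> intro x hx <;>
      simp_all [Cmd.writesW, Cmd.writesR, Cmd.writesWA, Cmd.writesRA]
  | loop_stop _ => exact .refl _ _
  | loop_step _ _ _ ih₁ ih₂ =>
    exact Frame.trans (p := Cmd.loop _ _)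
      (ih₁.mono (fun _ h => h) (fun _ h => h) (fun _ h => h) (fun _ h => h)) ih₂

theorem Run.frame {w : ℕ} {p : Cmd} {s : State} {T : ℕ} {Q : State → Prop}
    (h : Run w p s T Q) : Run w p s T (fun s' => Q s' ∧ Frame p s s') := by
  obtain ⟨s', t, e, l, q⟩ := h
  exact ⟨s', t, e, l, q, e.frame⟩

/-- The second program is analysed together with the frame of the first, so the intermediate
assertion `R` only needs to describe what `p` changed. -/
theorem Run.seq {w : ℕ} {p q : Cmd} {s : State} {T₁ T₂ T : ℕ} {R Q : State → Prop}
    (hp : Run w p s T₁ R) (hq : ∀ s', R s' → Frame p s s' → Run w q s' T₂ Q)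
    (hT : T₁ + T₂ ≤ T) : Run w (Cmd.seq p q) s T Q := by
  obtain ⟨s₁, t₁, e₁, l₁, h₁⟩ := hp
  obtain ⟨s₂, t₂, e₂, l₂, h₂⟩ := hq s₁ h₁ e₁.frame
  exact ⟨s₂, _, .seq e₁ e₂, (add_le_add l₁ l₂).trans hT, h₂⟩

theorem Run.ite {w : ℕ} {b : BExpr} {p q : Cmd} {s : State} {T T' : ℕ} {Q : State → Prop}
    (hb : b.Ok w s) (hp : b.val s → Run w p s T Q) (hq : ¬ b.val s → Run w q s T Q)
    (hT : b.cost + T + 1 ≤ T') : Run w (Cmd.ite b p q) s T' Q := by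
  by_cases h : b.val s
  · obtain ⟨s₁, t₁, e₁, l₁, h₁⟩ := hp h
    exact ⟨s₁, _, .ite_true ((BExpr.holds_iff hb).2 h) e₁, by omega, h₁⟩
  · obtain ⟨s₁, t₁, e₁, l₁, h₁⟩ := hq h
    exact ⟨s₁, _, .ite_false (fun hh => h ((BExpr.holds_iff hb).1 hh)) e₁, by omega, h₁⟩

/-! ### Loop rules. -/

/-- A loop with invariant `I` and strictly decreasing measure `μ`. -/
theorem Run.while {w : ℕ} {b : BExpr} {p : Cmd} {s : State} {Tb : ℕ} (I : State → Prop)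
    (μ : State → ℕ) (hok : ∀ s', I s' → b.Ok w s')
    (hb : ∀ s', I s' → b.val s' → Run w p s' Tb (fun s'' => I s'' ∧ μ s'' < μ s'))
    (h0 : I s) :
    Run w (Cmd.loop b p) s (μ s * (Tb + b.cost + 1) + b.cost + 1)
      (fun s' => I s' ∧ ¬ b.val s') := by
  induction hm : μ s using Nat.strong_induction_on generalizing s with
  | _ m ih =>
    subst hm
    by_cases h : b.val s
    · obtain ⟨s₁, t₁, e₁, l₁, h₁, hlt⟩ := hb s h0 h
      obtain ⟨s₂, t₂, e₂, l₂, h₂⟩ := ih _ hlt h₁ rfl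
      refine ⟨s₂, _, Exec.loop_step ((BExpr.holds_iff (hok s h0)).2 h) e₁ e₂, ?_, h₂⟩
      have : (μ s₁ + 1) * (Tb + b.cost + 1) ≤ μ s * (Tb + b.cost + 1) :=
        Nat.mul_le_mul_right _ hlt
      rw [add_mul, one_mul] at this
      omega
    · exact ⟨s, _, Exec.loop_stop (fun hh => h ((BExpr.holds_iff (hok s h0)).1 hh)), by omega, h0, h⟩

@[simp] theorem State.setW_wvar (s : State) (x v y : ℕ) :
    (s.setW x v).wvar y = if y = x then v else s.wvar y := by
  simp [State.setW, Function.update_apply]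
@[simp] theorem State.setW_rvar (s : State) (x v : ℕ) : (s.setW x v).rvar = s.rvar := rfl
@[simp] theorem State.setW_warr (s : State) (x v : ℕ) : (s.setW x v).warr = s.warr := rfl
@[simp] theorem State.setW_rarr (s : State) (x v : ℕ) : (s.setW x v).rarr = s.rarr := rfl
@[simp] theorem State.setR_rvar (s : State) (x : ℕ) (v : ℝ) (y : ℕ) :
    (s.setR x v).rvar y = if y = x then v else s.rvar y := by
  simp [State.setR, Function.update_apply]
@[simp] theorem State.setR_wvar (s : State) (x : ℕ) (v : ℝ) : (s.setR x v).wvar = s.wvar := rfl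
@[simp] theorem State.setR_warr (s : State) (x : ℕ) (v : ℝ) : (s.setR x v).warr = s.warr := rfl
@[simp] theorem State.setR_rarr (s : State) (x : ℕ) (v : ℝ) : (s.setR x v).rarr = s.rarr := rfl
@[simp] theorem State.putW_wvar (s : State) (A i v : ℕ) : (s.putW A i v).wvar = s.wvar := rfl
@[simp] theorem State.putW_rvar (s : State) (A i v : ℕ) : (s.putW A i v).rvar = s.rvar := rfl
@[simp] theorem State.putW_rarr (s : State) (A i v : ℕ) : (s.putW A i v).rarr = s.rarr := rfl
@[simp] theorem State.putW_warr (s : State) (A i v B j : ℕ) :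
    (s.putW A i v).warr B j = if B = A ∧ j = i then v else s.warr B j := by
  by_cases h : B = A
  · subst h; by_cases h' : j = i <;> simp [State.putW, h']
  · simp [State.putW, h]
@[simp] theorem State.putR_rarr (s : State) (A i : ℕ) (v : ℝ) (B j : ℕ) :
    (s.putR A i v).rarr B j = if B = A ∧ j = i then v else s.rarr B j := by
  by_cases h : B = A
  · subst h; by_cases h' : j = i <;> simp [State.putR, h']
  · simp [State.putR, h]

/-- `for x := 0 to y - 1 do body`, where `x` and `y` are word variables. -/
def forLoop (x y : ℕ) (body : Cmd) : Cmd :=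
  .seq (.wset x (.const 0))
    (.loop (.wlt (.var x) (.var y)) (.seq body (.wset x (.add (.var x) (.const 1)))))

/-- The invariant with index `i` is required of the state in which the counter has already been set
to `i`, whence the `setW` in `h0` and `hb`. The body also receives the frame of the whole loop
relative to the start. The 8 pays for the test and the increment of one pass; the extra pass in the
bound pays for the initialisation and the final test. -/
theorem Run.forLoop {w x y : ℕ} {body : Cmd} {s : State} {T Tb : ℕ} {Q : State → Prop}
    (I : ℕ → State → Prop)
    (hx : body.writesW x = false) (hy : (RealRAM.forLoop x y body).writesW y = false)
    (hm : s.wvar y < 2 ^ w)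
    (h0 : I 0 (s.setW x 0))
    (hb : ∀ i s', i < s.wvar y → Frame (RealRAM.forLoop x y body) s s' → s'.wvar x = i → I i s' →
      Run w body s' Tb (fun s'' => I (i + 1) (s''.setW x (i + 1))))
    (hT : (s.wvar y + 1) * (Tb + 8) ≤ T)
    (hQ : ∀ s', Frame (RealRAM.forLoop x y body) s s' → s'.wvar x = s.wvar y →
      I (s.wvar y) s' → Q s') :
    Run w (RealRAM.forLoop x y body) s T Q := by
  set m := s.wvar y with hmdef
  have hw : 1 ≤ m → 1 < 2 ^ w := fun h => lt_of_le_of_lt h hm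
  have key : Run w (.loop (.wlt (.var x) (.var y)) (.seq body (.wset x (.add (.var x) (.const 1)))))
      (s.setW x 0) (m * (Tb + 8) + 4) (fun s' => (Frame (RealRAM.forLoop x y body) s s' ∧
        s'.wvar x ≤ m ∧ I (s'.wvar x) s') ∧
        ¬ (BExpr.wlt (.var x) (.var y)).val s') := by
    have hfr0 : Frame (RealRAM.forLoop x y body) s (s.setW x 0) := by
      refine ⟨fun z hz => ?_, fun _ _ => rfl, fun _ _ => rfl, fun _ _ => rfl⟩
      simp only [RealRAM.forLoop, Cmd.writesW, Bool.or_eq_false_iff, beq_eq_false_iff_ne] at hz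
      simp [hz.1]
    have := Run.while (w := w) (b := .wlt (.var x) (.var y))
      (p := .seq body (.wset x (.add (.var x) (.const 1)))) (s := s.setW x 0) (Tb := Tb + 4)
      (fun s' => Frame (RealRAM.forLoop x y body) s s' ∧ s'.wvar x ≤ m ∧ I (s'.wvar x) s')
      (fun s' => m - s'.wvar x) (fun _ _ => ⟨trivial, trivial⟩) ?_ ?_
    · refine this.mono ?_ (fun s' h => h)
      simp [BExpr.cost, WExpr.cost]
    · rintro s' ⟨hF, hle, hI⟩ hlt
      simp only [BExpr.val, WExpr.nat, hF.w y hy, ← hmdef] at hlt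
      refine Run.seq (hb _ s' hlt hF rfl hI) (T₂ := 4)
        (R := fun s'' => I (s'.wvar x + 1) (s''.setW x (s'.wvar x + 1))) ?_ le_rfl
      intro s'' hI' hF'
      have hxx := hF'.w x hx
      refine Run.of_wp ?_ (by simp [Cmd.cst, WExpr.cost])
      have hF'' : Frame (RealRAM.forLoop x y body) s (s''.setW x (s''.wvar x + 1)) := by
        refine hF.trans (Frame.trans (hF'.mono ?_ ?_ ?_ ?_) (s' := s'') ⟨fun z hz => ?_, ?_, ?_, ?_⟩)
        all_goals first
          | (intro z hz
             simp_all [RealRAM.forLoop, Cmd.writesW, Cmd.writesR, Cmd.writesWA, Cmd.writesRA])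
          | (simp only [RealRAM.forLoop, Cmd.writesW, Bool.or_eq_false_iff,
               beq_eq_false_iff_ne] at hz
             simp [hz.1])
      refine ⟨⟨trivial, hw (by omega), ?_⟩, ⟨hF'', ?_, ?_⟩, ?_⟩
      · simp only [WExpr.nat]; omega
      · simp; omega
      · simpa [hxx] using hI'
      · simp; omega
    · exact ⟨hfr0, by simp, by simpa using h0⟩
  obtain ⟨s', t, e, l, ⟨hF, hle, hI⟩, hn⟩ := key
  have he : s'.wvar x = m := by
    simp only [BExpr.val, WExpr.nat, hF.w y hy] at hn; omega
  refine ⟨s', _, .seq (.wset s x (.const 0)) (by simpa [WExpr.eval] using e), ?_,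
    hQ s' hF he (he ▸ hI)⟩
  simp only [WExpr.cost]
  rw [add_mul] at hT
  omega

/-- Fill a word table: if for each `t` the program `body` leaves in variable `v` a value with the
property `P t`, then the loop leaves such values in the first cells of `A`. -/
theorem Run.fillW {w x y v A : ℕ} {body : Cmd} {s : State} {T Tb : ℕ} {Q : State → Prop}
    (P : ℕ → ℕ → Prop)
    (hx : body.writesW x = false) (hA : body.writesWA A = false)
    (hy : (RealRAM.forLoop x y (.seq body (.wput A (.var x) (.var v)))).writesW y = false)
    (hm : s.wvar y < 2 ^ w)
    (hb : ∀ t s', t < s.wvar y →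
      Frame (RealRAM.forLoop x y (.seq body (.wput A (.var x) (.var v)))) s s' →
      s'.wvar x = t → (∀ t' < t, P t' (s'.warr A t')) → (∀ t', t ≤ t' → s'.warr A t' = s.warr A t') →
      Run w body s' Tb (fun s'' => P t (s''.wvar v)))
    (hT : (s.wvar y + 1) * (Tb + 11) ≤ T)
    (hQ : ∀ s', Frame (RealRAM.forLoop x y (.seq body (.wput A (.var x) (.var v)))) s s' →
      (∀ t < s.wvar y, P t (s'.warr A t)) →
      (∀ t, s.wvar y ≤ t → s'.warr A t = s.warr A t) → Q s') :
    Run w (RealRAM.forLoop x y (.seq body (.wput A (.var x) (.var v)))) s T Q := by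
  refine Run.forLoop (Tb := Tb + 3) (fun i s' => (∀ t < i, P t (s'.warr A t)) ∧
    (∀ t, i ≤ t → s'.warr A t = s.warr A t))
    (by simp [Cmd.writesW, hx]) hy hm ⟨by simp, by simp⟩ ?_ hT
    (fun s' hF _ h => hQ s' hF h.1 h.2)
  rintro i s' hi hF hxi ⟨h1, h2⟩
  refine Run.seq (hb i s' hi hF hxi h1 h2) (fun s'' hP hF' => Run.of_wp (T := 3) ?_
    (by simp [Cmd.cst, WExpr.cost])) le_rfl
  have hA' := hF'.wa A hA
  have hx' := hF'.w x hx
  refine ⟨trivial, trivial, ?_, ?_⟩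
  · intro t ht
    simp only [WExpr.nat, State.setW_warr, State.putW_warr, hx', hxi, true_and, hA']
    rcases Nat.lt_succ_iff_lt_or_eq.1 ht with h | h
    · rw [if_neg h.ne]; exact h1 t h
    · subst h; simpa using hP
  · intro t ht
    simp only [WExpr.nat, State.setW_warr, State.putW_warr, hx', hxi, true_and, hA']
    rw [if_neg (by omega)]; exact h2 t (by omega)

/-- Fill a real table; see `Run.fillW`. -/
theorem Run.fillR {w x y v A : ℕ} {body : Cmd} {s : State} {T Tb : ℕ} {Q : State → Prop}
    (P : ℕ → ℝ → Prop)
    (hx : body.writesW x = false) (hA : body.writesRA A = false)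
    (hy : (RealRAM.forLoop x y (.seq body (.rput A (.var x) (.var v)))).writesW y = false)
    (hm : s.wvar y < 2 ^ w)
    (hb : ∀ t s', t < s.wvar y →
      Frame (RealRAM.forLoop x y (.seq body (.rput A (.var x) (.var v)))) s s' →
      s'.wvar x = t → (∀ t' < t, P t' (s'.rarr A t')) →
      Run w body s' Tb (fun s'' => P t (s''.rvar v)))
    (hT : (s.wvar y + 1) * (Tb + 11) ≤ T)
    (hQ : ∀ s', Frame (RealRAM.forLoop x y (.seq body (.rput A (.var x) (.var v)))) s s' →
      (∀ t < s.wvar y, P t (s'.rarr A t)) → Q s') :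
    Run w (RealRAM.forLoop x y (.seq body (.rput A (.var x) (.var v)))) s T Q := by
  refine Run.forLoop (Tb := Tb + 3) (fun i s' => ∀ t < i, P t (s'.rarr A t))
    (by simp [Cmd.writesW, hx]) hy hm (by simp) ?_ hT (fun s' hF _ h => hQ s' hF h)
  intro i s' hi hF hxi h1
  refine Run.seq (hb i s' hi hF hxi h1) (fun s'' hP hF' => Run.of_wp (T := 3) ?_
    (by simp [Cmd.cst, WExpr.cost, RExpr.cost])) le_rfl
  have hA' := hF'.ra A hA
  have hx' := hF'.w x hx
  refine ⟨trivial, trivial, ?_⟩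
  intro t ht
  simp only [WExpr.nat, RExpr.val, State.setW_rarr, State.putR_rarr, hx', hxi, true_and, hA']
  rcases Nat.lt_succ_iff_lt_or_eq.1 ht with h | h
  · rw [if_neg h.ne]; exact h1 t h
  · subst h; simpa using hP

end RealRAM

/-! ## Diversity and local search -/

namespace DiverseOpt

variable {V : Type*} [DecidableEq V]

/-- This is the squared Euclidean distance of the indicator vectors, the source of the negative type
inequality. -/
theorem card_symmDiff_eq_sum [Fintype V] (S T : Finset V) :
    ((symmDiff S T).card : ℝ) =
      ∑ v, ((if v ∈ S then 1 else 0 : ℝ) - if v ∈ T then 1 else 0) ^ 2 := by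
  rw [Finset.card_eq_sum_ones, Nat.cast_sum, ← Finset.sum_filter_add_sum_filter_not Finset.univ
    (fun v => v ∈ symmDiff S T)]
  rw [Finset.sum_eq_zero (s := Finset.univ.filter fun v => v ∉ symmDiff S T), add_zero]
  · refine Finset.sum_congr (by ext; simp) fun v hv => ?_
    simp only [Finset.mem_filter, Finset.mem_univ, true_and, Finset.mem_symmDiff] at hv
    rcases hv with h | h <;> simp [h]
  · intro v hv
    simp only [Finset.mem_filter, Finset.mem_symmDiff, Finset.mem_univ, true_and] at hv
    by_cases h : v ∈ S <;> by_cases h' : v ∈ T <;> simp_all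

theorem card_symmDiff_triangle (S T U : Finset V) :
    (symmDiff S U).card ≤ (symmDiff S T).card + (symmDiff T U).card :=
  (Finset.card_le_card (by simpa using symmDiff_triangle S T U)).trans (Finset.card_union_le _ _)

/-- The symmetric difference is of negative type. -/
theorem sum_card_symmDiff_negType [Fintype V] {ι : Type*} (P Q : Finset ι)
    (hPQ : P.card = Q.card) (f g : ι → Finset V) :
    (∑ i ∈ P, ∑ j ∈ P, ((symmDiff (f i) (f j)).card : ℝ)) +
      ∑ i ∈ Q, ∑ j ∈ Q, ((symmDiff (g i) (g j)).card : ℝ) ≤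
      2 * ∑ i ∈ P, ∑ j ∈ Q, ((symmDiff (f i) (g j)).card : ℝ) := by
  have key : ∀ (A B : Finset ι) (a b : ι → Finset V),
      (∑ i ∈ A, ∑ j ∈ B, ((symmDiff (a i) (b j)).card : ℝ)) = ∑ v,
        ((B.card : ℝ) * (∑ i ∈ A, (if v ∈ a i then 1 else 0 : ℝ)) +
          A.card * (∑ j ∈ B, (if v ∈ b j then 1 else 0 : ℝ)) -
          2 * (∑ i ∈ A, (if v ∈ a i then 1 else 0 : ℝ)) *
            ∑ j ∈ B, (if v ∈ b j then 1 else 0 : ℝ)) := by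
    intro A B a b
    simp_rw [card_symmDiff_eq_sum]
    simp_rw [Finset.sum_comm (s := B)]
    rw [Finset.sum_comm]
    refine Finset.sum_congr rfl fun v _ => ?_
    have : ∀ i j, ((if v ∈ a i then 1 else 0 : ℝ) - if v ∈ b j then 1 else 0) ^ 2 =
        (if v ∈ a i then 1 else 0 : ℝ) + (if v ∈ b j then 1 else 0 : ℝ) -
          2 * (if v ∈ a i then 1 else 0 : ℝ) * (if v ∈ b j then 1 else 0 : ℝ) := by
      intro i j; split_ifs <;> norm_num
    simp_rw [this, Finset.sum_sub_distrib, Finset.sum_add_distrib, Finset.sum_const, nsmul_eq_mul,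
      ← Finset.mul_sum, ← Finset.sum_mul, ← Finset.mul_sum]
  rw [key, key, key, ← Finset.sum_add_distrib, Finset.mul_sum]
  refine Finset.sum_le_sum fun v _ => ?_
  rw [hPQ]
  -- At a vertex lying in a of the sets `f i` and b of the sets `g j`, the difference of the two
  -- sides is 2 (a - b)^2.
  nlinarith [sq_nonneg ((∑ i ∈ P, (if v ∈ f i then 1 else 0 : ℝ)) -
    ∑ j ∈ Q, (if v ∈ g j then 1 else 0 : ℝ))]

theorem two_mul_diversity {k : ℕ} (S : Fin k → Finset V) :
    2 * diversity S = ∑ i, ∑ j, (symmDiff (S i) (S j)).card := by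
  have h : ∀ i : Fin k, ∑ j, (symmDiff (S i) (S j)).card =
      (∑ j ∈ Finset.Ioi i, (symmDiff (S i) (S j)).card) +
        ∑ j ∈ Finset.Iio i, (symmDiff (S i) (S j)).card := by
    intro i
    rw [← Finset.sum_union (by
      rw [Finset.disjoint_left]; intro a; simp only [Finset.mem_Ioi, Finset.mem_Iio]; omega)]
    refine (Finset.sum_subset (Finset.subset_univ _) fun j _ hj => ?_).symm
    have : i = j := by
      simp only [Finset.mem_union, Finset.mem_Ioi, Finset.mem_Iio, not_or, not_lt] at hj
      exact le_antisymm hj.2 hj.1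
    simp [this]
  simp_rw [h, Finset.sum_add_distrib]
  rw [two_mul, diversity]
  congr 1
  rw [Finset.sum_comm' (t' := Finset.univ) (s' := fun j => Finset.Iio j) (by simp)]
  simp_rw [symmDiff_comm]

/-! ### Collections that are optimal under single replacements. -/

/-- No replacement of a single member by an element of `F` (one outside the rest of the collection,
if `distinct`) increases the diversity. -/
def SwapOptimal (F : Set (Finset V)) (distinct : Prop) {k : ℕ} (A : Fin k → Finset V) : Prop :=
  ∀ i, ∀ S ∈ F, (distinct → ∀ j, j ≠ i → S ≠ A j) →
    ∑ j ∈ Finset.univ.erase i, (symmDiff S (A j)).card ≤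
      ∑ j ∈ Finset.univ.erase i, (symmDiff (A i) (A j)).card

/-- Let X be the sum of all distances between members of `O` and of `A`. Summing the local
inequalities over all pairs gives (k-1) X ≤ 2k div(A), and negative type gives div(O) + div(A) ≤ X.
-/
theorem SwapOptimal.diversity_le_of_not_distinct [Fintype V] {F : Set (Finset V)} {k : ℕ}
    {A O : Fin k → Finset V} (hA : SwapOptimal F False A) (hO : ∀ i, O i ∈ F) :
    ((k : ℝ) - 1) * diversity O ≤ (k + 1) * diversity A := by
  have h1 : ∀ i j, (∑ l, ((symmDiff (O j) (A l)).card : ℝ)) - (symmDiff (O j) (A i)).card ≤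
      ∑ l, ((symmDiff (A i) (A l)).card : ℝ) := by
    intro i j
    have := hA i (O j) (hO j) (fun h => h.elim)
    have h2 := Finset.add_sum_erase Finset.univ (fun l => (symmDiff (O j) (A l)).card)
      (Finset.mem_univ i)
    have h3 := Finset.add_sum_erase Finset.univ (fun l => (symmDiff (A i) (A l)).card)
      (Finset.mem_univ i)
    rw [← Nat.cast_sum, ← Nat.cast_sum, ← h2, ← h3]
    push_cast
    have : (∑ j_1 ∈ Finset.univ.erase i, ((symmDiff (O j) (A j_1)).card : ℝ)) ≤
      ∑ j ∈ Finset.univ.erase i, ((symmDiff (A i) (A j)).card : ℝ) := by exact_mod_cast this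
    have := (Nat.cast_nonneg (α := ℝ) (symmDiff (A i) (A i)).card)
    linarith
  have h2 := Finset.sum_le_sum fun i (_ : i ∈ Finset.univ) =>
    Finset.sum_le_sum fun j (_ : j ∈ Finset.univ) => h1 i j
  simp only [Finset.sum_sub_distrib, Finset.sum_const, Finset.card_univ, Fintype.card_fin,
    nsmul_eq_mul, ← Finset.mul_sum] at h2
  have h3 := sum_card_symmDiff_negType Finset.univ Finset.univ rfl O A
  have h4 : (2 * diversity O : ℝ) = ∑ i, ∑ j, ((symmDiff (O i) (O j)).card : ℝ) := by
    exact_mod_cast two_mul_diversity O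
  have h5 : (2 * diversity A : ℝ) = ∑ i, ∑ j, ((symmDiff (A i) (A j)).card : ℝ) := by
    exact_mod_cast two_mul_diversity A
  rw [← h4, ← h5] at h3
  rw [← h5, Finset.sum_comm (f := fun x i => ((symmDiff (O i) (A x)).card : ℝ))] at h2
  rcases Nat.eq_zero_or_pos k with rfl | hk
  · simp [diversity]
  · have hk' : (1 : ℝ) ≤ k := by exact_mod_cast hk
    nlinarith

/-- A member common to both collections can be neither swapped in nor usefully swapped out. The
local inequalities are therefore summed only over `A'` × `O'`, the parts outside the intersection
`C`, and negative type is applied to `A'` and `O'`. The loss from using m = |A'| instead of k is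
recovered by triangle inequalities through `C`. -/
theorem SwapOptimal.diversity_le_of_injective [Fintype V] {F : Set (Finset V)} {k : ℕ}
    {A O : Fin k → Finset V} (hA : SwapOptimal F True A) (hO : ∀ i, O i ∈ F)
    (hAi : Function.Injective A) (hOi : Function.Injective O) :
    ((k : ℝ) - 1) * diversity O ≤ (k + 1) * diversity A := by
  let d : Finset V → Finset V → ℝ := fun S T => ((symmDiff S T).card : ℝ)
  have dcomm : ∀ S T, d S T = d T S := fun S T => by simp only [d, symmDiff_comm]
  let D : Finset (Finset V) → Finset (Finset V) → ℝ := fun P Q => ∑ S ∈ P, ∑ T ∈ Q, d S T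
  have Dcomm : ∀ P Q, D P Q = D Q P := fun P Q => by
    simp only [D]; rw [Finset.sum_comm]; simp_rw [dcomm]
  have Dnn : ∀ P Q, 0 ≤ D P Q := fun P Q =>
    Finset.sum_nonneg fun _ _ => Finset.sum_nonneg fun _ _ => Nat.cast_nonneg _
  set 𝒜 := Finset.univ.image A with h𝒜
  set 𝒪 := Finset.univ.image O with h𝒪
  have hc𝒜 : 𝒜.card = k := by rw [h𝒜, Finset.card_image_of_injective _ hAi]; simp
  have hc𝒪 : 𝒪.card = k := by rw [h𝒪, Finset.card_image_of_injective _ hOi]; simp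
  have hdA : (2 * diversity A : ℝ) = D 𝒜 𝒜 := by
    simp only [D, d, h𝒜]
    rw [Finset.sum_image fun _ _ _ _ h => hAi h]
    simp_rw [Finset.sum_image fun _ _ _ _ h => hAi h]
    exact_mod_cast two_mul_diversity A
  have hdO : (2 * diversity O : ℝ) = D 𝒪 𝒪 := by
    simp only [D, d, h𝒪]
    rw [Finset.sum_image fun _ _ _ _ h => hOi h]
    simp_rw [Finset.sum_image fun _ _ _ _ h => hOi h]
    exact_mod_cast two_mul_diversity O
  set C := 𝒜 ∩ 𝒪 with hC
  set A' := 𝒜 \ 𝒪 with hA'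
  set O' := 𝒪 \ 𝒜 with hO'
  have hAC : Disjoint A' C := by
    rw [Finset.disjoint_left]; intro x; simp only [hA', hC, Finset.mem_sdiff, Finset.mem_inter]
    tauto
  have hOC : Disjoint O' C := by
    rw [Finset.disjoint_left]; intro x; simp only [hO', hC, Finset.mem_sdiff, Finset.mem_inter]
    tauto
  have hAu : 𝒜 = A' ∪ C := by
    ext x; simp only [hA', hC, Finset.mem_union, Finset.mem_sdiff, Finset.mem_inter]; tauto
  have hOu : 𝒪 = O' ∪ C := by
    ext x; simp only [hO', hC, Finset.mem_union, Finset.mem_sdiff, Finset.mem_inter]; tauto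
  have hcA : A'.card + C.card = k := by rw [← Finset.card_union_of_disjoint hAC, ← hAu, hc𝒜]
  have hcO : O'.card + C.card = k := by rw [← Finset.card_union_of_disjoint hOC, ← hOu, hc𝒪]
  have Dadd_right : ∀ P {Q R}, Disjoint Q R → D P (Q ∪ R) = D P Q + D P R := by
    intro P Q R h
    simp only [D]; rw [← Finset.sum_add_distrib]
    exact Finset.sum_congr rfl fun S _ => Finset.sum_union h
  have Dself : ∀ {Q R}, Disjoint Q R → D (Q ∪ R) (Q ∪ R) = D Q Q + 2 * D Q R + D R R := by
    intro Q R h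
    rw [Dadd_right _ h, Dcomm _ Q, Dcomm _ R, Dadd_right _ h, Dadd_right _ h, Dcomm R Q]; ring
  have hloc : ∀ S ∈ A', ∀ T ∈ O', (∑ U ∈ 𝒜, d T U) - d T S ≤ ∑ U ∈ 𝒜, d S U := by
    intro S hS T hT
    obtain ⟨hS1, -⟩ := Finset.mem_sdiff.1 hS
    obtain ⟨hT1, hT2⟩ := Finset.mem_sdiff.1 hT
    obtain ⟨i, -, rfl⟩ := Finset.mem_image.1 hS1
    obtain ⟨j, -, rfl⟩ := Finset.mem_image.1 hT1
    have := hA i (O j) (hO j) (fun _ l _ h => hT2 (h ▸ Finset.mem_image_of_mem _ (Finset.mem_univ _)))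
    have h2 := Finset.add_sum_erase Finset.univ (fun l => d (O j) (A l)) (Finset.mem_univ i)
    have h3 := Finset.add_sum_erase Finset.univ (fun l => d (A i) (A l)) (Finset.mem_univ i)
    rw [h𝒜, Finset.sum_image fun _ _ _ _ h => hAi h, Finset.sum_image fun _ _ _ _ h => hAi h,
      ← h2, ← h3]
    have : (∑ l ∈ Finset.univ.erase i, d (O j) (A l)) ≤ ∑ l ∈ Finset.univ.erase i, d (A i) (A l) := by
      simp only [d]; exact_mod_cast this
    have := (Nat.cast_nonneg (α := ℝ) (symmDiff (A i) (A i)).card)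
    simp only [d] at *
    linarith
  have hm : A'.card = O'.card := by omega
  have e1 : (A'.card : ℝ) * (D O' A' + D O' C) - D O' A' ≤ A'.card * (D A' A' + D A' C) := by
    have h2 := Finset.sum_le_sum fun S (hS : S ∈ A') => Finset.sum_le_sum fun T hT => hloc S hS T hT
    simp only [Finset.sum_sub_distrib, Finset.sum_const, nsmul_eq_mul, ← Finset.mul_sum] at h2
    change (A'.card : ℝ) * D O' 𝒜 - _ ≤ O'.card * D A' 𝒜 at h2
    rw [Finset.sum_comm] at h2
    change (A'.card : ℝ) * D O' 𝒜 - D O' A' ≤ _ at h2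
    rwa [hAu, Dadd_right _ hAC, Dadd_right _ hAC, ← hm] at h2
  have e2 : D O' O' + D A' A' ≤ 2 * D O' A' :=
    sum_card_symmDiff_negType O' A' hm.symm id id
  -- Sum the triangle inequality d(S,T) ≤ d(S,U) + d(U,T) over S, T in `P` and U in `C`.
  have tri : ∀ P, (C.card : ℝ) * D P P ≤ 2 * P.card * D P C := by
    intro P
    have : ∑ S ∈ P, ∑ T ∈ P, ∑ U ∈ C, d S T ≤ ∑ S ∈ P, ∑ T ∈ P, ∑ U ∈ C, (d S U + d T U) := by
      refine Finset.sum_le_sum fun S _ => Finset.sum_le_sum fun T _ => Finset.sum_le_sum fun U _ => ?_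
      rw [dcomm T U]; simp only [d]; exact_mod_cast card_symmDiff_triangle S U T
    simp only [Finset.sum_const, nsmul_eq_mul, Finset.sum_add_distrib, ← Finset.mul_sum] at this
    change (C.card : ℝ) * D P P ≤ P.card * D P C + P.card * D P C at this
    linarith
  have e3 := tri O'
  have e4 := tri A'
  rw [hAu, Dself hAC] at hdA
  rw [hOu, Dself hOC] at hdO
  rw [← hm] at e3
  have hk : (k : ℝ) = A'.card + C.card := by exact_mod_cast hcA.symm
  have n1 := Dnn A' A'
  have n2 := Dnn O' O'
  have n3 := Dnn A' C
  have n4 := Dnn O' C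
  have n5 := Dnn C C
  have n6 : (0 : ℝ) ≤ C.card := Nat.cast_nonneg _
  -- If `A'` is empty, both collections consist of the same sets. Otherwise m can be cancelled at
  -- the end.
  rcases Nat.eq_zero_or_pos A'.card with h0 | hpos
  · have hA0 := Finset.card_eq_zero.1 h0
    have hO0 := Finset.card_eq_zero.1 (hm ▸ h0)
    have : (diversity A : ℝ) = diversity O := by
      have : (2 * diversity A : ℝ) = 2 * diversity O := by rw [hdA, hdO, hA0, hO0]
      linarith
    rw [this]
    have := Nat.cast_nonneg (α := ℝ) (diversity O)
    nlinarith
  · have hm1 : (1 : ℝ) ≤ A'.card := by exact_mod_cast hpos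
    generalize (A'.card : ℝ) = m at *
    generalize (C.card : ℝ) = c at *
    -- Twice `e1`, with the cross term bounded below by (m - 1) times `e2`. The bracket is twice the
    -- excess of the diversity of `O` over that of `A`.
    have f1 : m * (D O' O' + 2 * D O' C - D A' A' - 2 * D A' C) ≤ D A' A' + D O' O' := by
      nlinarith
    -- Since k = m + |C|, the contribution of |C| to the right side is absorbed by `e3` and `e4`.
    have f2 : m * (k * (D O' O' + 2 * D O' C - D A' A' - 2 * D A' C)) ≤
        m * (D O' O' + 2 * D O' C + D A' A' + 2 * D A' C) := by
      have : (k : ℝ) * (m * (D O' O' + 2 * D O' C - D A' A' - 2 * D A' C)) ≤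
          k * (D A' A' + D O' O') := mul_le_mul_of_nonneg_left f1 (by linarith)
      rw [hk] at this ⊢
      nlinarith
    have f3 := le_of_mul_le_mul_left f2 (by linarith)
    nlinarith

/-- The factor is 1 - 2/(k+1) = (k-1)/(k+1), the form supplied by both cases. -/
theorem SwapOptimal.isApprox [Fintype V] {F : Set (Finset V)} {k : ℕ} (hk : 1 ≤ k)
    {A : Fin k → Finset V} {distinct : Prop} (hd : distinct ↔ k ≤ F.ncard)
    (hA : SwapOptimal F distinct A) (hmem : ∀ i, A i ∈ F)
    (hinj : distinct → Function.Injective A) :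
    IsApprox F (1 - 2 / ((k : ℝ) + 1)) A := by
  refine ⟨⟨hmem, fun h => hinj (hd.2 h)⟩, fun O hO => ?_⟩
  have key : ((k : ℝ) - 1) * diversity O ≤ (k + 1) * diversity A := by
    by_cases h : distinct
    · refine SwapOptimal.diversity_le_of_injective ?_ hO.1 (hinj h) (hO.2 (hd.1 h))
      simpa [h] using hA
    · refine SwapOptimal.diversity_le_of_not_distinct ?_ hO.1
      simpa [h] using hA
  have hk' : (0 : ℝ) < k + 1 := by positivity
  have : (1 - 2 / ((k : ℝ) + 1)) = (k - 1) / (k + 1) := by field_simp; ring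
  rw [this, div_mul_eq_mul_div, div_le_iff₀ hk']
  linarith

/-! ### Invariance, size and increments of the diversity. -/

/-- Approximation guarantees are transported by distance-preserving bijections. -/
theorem IsApprox.image {U : Type*} [DecidableEq U] {F : Set (Finset U)} {F' : Set (Finset V)}
    {β : ℝ} {k : ℕ}
    {A : Fin k → Finset U} (φ : Finset U → Finset V) (hφ : Function.Bijective φ)
    (hd : ∀ S T, (symmDiff (φ S) (φ T)).card = (symmDiff S T).card)
    (hF : ∀ S, φ S ∈ F' ↔ S ∈ F) (hA : IsApprox F β A) : IsApprox F' β (fun i => φ (A i)) := by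
  have hF' : F' = φ '' F := by
    ext T
    obtain ⟨S, rfl⟩ := hφ.2 T
    rw [hF, hφ.1.mem_set_image]
  have hcard : F'.ncard = F.ncard := by rw [hF', Set.ncard_image_of_injective _ hφ.1]
  have hdiv : ∀ B : Fin k → Finset U, diversity (fun i => φ (B i)) = diversity B := by
    intro B; simp only [diversity, hd]
  obtain ⟨⟨h1, h2⟩, h3⟩ := hA
  refine ⟨⟨fun i => (hF _).2 (h1 i), fun h => hφ.1.comp (h2 (hcard ▸ h))⟩, fun O hO => ?_⟩
  choose ψ hψ using hφ.2
  have : O = fun i => φ (ψ (O i)) := by funext i; rw [hψ]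
  rw [this, hdiv, hdiv]
  refine h3 _ ⟨fun i => (hF _).1 (by rw [hψ]; exact hO.1 i), fun h i j hij => ?_⟩
  refine hO.2 (hcard ▸ h) ?_
  rw [← hψ (O i), ← hψ (O j)]
  exact congrArg φ hij

theorem diversity_le [Fintype V] {k : ℕ} (A : Fin k → Finset V) :
    diversity A ≤ Fintype.card V * (k * k) := by
  calc diversity A ≤ ∑ _i : Fin k, ∑ _j : Fin k, Fintype.card V := by
        refine Finset.sum_le_sum fun i _ => ?_
        refine (Finset.sum_le_sum_of_subset (Finset.subset_univ _)).trans ?_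
        exact Finset.sum_le_sum fun j _ => Finset.card_le_univ _
    _ = Fintype.card V * (k * k) := by simp; ring

/-- Replacing one member changes the diversity by the change of its distances to the rest. -/
theorem diversity_update {k : ℕ} (A : Fin k → Finset V) (i : Fin k) (S : Finset V) :
    diversity (Function.update A i S) +
        ∑ j ∈ Finset.univ.erase i, (symmDiff (A i) (A j)).card =
      diversity A + ∑ j ∈ Finset.univ.erase i, (symmDiff S (A j)).card := by
  have key : ∀ B : Fin k → Finset V, 2 * diversity B =
      2 * (∑ j ∈ Finset.univ.erase i, (symmDiff (B i) (B j)).card) +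
        ∑ l ∈ Finset.univ.erase i, ∑ j ∈ Finset.univ.erase i, (symmDiff (B l) (B j)).card := by
    intro B
    rw [two_mul_diversity, ← Finset.add_sum_erase _ _ (Finset.mem_univ i),
      ← Finset.add_sum_erase _ _ (Finset.mem_univ i)]
    have : ∀ l, ∑ j, (symmDiff (B l) (B j)).card = (symmDiff (B i) (B l)).card +
        ∑ j ∈ Finset.univ.erase i, (symmDiff (B l) (B j)).card := by
      intro l; rw [← Finset.add_sum_erase _ _ (Finset.mem_univ i), symmDiff_comm]
    simp_rw [this, Finset.sum_add_distrib]
    simp; ring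
  have h1 := key A
  have h2 := key (Function.update A i S)
  have h3 : ∀ T, ∑ j ∈ Finset.univ.erase i, (symmDiff T (Function.update A i S j)).card =
      ∑ j ∈ Finset.univ.erase i, (symmDiff T (A j)).card := by
    intro T
    refine Finset.sum_congr rfl fun j hj => ?_
    rw [Function.update_of_ne (Finset.ne_of_mem_erase hj)]
  have h4 : ∑ l ∈ Finset.univ.erase i, ∑ j ∈ Finset.univ.erase i,
      (symmDiff (Function.update A i S l) (A j)).card =
      ∑ l ∈ Finset.univ.erase i, ∑ j ∈ Finset.univ.erase i, (symmDiff (A l) (A j)).card := by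
    refine Finset.sum_congr rfl fun j hj => ?_
    rw [Function.update_of_ne (Finset.ne_of_mem_erase hj)]
  rw [Function.update_self, h3] at h2
  simp_rw [h3] at h2
  rw [h4] at h2
  omega

end DiverseOpt

/-! ## Points in convex position in the coordinate frame of a diametral pair -/

namespace DiverseOpt

/-- Coordinates `x`, `y` of points in convex position, the pair `s`, `t` being a diameter
on the `x`-axis with `s` at the origin. -/
structure DiametralFrame {ι : Type*} (x y : ι → ℝ) (s t : ι) (l : ℝ) : Prop where
  pos : 0 < l
  xs : x s = 0
  ys : y s = 0
  xt : x t = l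
  yt : y t = 0
  diam : ∀ a b, (x a - x b) ^ 2 + (y a - y b) ^ 2 ≤ l ^ 2
  inj : ∀ a b, x a = x b → y a = y b → a = b
  conv : ∀ a b c, b ≠ a → b ≠ c → b ≠ s → b ≠ t → ∀ α β γ δ : ℝ, 0 ≤ α → 0 ≤ β → 0 ≤ γ → 0 ≤ δ →
    α + β + γ + δ = 1 → x b = α * x a + β * x c + γ * x s + δ * x t →
    y b = α * y a + β * y c + γ * y s + δ * y t → False

namespace DiametralFrame

variable {ι : Type*} {x y : ι → ℝ} {s t : ι} {l : ℝ}

theorem neg (h : DiametralFrame x y s t l) : DiametralFrame x (fun a => -y a) s t l where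
  pos := h.pos
  xs := h.xs
  ys := by simp [h.ys]
  xt := h.xt
  yt := by simp [h.yt]
  diam a b := by have := h.diam a b; nlinarith
  inj a b hx hy := h.inj a b hx (neg_injective hy)
  conv a b c h1 h2 h3 h4 α β γ δ hα hβ hγ hδ hs hx hy :=
    h.conv a b c h1 h2 h3 h4 α β γ δ hα hβ hγ hδ hs hx (by linarith)

/-- The point is within distance `l` of `t`, and that disc lies to the right of `s`; for `x_le` the
roles of `s` and `t` are exchanged. -/
theorem x_nonneg (h : DiametralFrame x y s t l) (a : ι) : 0 ≤ x a := by
  have := h.diam a t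
  rw [h.xt] at this
  nlinarith [h.pos, sq_nonneg (y a - y t), sq_nonneg (x a)]

theorem x_le (h : DiametralFrame x y s t l) (a : ι) : x a ≤ l := by
  have := h.diam a s
  rw [h.xs] at this
  nlinarith [h.pos, sq_nonneg (y a - y s)]

/-- The disc of radius `l` about `s` meets the line x = l only in `t`. -/
theorem eq_t (h : DiametralFrame x y s t l) {a : ι} (ha : x a = l) : a = t := by
  have := h.diam a s
  rw [h.xs, h.ys, ha] at this
  have : y a = 0 := by nlinarith
  exact h.inj a t (ha.trans h.xt.symm) (this.trans h.yt.symm)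

theorem eq_s (h : DiametralFrame x y s t l) {a : ι} (ha : x a = 0) : a = s := by
  have := h.diam a t
  rw [h.xt, h.yt, ha] at this
  have : y a = 0 := by nlinarith
  exact h.inj a s (ha.trans h.xs.symm) (this.trans h.ys.symm)

/-- A point on the upper side lies strictly above every chord that spans it. -/
theorem cross_neg (h : DiametralFrame x y s t l) {a b c : ι} (hab : x a < x b) (hbc : x b ≤ x c)
    (hne : b ≠ c) (hb : 0 ≤ y b) :
    (x b - x a) * (y c - y a) - (y b - y a) * (x c - x a) < 0 := by
  by_contra hcon
  rw [not_lt] at hcon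
  have hl := h.pos
  have hxa := h.x_nonneg a
  have hxb := h.x_le b
  have hac : 0 < x c - x a := by linarith
  have hbs : b ≠ s := by rintro rfl; rw [h.xs] at hab; linarith
  have hbt : b ≠ t := by
    rintro rfl
    exact hne (h.eq_t (le_antisymm (h.x_le c) (by rw [← h.xt]; exact hbc))).symm
  have hba : b ≠ a := by rintro rfl; exact lt_irrefl _ hab
  set lam := (x b - x a) / (x c - x a) with hlam
  have hl0 : 0 ≤ lam := div_nonneg (by linarith) hac.le
  have hl1 : lam ≤ 1 := (div_le_one hac).2 (by linarith)
  have hlx : x b = (1 - lam) * x a + lam * x c := by rw [hlam]; field_simp; ring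
  set mu := x b / l with hmu
  have hm0 : 0 ≤ mu := div_nonneg (by linarith) hl.le
  have hm1 : mu ≤ 1 := (div_le_one hl).2 hxb
  have hmx : x b = mu * l := by rw [hmu]; field_simp
  -- If the claim fails, `b` lies between the axis and the chord `ac`: its height is a fraction `r`
  -- of the height of the chord above the same abscissa. The case of height 0 is separate because
  -- the chord may then have height 0 as well.
  obtain ⟨r, hr0, hr1, hr⟩ : ∃ r : ℝ, 0 ≤ r ∧ r ≤ 1 ∧
      y b = r * ((1 - lam) * y a + lam * y c) := by
    have hle : y b ≤ (1 - lam) * y a + lam * y c := by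
      have : (1 - lam) * y a + lam * y c - y b =
          ((x b - x a) * (y c - y a) - (y b - y a) * (x c - x a)) / (x c - x a) := by
        rw [hlam]; field_simp; ring
      have := div_nonneg hcon hac.le
      linarith
    rcases hb.eq_or_lt with h0 | h0
    · exact ⟨0, le_rfl, zero_le_one, by rw [← h0]; ring⟩
    · have h1 := h0.trans_le hle
      exact ⟨_, div_nonneg hb h1.le, (div_le_one h1).2 hle, by field_simp⟩
  -- Thus `b` is r times the point of the chord plus (1 - r) times its foot on the segment `st`, a
  -- convex combination of a, c, s, t.
  refine h.conv a b c hba hne hbs hbt (r * (1 - lam)) (r * lam) ((1 - r) * (1 - mu)) ((1 - r) * mu)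
    (mul_nonneg hr0 (by linarith)) (mul_nonneg hr0 hl0) (mul_nonneg (by linarith) (by linarith))
    (mul_nonneg (by linarith) hm0) (by ring) ?_ ?_
  · rw [h.xs, h.xt]
    linear_combination r * hlx + (1 - r) * hmx
  · rw [h.ys, h.yt, hr]; ring

/-- Of two points of one side on a common vertical line, the one nearer to the axis would lie
between the other one and its foot on `st`, contradicting convex position. -/
theorem x_ne (h : DiametralFrame x y s t l) {a b : ι} (hab : a ≠ b) (ha : 0 ≤ y a) (hb : 0 ≤ y b) :
    x a ≠ x b := by
  intro hx
  wlog hlt : y a < y b generalizing a b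
  · rcases (not_lt.1 hlt).eq_or_lt with h1 | h1
    · exact hab (h.inj a b hx h1.symm)
    · exact this hab.symm hb ha hx.symm h1
  have hbs : a ≠ s := by rintro rfl; exact hab (h.eq_s (hx ▸ h.xs)).symm
  have hbt : a ≠ t := by rintro rfl; exact hab (h.eq_t (hx ▸ h.xt)).symm
  have hyb := ha.trans_lt hlt
  set r := y a / y b with hr
  have hr0 : 0 ≤ r := div_nonneg ha hb
  have hr1 : r ≤ 1 := (div_le_one hyb).2 hlt.le
  have hra : y a = r * y b := by rw [hr]; field_simp
  have hl := h.pos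
  set mu := x a / l with hmu
  have hm0 : 0 ≤ mu := div_nonneg (h.x_nonneg a) hl.le
  have hm1 : mu ≤ 1 := (div_le_one hl).2 (h.x_le a)
  have hmx : x a = mu * l := by rw [hmu]; field_simp
  refine h.conv b a b hab hab hbs hbt r 0 ((1 - r) * (1 - mu)) ((1 - r) * mu) hr0 le_rfl
    (mul_nonneg (by linarith) (by linarith)) (mul_nonneg (by linarith) hm0) (by ring) ?_ ?_
  · rw [h.xs, h.xt, ← hx]
    linear_combination (1 - r) * hmx
  · rw [h.ys, h.yt, hra]; ring

/-- If `P - Q` is shorter than `P` and `Q`, then for vectors `A`, `B` in the cone of `P` and `Q`,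
`A - B` is shorter than `A` or `B`. -/
theorem cone_shortest {P₁ P₂ Q₁ Q₂ A₁ A₂ B₁ B₂ : ℝ}
    (hC : 0 < P₁ * Q₂ - P₂ * Q₁)
    (hα₁ : 0 ≤ A₁ * Q₂ - A₂ * Q₁) (hβ₁ : 0 ≤ P₁ * A₂ - P₂ * A₁)
    (hα₂ : 0 ≤ B₁ * Q₂ - B₂ * Q₁) (hβ₂ : 0 ≤ P₁ * B₂ - P₂ * B₁)
    (hP : P₁ ^ 2 + P₂ ^ 2 < 2 * (P₁ * Q₁ + P₂ * Q₂))
    (hQ : Q₁ ^ 2 + Q₂ ^ 2 < 2 * (P₁ * Q₁ + P₂ * Q₂))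
    (hA : 2 * (A₁ * B₁ + A₂ * B₂) ≤ A₁ ^ 2 + A₂ ^ 2)
    (hB : 2 * (A₁ * B₁ + A₂ * B₂) ≤ B₁ ^ 2 + B₂ ^ 2)
    (hA0 : 0 < A₁ ^ 2 + A₂ ^ 2) (hB0 : 0 < B₁ ^ 2 + B₂ ^ 2) : False := by
  set C := P₁ * Q₂ - P₂ * Q₁ with hCd
  set a₁ := A₁ * Q₂ - A₂ * Q₁ with ha₁
  set b₁ := P₁ * A₂ - P₂ * A₁ with hb₁
  set a₂ := B₁ * Q₂ - B₂ * Q₁ with ha₂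
  set b₂ := P₁ * B₂ - P₂ * B₁ with hb₂
  set I := P₁ * Q₁ + P₂ * Q₂ with hI
  set J := A₁ * B₁ + A₂ * B₂ with hJ
  set K := A₁ * B₂ - A₂ * B₁ with hK
  have hP0 : 0 ≤ P₁ ^ 2 + P₂ ^ 2 := by positivity
  have hQ0 : 0 ≤ Q₁ ^ 2 + Q₂ ^ 2 := by positivity
  have hI0 : 0 < I := by linarith
  -- By hypothesis P - Q is the strictly shortest side of the triangle, so the angle between P and Q
  -- is less than 60 degrees. With C the cross product and I the inner product, this says that the
  -- squared tangent is less than 3.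
  have hCI : C ^ 2 < 3 * I ^ 2 := by
    have h1 : (P₁ ^ 2 + P₂ ^ 2) * (Q₁ ^ 2 + Q₂ ^ 2) < (2 * I) * (2 * I) :=
      mul_lt_mul'' hP hQ hP0 hQ0
    have h2 : (P₁ ^ 2 + P₂ ^ 2) * (Q₁ ^ 2 + Q₂ ^ 2) = I ^ 2 + C ^ 2 := by rw [hI, hCd]; ring
    linarith
  have hCJ : C ^ 2 * J = a₁ * a₂ * (P₁ ^ 2 + P₂ ^ 2) + b₁ * b₂ * (Q₁ ^ 2 + Q₂ ^ 2) +
      (a₁ * b₂ + a₂ * b₁) * I := by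
    rw [hCd, hJ, ha₁, hb₁, ha₂, hb₂, hI]; ring
  have hCK : C * K = a₁ * b₂ - a₂ * b₁ := by
    rw [hCd, hK, ha₁, hb₁, ha₂, hb₂]; ring
  have hs₁ := mul_nonneg hα₁ hβ₂
  have hs₂ := mul_nonneg hα₂ hβ₁
  -- The numbers `a₁`, `b₁`, `a₂`, `b₂` are C times the coordinates of A and B in the basis P, Q. As
  -- they are nonnegative, the tangent of the angle of A and B is at most that of P and Q: here J is
  -- bounded below, and in `hle` the cross product K above.
  have hsJ : (a₁ * b₂ + a₂ * b₁) * I ≤ C ^ 2 * J := by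
    rw [hCJ]
    have := mul_nonneg (mul_nonneg hα₁ hα₂) hP0
    have := mul_nonneg (mul_nonneg hβ₁ hβ₂) hQ0
    linarith
  have hJ0 : 0 ≤ J := by
    have : 0 ≤ C ^ 2 * J := le_trans (mul_nonneg (add_nonneg hs₁ hs₂) hI0.le) hsJ
    exact nonneg_of_mul_nonneg_right this (by positivity)
  have hprod : (2 * J) * (2 * J) ≤ J ^ 2 + K ^ 2 := by
    have h1 := mul_le_mul hA hB (by linarith) hA0.le
    have h2 : (A₁ ^ 2 + A₂ ^ 2) * (B₁ ^ 2 + B₂ ^ 2) = J ^ 2 + K ^ 2 := by rw [hJ, hK]; ring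
    linarith
  have hpos : 0 < J ^ 2 + K ^ 2 := by
    have h2 : (A₁ ^ 2 + A₂ ^ 2) * (B₁ ^ 2 + B₂ ^ 2) = J ^ 2 + K ^ 2 := by rw [hJ, hK]; ring
    rw [← h2]; positivity
  have hle : (C * K) ^ 2 ≤ (a₁ * b₂ + a₂ * b₁) ^ 2 := by
    rw [hCK]; linarith [mul_nonneg hs₁ hs₂, show (a₁ * b₂ + a₂ * b₁) ^ 2 - (a₁ * b₂ - a₂ * b₁) ^ 2 =
      4 * (a₁ * b₂ * (a₂ * b₁)) by ring]
  -- In the degenerate case A and B are parallel, so K = 0, which is incompatible with 4 J^2 ≤ J^2 +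
  -- K^2. Otherwise the tangent comparison contradicts the inequality K^2 ≥ 3 J^2, the angle of at
  -- least 60 degrees.
  rcases (add_nonneg hs₁ hs₂).eq_or_lt with h0 | h0
  · rw [← h0] at hle
    have hK0 : K = 0 := by
      have : (C * K) ^ 2 = 0 := le_antisymm (by simpa using hle) (sq_nonneg _)
      rcases mul_eq_zero.1 (pow_eq_zero_iff two_ne_zero |>.1 this) with h | h
      · exact absurd h hC.ne'
      · exact h
    rw [hK0] at hprod hpos
    nlinarith
  · have h1 : (a₁ * b₂ + a₂ * b₁) ^ 2 * C ^ 2 < (a₁ * b₂ + a₂ * b₁) ^ 2 * (3 * I ^ 2) :=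
      mul_lt_mul_of_pos_left hCI (pow_pos h0 2)
    have h2 : ((a₁ * b₂ + a₂ * b₁) * I) ^ 2 ≤ (C ^ 2 * J) ^ 2 :=
      pow_le_pow_left₀ (mul_nonneg h0.le hI0.le) hsJ 2
    have h3 : (C * K) ^ 2 * C ^ 2 ≤ (a₁ * b₂ + a₂ * b₁) ^ 2 * C ^ 2 :=
      mul_le_mul_of_nonneg_right hle (sq_nonneg _)
    have h4 : C ^ 4 * K ^ 2 < C ^ 4 * (3 * J ^ 2) := by
      clear_value C J K I a₁ b₁ a₂ b₂
      linarith [show (C * K) ^ 2 * C ^ 2 = C ^ 4 * K ^ 2 by ring,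
        show (C ^ 2 * J) ^ 2 = C ^ 4 * J ^ 2 by ring,
        show ((a₁ * b₂ + a₂ * b₁) * I) ^ 2 = (a₁ * b₂ + a₂ * b₁) ^ 2 * I ^ 2 by ring]
    have h5 := lt_of_mul_lt_mul_left h4 (pow_pos hC 4).le
    linarith

/-- Among three consecutive points of one side, the outer two are not the closest pair. -/
theorem far_same_side (h : DiametralFrame x y s t l) {p r q : ι} {D : ℝ} (hpr : x p < x r)
    (hrq : x r < x q) (hp : 0 ≤ y p) (hr : 0 ≤ y r) (hq : 0 ≤ y q)
    (h1 : D < (x p - x r) ^ 2 + (y p - y r) ^ 2) (h2 : D < (x r - x q) ^ 2 + (y r - y q) ^ 2) :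
    D < (x p - x q) ^ 2 + (y p - y q) ^ 2 := by
  by_contra hcon
  rw [not_lt] at hcon
  have hl := h.pos
  have hrs : x s < x r := by rw [h.xs]; exact (h.x_nonneg p).trans_lt hpr
  have hrt : x r < x t := by rw [h.xt]; exact hrq.trans_le (h.x_le q)
  have c1 := h.cross_neg hpr hrq.le (fun e => hrq.ne (congrArg x e)) hr
  have c2 := h.cross_neg hrs hrq.le (fun e => hrq.ne (congrArg x e)) hr
  have c4 := h.cross_neg hpr hrt.le (fun e => hrt.ne (congrArg x e)) hr
  have c3 : (x p - x s) * (y r - y s) - (y p - y s) * (x r - x s) ≤ 0 := by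
    by_cases e : p = s
    · subst e; simp
    · refine (h.cross_neg ?_ hpr.le (fun e => hpr.ne (congrArg x e)) hp).le
      rw [h.xs]
      exact (h.x_nonneg p).lt_of_ne fun hh => e (h.eq_s hh.symm)
  have c5 : (x q - x r) * (y t - y r) - (y q - y r) * (x t - x r) ≤ 0 := by
    by_cases e : q = t
    · subst e; apply le_of_eq; ring
    · exact (h.cross_neg hrq (h.xt ▸ h.x_le q) e hq).le
  have d1 := h.diam r s
  have d2 := h.diam r t
  have e1 : (x s - x t) ^ 2 + (y s - y t) ^ 2 = l ^ 2 := by rw [h.xs, h.ys, h.xt, h.yt]; ring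
  -- The apex is `r`. By convexity `s` and `t` lie in the cone that `p` and `q` span from `r`, and
  -- `st` is a longest side of the triangle s, r, t.
  refine cone_shortest (P₁ := x p - x r) (P₂ := y p - y r) (Q₁ := x q - x r) (Q₂ := y q - y r)
    (A₁ := x s - x r) (A₂ := y s - y r) (B₁ := x t - x r) (B₂ := y t - y r)
    (by linarith) (by linarith) (by linarith) (by linarith) (by linarith) (by linarith) (by linarith)
    (by linarith) (by linarith) ?_ ?_
  · have : 0 < (x s - x r) ^ 2 := by have : x s - x r ≠ 0 := by linarith
                                     positivity
    positivity
  · have : 0 < (x t - x r) ^ 2 := by have : x t - x r ≠ 0 := by linarith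
                                     positivity
    positivity

/-- A point `q` of the other side, not to the left of `r`, is not closer to `p` than its neighbours
`m` and `r` on its own side. -/
theorem far_other_side (h : DiametralFrame x y s t l) {m p r q : ι} {D : ℝ} (hmp : x m < x p)
    (hpr : x p < x r) (hrq : x r ≤ x q) (hne : r ≠ q) (hm : 0 ≤ y m) (hp : 0 ≤ y p) (hr : 0 ≤ y r)
    (hq : y q ≤ 0)
    (h1 : D < (x m - x p) ^ 2 + (y m - y p) ^ 2) (h2 : D < (x p - x r) ^ 2 + (y p - y r) ^ 2) :
    D < (x p - x q) ^ 2 + (y p - y q) ^ 2 := by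
  by_contra hcon
  rw [not_lt] at hcon
  have c1 := h.cross_neg (hmp.trans hpr) hrq hne hr
  have c2 := h.cross_neg hpr hrq hne hr
  have c3 := h.cross_neg hmp (hpr.le.trans hrq) (fun e => (hpr.trans_le hrq).ne (congrArg x e)) hp
  have c4 := h.cross_neg hmp hpr.le (fun e => hpr.ne (congrArg x e)) hp
  -- Both `m` and `r` lie weakly to the left of and above `q`, so the angle at `q` is at most 90
  -- degrees.
  have hdot : 0 ≤ (x m - x q) * (x r - x q) + (y m - y q) * (y r - y q) :=
    add_nonneg (mul_nonneg_of_nonpos_of_nonpos (by linarith) (by linarith))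
      (mul_nonneg (by linarith) (by linarith))
  set M₁ := x m - x q with hM₁
  set M₂ := y m - y q with hM₂
  set R₁ := x r - x q with hR₁
  set R₂ := y r - y q with hR₂
  set P₁ := x p - x q with hP₁
  set P₂ := y p - y q with hP₂
  obtain ⟨k, hk⟩ : ∃ k, k = M₂ * R₁ - M₁ * R₂ := ⟨_, rfl⟩
  obtain ⟨a, ha⟩ : ∃ a, a = P₂ * R₁ - P₁ * R₂ := ⟨_, rfl⟩
  obtain ⟨b, hb⟩ : ∃ b, b = M₂ * P₁ - M₁ * P₂ := ⟨_, rfl⟩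
  have hk0 : 0 < k := by rw [hk, hM₁, hM₂, hR₁, hR₂]; linarith
  have ha0 : 0 < a := by rw [ha, hP₁, hP₂, hR₁, hR₂]; linarith
  have hb0 : 0 < b := by rw [hb, hM₁, hM₂, hP₁, hP₂]; linarith
  -- Relative to `q`, k p = a m + b r; that a + b exceeds k says that `p` lies beyond the segment
  -- `mr` as seen from `q`. The remaining inequalities would force 2a < k and 2b < k.
  have hab : k < a + b := by rw [hk, ha, hb, hM₁, hM₂, hP₁, hP₂, hR₁, hR₂]; linarith
  have e1 : k * P₁ = a * M₁ + b * R₁ := by rw [hk, ha, hb]; ring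
  have e2 : k * P₂ = a * M₂ + b * R₂ := by rw [hk, ha, hb]; ring
  have f1 : 2 * (M₁ * P₁ + M₂ * P₂) < M₁ ^ 2 + M₂ ^ 2 := by
    rw [hM₁, hM₂, hP₁, hP₂] at *; linarith
  have f2 : 2 * (R₁ * P₁ + R₂ * P₂) < R₁ ^ 2 + R₂ ^ 2 := by
    rw [hR₁, hR₂, hP₁, hP₂] at *; linarith
  have g1 : 2 * a * (M₁ ^ 2 + M₂ ^ 2) < k * (M₁ ^ 2 + M₂ ^ 2) := by
    have := mul_lt_mul_of_pos_left f1 hk0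
    have e : k * (2 * (M₁ * P₁ + M₂ * P₂)) =
        2 * (a * (M₁ ^ 2 + M₂ ^ 2) + b * (M₁ * R₁ + M₂ * R₂)) := by
      linear_combination 2 * M₁ * e1 + 2 * M₂ * e2
    have := mul_nonneg hb0.le hdot
    linarith
  have g2 : 2 * b * (R₁ ^ 2 + R₂ ^ 2) < k * (R₁ ^ 2 + R₂ ^ 2) := by
    have := mul_lt_mul_of_pos_left f2 hk0
    have e : k * (2 * (R₁ * P₁ + R₂ * P₂)) =
        2 * (b * (R₁ ^ 2 + R₂ ^ 2) + a * (M₁ * R₁ + M₂ * R₂)) := by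
      linear_combination 2 * R₁ * e1 + 2 * R₂ * e2
    have := mul_nonneg ha0.le hdot
    linarith
  have i1 := lt_of_mul_lt_mul_right g1 (by positivity)
  have i2 := lt_of_mul_lt_mul_right g2 (by positivity)
  linarith

/-- Points sorted by their first coordinate are pairwise far apart if each is far from the last
earlier point of its own side and from the last and the first earlier point of the other side. -/
theorem far_of_neighbours (h : DiametralFrame x y s t l) {n : ℕ} {e : ℕ → ι}
    (he : Set.InjOn e (Set.Iio n)) (hmono : ∀ p q, p < q → q < n → x (e p) ≤ x (e q))
    {D : ℝ} {S : ℕ → Prop} (hS : ∀ p, S p → p < n)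
    (h1 : ∀ z r, S z → S r → r < z →
      (∀ p, S p → p < z → (0 ≤ y (e p) ↔ 0 ≤ y (e r)) → p ≤ r) →
      D < (x (e r) - x (e z)) ^ 2 + (y (e r) - y (e z)) ^ 2)
    (h2 : ∀ z r, S z → S r → r < z → ¬ (0 ≤ y (e r) ↔ 0 ≤ y (e z)) →
      (∀ p, S p → p < z → (0 ≤ y (e p) ↔ 0 ≤ y (e r)) → r ≤ p) →
      D < (x (e r) - x (e z)) ^ 2 + (y (e r) - y (e z)) ^ 2)
    {p z : ℕ} (hp : S p) (hz : S z) (hpz : p < z) :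
    D < (x (e p) - x (e z)) ^ 2 + (y (e p) - y (e z)) ^ 2 := by
  classical
  -- Pairs with a smaller later point are known to be far. Hence if p is neither the last earlier
  -- point `r` nor the first one `m` of its side, it is far from both, and one of the two geometric
  -- lemmas applies. For the same side only `r` is used.
  induction z using Nat.strong_induction_on generalizing p with
  | _ z ih =>
    -- the last earlier point on the side of `p`
    obtain ⟨r, ⟨hrS, hrz, hrp⟩, hrmax⟩ : ∃ r, (S r ∧ r < z ∧ (0 ≤ y (e r) ↔ 0 ≤ y (e p))) ∧
        ∀ p', S p' → p' < z → (0 ≤ y (e p') ↔ 0 ≤ y (e p)) → p' ≤ r := by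
      have hne : ((Finset.range z).filter
          (fun r => S r ∧ (0 ≤ y (e r) ↔ 0 ≤ y (e p)))).Nonempty := ⟨p, by simp [hp, hpz]⟩
      refine ⟨Finset.max' _ hne, ?_, fun p' a b c => Finset.le_max' _ _ (by simp [a, b, c])⟩
      have := Finset.max'_mem _ hne
      simp only [Finset.mem_filter, Finset.mem_range] at this
      exact ⟨this.2.1, this.1, this.2.2⟩
    have hprle := hrmax p hp hpz Iff.rfl
    have hrz' := h1 z r hz hrS hrz (fun p' a b c => hrmax p' a b (c.trans hrp))
    rcases hprle.eq_or_lt with rfl | hpr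
    · exact hrz'
    have hprf := ih r hrz hp hrS hpr
    have hxpr := hmono p r hpr (hS r hrS)
    have hxrz := hmono r z hrz (hS z hz)
    have ene : ∀ {a b}, S a → S b → a < b → e a ≠ e b := fun ha hb hab hh =>
      hab.ne (he (hS _ ha) (hS _ hb) hh)
    have hsqneg : ∀ a b : ι, (-y a - -y b) ^ 2 = (y a - y b) ^ 2 := fun a b => by ring
    have hn := h.neg
    by_cases hs : (0 ≤ y (e p) ↔ 0 ≤ y (e z))
    · by_cases hup : 0 ≤ y (e p)
      · have hr0 := hrp.2 hup
        have hz0 := hs.1 hup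
        exact h.far_same_side (lt_of_le_of_ne hxpr (h.x_ne (ene hp hrS hpr) hup hr0))
          (lt_of_le_of_ne hxrz (h.x_ne (ene hrS hz hrz) hr0 hz0)) hup hr0 hz0 hprf hrz'
      -- The lower side is treated by reflection in the axis.
      · have hr0 : ¬ _ := fun hh => hup (hrp.1 hh)
        have hz0 : ¬ _ := fun hh => hup (hs.2 hh)
        rw [not_le] at hup hr0 hz0
        have := hn.far_same_side (p := e p) (r := e r) (q := e z) (D := D)
          (lt_of_le_of_ne hxpr (hn.x_ne (ene hp hrS hpr) (by linarith) (by linarith)))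
          (lt_of_le_of_ne hxrz (hn.x_ne (ene hrS hz hrz) (by linarith) (by linarith)))
          (by linarith) (by linarith) (by linarith) (by rw [hsqneg]; exact hprf)
          (by rw [hsqneg]; exact hrz')
        rwa [hsqneg] at this
    · -- the first earlier point on the side of `p`
      obtain ⟨m, ⟨hmS, hmz, hmp⟩, hmmin⟩ : ∃ r, (S r ∧ r < z ∧ (0 ≤ y (e r) ↔ 0 ≤ y (e p))) ∧
          ∀ p', S p' → p' < z → (0 ≤ y (e p') ↔ 0 ≤ y (e p)) → r ≤ p' := by
        have hne : ((Finset.range z).filter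
            (fun r => S r ∧ (0 ≤ y (e r) ↔ 0 ≤ y (e p)))).Nonempty := ⟨p, by simp [hp, hpz]⟩
        refine ⟨Finset.min' _ hne, ?_, fun p' a b c => Finset.min'_le _ _ (by simp [a, b, c])⟩
        have := Finset.min'_mem _ hne
        simp only [Finset.mem_filter, Finset.mem_range] at this
        exact ⟨this.2.1, this.1, this.2.2⟩
      have hmple := hmmin p hp hpz Iff.rfl
      rcases hmple.eq_or_lt with rfl | hmp'
      · exact h2 z m hz hp hpz hs hmmin
      have hmpf := ih p hpz hmS hp hmp'
      have hxmp := hmono m p hmp' (hS p hp)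
      by_cases hup : 0 ≤ y (e p)
      · have hr0 := hrp.2 hup
        have hm0 := hmp.2 hup
        have hz0 : ¬ 0 ≤ y (e z) := fun hh => hs (iff_of_true hup hh)
        exact h.far_other_side (lt_of_le_of_ne hxmp (h.x_ne (ene hmS hp hmp') hm0 hup))
          (lt_of_le_of_ne hxpr (h.x_ne (ene hp hrS hpr) hup hr0)) hxrz (ene hrS hz hrz) hm0 hup hr0
          (not_le.1 hz0).le hmpf hprf
      · have hr0 : ¬ _ := fun hh => hup (hrp.1 hh)
        have hm0 : ¬ _ := fun hh => hup (hmp.1 hh)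
        have hz0 : 0 ≤ y (e z) := by
          by_contra hh; exact hs (iff_of_false hup hh)
        rw [not_le] at hup hr0 hm0
        have := hn.far_other_side (m := e m) (p := e p) (r := e r) (q := e z) (D := D)
          (lt_of_le_of_ne hxmp (hn.x_ne (ene hmS hp hmp') (by linarith) (by linarith)))
          (lt_of_le_of_ne hxpr (hn.x_ne (ene hp hrS hpr) (by linarith) (by linarith)))
          hxrz (ene hrS hz hrz) (by linarith) (by linarith) (by linarith) (by linarith)
          (by rw [hsqneg]; exact hmpf) (by rw [hsqneg]; exact hprf)
        rwa [hsqneg] at this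

end DiametralFrame

end DiverseOpt

/-! ## Euclidean points in the frame of a diameter -/

namespace DiverseOpt

/-- The new coordinates are inner and cross products with t - s and are not normalised. All lengths
are multiplied by |st|, the length of `st` becomes its square `l`, and no square root is needed. -/
theorem diametralFrame_of_convexIndependent {ι : Type*} {pt : ι → EuclideanSpace ℝ (Fin 2)}
    (hc : ConvexIndependent ℝ pt) {s t : ι} {l : ℝ}
    (hl : l = (pt t 0 - pt s 0) * (pt t 0 - pt s 0) + (pt t 1 - pt s 1) * (pt t 1 - pt s 1))
    (hpos : 0 < l)
    (hd : ∀ a b, (pt a 0 - pt b 0) * (pt a 0 - pt b 0) + (pt a 1 - pt b 1) * (pt a 1 - pt b 1) ≤ l) :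
    DiametralFrame
      (fun a => (pt a 0 - pt s 0) * (pt t 0 - pt s 0) + (pt a 1 - pt s 1) * (pt t 1 - pt s 1))
      (fun a => (pt t 0 - pt s 0) * (pt a 1 - pt s 1) - (pt t 1 - pt s 1) * (pt a 0 - pt s 0))
      s t l := by
  -- The change of coordinates is linear with determinant `l`, which is positive, so it is
  -- injective.
  have recover : ∀ u v : ℝ,
      u * (pt t 0 - pt s 0) + v * (pt t 1 - pt s 1) = 0 →
      (pt t 0 - pt s 0) * v - (pt t 1 - pt s 1) * u = 0 → u = 0 ∧ v = 0 := by
    intro u v h1 h2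
    have e1 : l * u = 0 := by
      rw [hl]; linear_combination (pt t 0 - pt s 0) * h1 - (pt t 1 - pt s 1) * h2
    have e2 : l * v = 0 := by
      rw [hl]; linear_combination (pt t 1 - pt s 1) * h1 + (pt t 0 - pt s 0) * h2
    exact ⟨(mul_eq_zero.1 e1).resolve_left hpos.ne', (mul_eq_zero.1 e2).resolve_left hpos.ne'⟩
  have ext2 : ∀ u v : EuclideanSpace ℝ (Fin 2), u 0 = v 0 → u 1 = v 1 → u = v := by
    intro u v h0 h1
    ext i; fin_cases i
    · exact h0
    · exact h1
  refine ⟨hpos, by ring, by ring, by rw [hl], by ring, fun a b => ?_, fun a b hx hy => ?_, ?_⟩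
  · have e := mul_le_mul_of_nonneg_left (hd a b) hpos.le
    nth_rewrite 1 [hl] at e
    linarith
  · obtain ⟨h0, h1⟩ := recover (pt a 0 - pt b 0) (pt a 1 - pt b 1) (by linarith) (by linarith)
    exact hc.injective (ext2 _ _ (sub_eq_zero.1 h0) (sub_eq_zero.1 h1))
  · intro a b c hba hbc hbs hbt α β γ δ hα hβ hγ hδ hsum hx hy
    have hs1 : γ = 1 - α - β - δ := by linarith
    obtain ⟨h0, h1⟩ := recover (pt b 0 - (α * pt a 0 + β * pt c 0 + γ * pt s 0 + δ * pt t 0))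
      (pt b 1 - (α * pt a 1 + β * pt c 1 + γ * pt s 1 + δ * pt t 1))
      (by subst hs1; linarith) (by subst hs1; linarith)
    have hb : pt b = α • pt a + β • pt c + γ • pt s + δ • pt t :=
      ext2 _ _ (by simpa using sub_eq_zero.1 h0) (by simpa using sub_eq_zero.1 h1)
    have hmem : pt b ∈ convexHull ℝ (pt '' {a, c, s, t}) := by
      have hcv := convex_convexHull ℝ (pt '' {a, c, s, t})
      have hin : ∀ i ∈ ({a, c, s, t} : Set ι), pt i ∈ convexHull ℝ (pt '' {a, c, s, t}) :=
        fun i hi => subset_convexHull _ _ (Set.mem_image_of_mem _ hi)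
      have := hcv.sum_mem (t := Finset.univ) (w := ![α, β, γ, δ])
        (z := ![pt a, pt c, pt s, pt t])
        (by intro i _; fin_cases i <;> simpa) (by simp [Fin.sum_univ_four, hsum])
        (by intro i _; fin_cases i <;> exact hin _ (by simp))
      simpa [Fin.sum_univ_four, hb] using this
    have := hc _ _ hmem
    simp only [Set.mem_insert_iff, Set.mem_singleton_iff] at this
    tauto

/-- Squared distance of the points `a` and `b` with coordinates `px`, `py`. -/
noncomputable def sqDist (px py : ℕ → ℝ) (a b : ℕ) : ℝ :=
  (px a - px b) * (px a - px b) + (py a - py b) * (py a - py b)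

/-- Coordinate in the direction of the segment from `s` to `t`. -/
noncomputable def along (px py : ℕ → ℝ) (s t a : ℕ) : ℝ :=
  (px a - px s) * (px t - px s) + (py a - py s) * (py t - py s)

/-- Coordinate in the direction orthogonal to the segment from `s` to `t`. -/
noncomputable def across (px py : ℕ → ℝ) (s t a : ℕ) : ℝ :=
  (px t - px s) * (py a - py s) - (py t - py s) * (px a - px s)

theorem sqDist_pt {n : ℕ} (pt : Fin n → EuclideanSpace ℝ (Fin 2)) {px py : ℕ → ℝ}
    (hx : ∀ i : Fin n, px i = pt i 0) (hy : ∀ i : Fin n, py i = pt i 1) (a b : Fin n) :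
    sqDist px py a b ≤ 1 ↔ dist (pt a) (pt b) ≤ 1 := by
  rw [EuclideanSpace.dist_eq, Fin.sum_univ_two, Real.sqrt_le_iff, sqDist, hx, hx, hy, hy,
    Real.dist_eq, Real.dist_eq, sq_abs, sq_abs, sq, sq]
  simp

/-- A set of points in convex position, sorted along a diameter, is independent if each of its
points is far from the last earlier point of each side and the first of the other side. -/
theorem far_of_neighbours {n : ℕ} {pt : Fin n → EuclideanSpace ℝ (Fin 2)}
    (hc : ConvexIndependent ℝ pt) {px py : ℕ → ℝ}
    (hx : ∀ i : Fin n, px i = pt i 0) (hy : ∀ i : Fin n, py i = pt i 1)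
    {s t : ℕ} (hs : s < n) (ht : t < n)
    (hd : ∀ a b, a < n → b < n → sqDist px py a b ≤ sqDist px py s t)
    {e : ℕ → ℕ} (hen : ∀ p < n, e p < n) (hinj : Set.InjOn e (Set.Iio n))
    (hmono : ∀ p q, p < q → q < n → along px py s t (e p) ≤ along px py s t (e q))
    {S : ℕ → Prop} (hS : ∀ p, S p → p < n)
    (h1 : ∀ z r, S z → S r → r < z → (∀ p, S p → p < z →
      (0 ≤ across px py s t (e p) ↔ 0 ≤ across px py s t (e r)) → p ≤ r) →
      1 < sqDist px py (e r) (e z))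
    (h2 : ∀ z r, S z → S r → r < z →
      ¬ (0 ≤ across px py s t (e r) ↔ 0 ≤ across px py s t (e z)) →
      (∀ p, S p → p < z → (0 ≤ across px py s t (e p) ↔ 0 ≤ across px py s t (e r)) → r ≤ p) →
      1 < sqDist px py (e r) (e z))
    {p z : ℕ} (hp : S p) (hz : S z) (hpz : p < z) : 1 < sqDist px py (e p) (e z) := by
  have hn : 0 < n := by omega
  let s' : Fin n := ⟨s, hs⟩
  let t' : Fin n := ⟨t, ht⟩
  let e' : ℕ → Fin n := fun p => if h : e p < n then ⟨e p, h⟩ else ⟨0, hn⟩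
  have he' : ∀ p < n, (e' p : ℕ) = e p := fun p hp => by simp [e', hen p hp]
  set l := (pt t' 0 - pt s' 0) * (pt t' 0 - pt s' 0) + (pt t' 1 - pt s' 1) * (pt t' 1 - pt s' 1)
    with hl
  have hlst : sqDist px py s t = l := by
    have h1 := hx s'; have h2 := hx t'; have h3 := hy s'; have h4 := hy t'
    simp only [s', t'] at h1 h2 h3 h4
    rw [sqDist, hl, h1, h2, h3, h4]; ring
  have hd' : ∀ a b : Fin n,
      (pt a 0 - pt b 0) * (pt a 0 - pt b 0) + (pt a 1 - pt b 1) * (pt a 1 - pt b 1) ≤ l := by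
    intro a b
    have := hd a b a.2 b.2
    rwa [hlst, sqDist, hx, hx, hy, hy] at this
  -- A vanishing diameter would make all points coincide, but the positions `p` and `z` carry
  -- distinct points. A single point needs no separate treatment for this reason.
  have hpos : 0 < l := by
    by_contra hcon
    rw [not_lt] at hcon
    have hpn := hS p hp; have hzn := hS z hz
    have := (hd' (e' p) (e' z)).trans hcon
    have e0 : pt (e' p) 0 - pt (e' z) 0 = 0 := by
      nlinarith [mul_self_nonneg (pt (e' p) 0 - pt (e' z) 0),
        mul_self_nonneg (pt (e' p) 1 - pt (e' z) 1)]
    have e1 : pt (e' p) 1 - pt (e' z) 1 = 0 := by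
      nlinarith [mul_self_nonneg (pt (e' p) 0 - pt (e' z) 0),
        mul_self_nonneg (pt (e' p) 1 - pt (e' z) 1)]
    have : pt (e' p) = pt (e' z) := by
      ext i; fin_cases i
      · exact sub_eq_zero.1 e0
      · exact sub_eq_zero.1 e1
    have := congrArg Fin.val (hc.injective this)
    rw [he' p hpn, he' z hzn] at this
    exact hpz.ne (hinj hpn hzn this)
  have hF := diametralFrame_of_convexIndependent hc hl hpos hd'
  have hX : ∀ p < n, along px py s t (e p) = (pt (e' p) 0 - pt s' 0) * (pt t' 0 - pt s' 0) +
      (pt (e' p) 1 - pt s' 1) * (pt t' 1 - pt s' 1) := by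
    intro p hp
    rw [along, ← he' p hp, ← hx, ← hx, ← hx, ← hy, ← hy, ← hy]
  have hY : ∀ p < n, across px py s t (e p) = (pt t' 0 - pt s' 0) * (pt (e' p) 1 - pt s' 1) -
      (pt t' 1 - pt s' 1) * (pt (e' p) 0 - pt s' 0) := by
    intro p hp
    rw [across, ← he' p hp, ← hx, ← hx, ← hx, ← hy, ← hy, ← hy]
  -- Squared distances in the frame are `l` times the original ones, so the threshold 1 becomes `l`.
  have hsq : ∀ p q, p < n → q < n → (l < (along px py s t (e p) - along px py s t (e q)) ^ 2 +
      (across px py s t (e p) - across px py s t (e q)) ^ 2 ↔ 1 < sqDist px py (e p) (e q)) := by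
    intro p q _ _
    have : (along px py s t (e p) - along px py s t (e q)) ^ 2 +
      (across px py s t (e p) - across px py s t (e q)) ^ 2 = l * sqDist px py (e p) (e q) := by
      rw [← hlst, along, along, across, across, sqDist, sqDist]; ring
    rw [this]
    exact lt_mul_iff_one_lt_right hpos
  have key := hF.far_of_neighbours (n := n) (e := e') (D := l) (S := S)
    (fun p hp q hq h => hinj hp hq (by rw [← he' p hp, ← he' q hq, h]))
    (fun p q hpq hq => by
      simp only [← hX p (hpq.trans hq), ← hX q hq]; exact hmono p q hpq hq) hS ?_ ?_ hp hz hpz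
  · rw [← hX p (hS p hp), ← hX z (hS z hz), ← hY p (hS p hp), ← hY z (hS z hz)] at key
    exact (hsq p z (hS p hp) (hS z hz)).1 key
  · intro z r hz hr hrz hmax
    rw [← hX r (hS r hr), ← hX z (hS z hz), ← hY r (hS r hr), ← hY z (hS z hz),
      hsq r z (hS r hr) (hS z hz)]
    refine h1 z r hz hr hrz fun p hp hpz hpr => hmax p hp hpz ?_
    rwa [hY p (hS p hp), hY r (hS r hr)] at hpr
  · intro z r hz hr hrz hside hmin
    rw [← hX r (hS r hr), ← hX z (hS z hz), ← hY r (hS r hr), ← hY z (hS z hz),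
      hsq r z (hS r hr) (hS z hz)]
    rw [← hY r (hS r hr), ← hY z (hS z hz)] at hside
    refine h2 z r hz hr hrz hside fun p hp hpz hpr => hmin p hp hpz ?_
    rwa [hY p (hS p hp), hY r (hS r hr)] at hpr

end DiverseOpt

/-! ## Automata reading sets bit by bit -/

namespace DiverseOpt

/-- `Path nx X z₀ r z`: from state `z₀` the first `r` bits of `X` lead to `z`; the transition
`nx pos z b` is `0` if there is none, and the successor of the new state otherwise. -/
def Path (nx : ℕ → ℕ → ℕ → ℕ) (X : ℕ → ℕ) (z₀ : ℕ) : ℕ → ℕ → Prop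
  | 0, z => z = z₀
  | r + 1, z' => ∃ z, Path nx X z₀ r z ∧ nx r z (X r) = z' + 1

theorem Path.congr {nx : ℕ → ℕ → ℕ → ℕ} {X Y : ℕ → ℕ} {z₀ r z : ℕ}
    (h : Path nx X z₀ r z) (hXY : ∀ p < r, X p = Y p) : Path nx Y z₀ r z := by
  induction r generalizing z with
  | zero => exact h
  | succ r ih =>
    obtain ⟨z', h', e⟩ := h
    exact ⟨z', ih h' fun p hp => hXY p (by omega), by rw [← hXY r (by omega)]; exact e⟩

/-- `Sol nx g wt acc n m z d τ`: `m` more bits can be read from state `z` to an accepting state,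
with total gain `d` and weight at least `τ`. -/
def Sol (nx : ℕ → ℕ → ℕ → ℕ) (g : ℕ → ℕ → ℕ) (wt : ℕ → ℝ) (acc : ℕ → Prop) (n : ℕ) :
    ℕ → ℕ → ℕ → ℝ → Prop
  | 0, z, d, τ => acc z ∧ d = 0 ∧ τ ≤ 0
  | m + 1, z, d, τ =>
    (∃ z', nx (n - (m + 1)) z 0 = z' + 1 ∧ g (n - (m + 1)) 0 ≤ d ∧
      Sol nx g wt acc n m z' (d - g (n - (m + 1)) 0) τ) ∨
    (∃ z', nx (n - (m + 1)) z 1 = z' + 1 ∧ g (n - (m + 1)) 1 ≤ d ∧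
      Sol nx g wt acc n m z' (d - g (n - (m + 1)) 1) (τ - wt (n - (m + 1))))

section

variable {nx : ℕ → ℕ → ℕ → ℕ} {g : ℕ → ℕ → ℕ} {wt : ℕ → ℝ} {acc : ℕ → Prop} {n : ℕ}

/-- By induction from the end of the word: each suffix of an accepted path is a completion from the
state reached, with the gain and the weight collected on that suffix. -/
theorem Path.sol {X : ℕ → ℕ} (hX : ∀ p < n, X p ≤ 1) {z₀ zn : ℕ}
    (h : Path nx X z₀ n zn) (hacc : acc zn) {τ : ℝ}
    (hτ : τ ≤ ∑ p ∈ Finset.range n, if X p = 1 then wt p else 0) :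
    Sol nx g wt acc n n z₀ (∑ p ∈ Finset.range n, g p (X p)) τ := by
  have key : ∀ m ≤ n, ∀ τ : ℝ,
      (τ ≤ ∑ p ∈ Finset.Ico (n - m) n, if X p = 1 then wt p else 0) →
      ∃ z, Path nx X z₀ (n - m) z ∧
      Sol nx g wt acc n m z (∑ p ∈ Finset.Ico (n - m) n, g p (X p)) τ := by
    intro m
    induction m with
    | zero =>
      intro _ τ hτ
      exact ⟨zn, h, hacc, by simp, by simpa using hτ⟩
    | succ m ih =>
      intro hm τ hτ
      have hlt : n - (m + 1) < n := by omega
      have he : n - m = n - (m + 1) + 1 := by omega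
      rw [Finset.sum_eq_sum_Ico_succ_bot hlt, ← he] at hτ
      obtain ⟨z', hz', hs⟩ := ih (by omega)
        (τ - if X (n - (m + 1)) = 1 then wt (n - (m + 1)) else 0) (by linarith)
      rw [he] at hz'
      obtain ⟨z, hz, hnx⟩ := hz'
      refine ⟨z, hz, ?_⟩
      rw [Finset.sum_eq_sum_Ico_succ_bot hlt, ← he]
      rcases Nat.le_one_iff_eq_zero_or_eq_one.1 (hX _ hlt) with h0 | h0
      · left
        rw [h0] at hnx hs
        refine ⟨z', hnx, by rw [h0]; omega, ?_⟩
        rw [h0, Nat.add_sub_cancel_left]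
        simpa using hs
      · right
        rw [h0] at hnx hs
        refine ⟨z', hnx, by rw [h0]; omega, ?_⟩
        rw [h0, Nat.add_sub_cancel_left]
        simpa using hs
  obtain ⟨z, hz, hs⟩ := key n le_rfl τ (by simpa using hτ)
  rw [Nat.sub_self] at hz hs
  rw [show z = z₀ from hz] at hs
  simpa using hs

end

/-! ### The automaton of the independent sets -/

/-- The first element of `X` below `r` on chain `c`, plus one; `0` if there is none. -/
def firstOn (ch X : ℕ → ℕ) (c : ℕ) : ℕ → ℕ
  | 0 => 0
  | r + 1 => if X r = 1 ∧ ch r = c ∧ firstOn ch X c r = 0 then r + 1 else firstOn ch X c r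

/-- The last element of `X` below `r` on chain `c`, plus one; `0` if there is none. -/
def lastOn (ch X : ℕ → ℕ) (c : ℕ) : ℕ → ℕ
  | 0 => 0
  | r + 1 => if X r = 1 ∧ ch r = c then r + 1 else lastOn ch X c r

theorem firstOn_le (ch X : ℕ → ℕ) (c r : ℕ) : firstOn ch X c r ≤ r := by
  induction r with
  | zero => rfl
  | succ r ih => simp only [firstOn]; split_ifs <;> omega

theorem lastOn_le (ch X : ℕ → ℕ) (c r : ℕ) : lastOn ch X c r ≤ r := by
  induction r with
  | zero => rfl
  | succ r ih => simp only [lastOn]; split_ifs <;> omega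

theorem firstOn_spec (ch X : ℕ → ℕ) (c r : ℕ) :
    (firstOn ch X c r = 0 ∧ ∀ p < r, X p = 1 → ch p ≠ c) ∨
    ∃ a < r, firstOn ch X c r = a + 1 ∧ X a = 1 ∧ ch a = c ∧
      ∀ p < r, X p = 1 → ch p = c → a ≤ p := by
  induction r with
  | zero => left; simp [firstOn]
  | succ r ih =>
    rcases ih with ⟨h0, h⟩ | ⟨a, har, h0, h1, h2, h3⟩
    · by_cases hr : X r = 1 ∧ ch r = c
      · right
        refine ⟨r, by omega, by simp [firstOn, hr, h0], hr.1, hr.2, fun p hp hX hc => ?_⟩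
        by_contra hlt
        exact h p (by omega) hX hc
      · left
        refine ⟨by simp only [firstOn]; rw [if_neg (by tauto), h0], fun p hp hX hc => ?_⟩
        rcases Nat.lt_succ_iff_lt_or_eq.1 hp with h' | rfl
        · exact h p h' hX hc
        · exact hr ⟨hX, hc⟩
    · right
      refine ⟨a, by omega, by simp [firstOn, h0], h1, h2, fun p hp hX hc => ?_⟩
      rcases Nat.lt_succ_iff_lt_or_eq.1 hp with h' | rfl
      · exact h3 p h' hX hc
      · omega

theorem lastOn_spec (ch X : ℕ → ℕ) (c r : ℕ) :
    (lastOn ch X c r = 0 ∧ ∀ p < r, X p = 1 → ch p ≠ c) ∨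
    ∃ a < r, lastOn ch X c r = a + 1 ∧ X a = 1 ∧ ch a = c ∧
      ∀ p < r, X p = 1 → ch p = c → p ≤ a := by
  induction r with
  | zero => left; simp [lastOn]
  | succ r ih =>
    by_cases hr : X r = 1 ∧ ch r = c
    · right
      exact ⟨r, by omega, by simp [lastOn, hr], hr.1, hr.2, fun p hp _ _ => by omega⟩
    · have hl : lastOn ch X c (r + 1) = lastOn ch X c r := by simp only [lastOn]; rw [if_neg hr]
      rw [hl]
      rcases ih with ⟨h0, h⟩ | ⟨a, har, h0, h1, h2, h3⟩
      · left
        refine ⟨h0, fun p hp hX hc => ?_⟩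
        rcases Nat.lt_succ_iff_lt_or_eq.1 hp with h' | rfl
        · exact h p h' hX hc
        · exact hr ⟨hX, hc⟩
      · right
        refine ⟨a, by omega, h0, h1, h2, fun p hp hX hc => ?_⟩
        rcases Nat.lt_succ_iff_lt_or_eq.1 hp with h' | rfl
        · exact h3 p h' hX hc
        · exact absurd ⟨hX, hc⟩ hr

/-- Four digits in base `b`. -/
def code4 (b f₀ f₁ l₀ l₁ : ℕ) : ℕ := ((f₀ * b + f₁) * b + l₀) * b + l₁

theorem digit_mod {a b c : ℕ} (h : c < b) : (a * b + c) % b = c := by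
  rw [Nat.mul_comm, Nat.mul_add_mod, Nat.mod_eq_of_lt h]

theorem digit_div {a b c : ℕ} (h : c < b) : (a * b + c) / b = a := by
  rw [Nat.mul_comm, Nat.mul_add_div (by omega), Nat.div_eq_of_lt h, add_zero]

theorem digit_lt {a b c d : ℕ} (ha : a < d) (h : c < b) : a * b + c < d * b := by
  calc a * b + c < a * b + b := by omega
    _ = (a + 1) * b := by ring
    _ ≤ d * b := Nat.mul_le_mul_right _ ha

theorem code4_lt {b f₀ f₁ l₀ l₁ : ℕ} (h₀ : f₀ < b) (h₁ : f₁ < b) (h₂ : l₀ < b) (h₃ : l₁ < b) :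
    code4 b f₀ f₁ l₀ l₁ < b * b * b * b :=
  digit_lt (digit_lt (digit_lt h₀ h₁) h₂) h₃

/-- The number of states of the automaton of independent sets. -/
def numRecords (n : ℕ) : ℕ := (n + 1) * (n + 1) * (n + 1) * (n + 1)

/-- The state of the automaton of independent sets after the elements of `X` below `r`. -/
def recordOf (n : ℕ) (ch X : ℕ → ℕ) (r : ℕ) : ℕ :=
  code4 (n + 1) (firstOn ch X 0 r) (firstOn ch X 1 r) (lastOn ch X 0 r) (lastOn ch X 1 r)

/-- Adding `pos` to the set with the given first and last elements: `0` if this creates a conflict,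
else the successor of the new state. -/
def addElem (n : ℕ) (ch : ℕ → ℕ) (nr : ℕ → ℕ → ℕ) (pos f₀ f₁ l₀ l₁ : ℕ) : ℕ :=
  if nr l₀ (pos + 1) = 0 ∧ nr l₁ (pos + 1) = 0 then
    if ch pos = 0 then
      if nr f₁ (pos + 1) = 0 then
        code4 (n + 1) (if f₀ = 0 then pos + 1 else f₀) f₁ (pos + 1) l₁ + 1
      else 0
    else
      if nr f₀ (pos + 1) = 0 then
        code4 (n + 1) f₀ (if f₁ = 0 then pos + 1 else f₁) l₀ (pos + 1) + 1
      else 0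
  else 0

/-- `addElem` with the state given as a number. -/
def addElemCode (n : ℕ) (ch : ℕ → ℕ) (nr : ℕ → ℕ → ℕ) (pos q : ℕ) : ℕ :=
  addElem n ch nr pos (q / (n + 1) / (n + 1) / (n + 1)) (q / (n + 1) / (n + 1) % (n + 1))
    (q / (n + 1) % (n + 1)) (q % (n + 1))

theorem addElemCode_code4 {n : ℕ} {ch : ℕ → ℕ} {nr : ℕ → ℕ → ℕ} {pos f₀ f₁ l₀ l₁ : ℕ}
    (h₁ : f₁ < n + 1) (h₂ : l₀ < n + 1) (h₃ : l₁ < n + 1) :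
    addElemCode n ch nr pos (code4 (n + 1) f₀ f₁ l₀ l₁) = addElem n ch nr pos f₀ f₁ l₀ l₁ := by
  simp only [addElemCode, code4, digit_mod h₁, digit_mod h₂, digit_mod h₃, digit_div h₁,
    digit_div h₂, digit_div h₃]

theorem addElemCode_le {n : ℕ} {ch : ℕ → ℕ} {nr : ℕ → ℕ → ℕ} {pos q : ℕ} (hp : pos < n)
    (hq : q < numRecords n) :
    addElemCode n ch nr pos q ≤ numRecords n := by
  have h0 : q / (n + 1) / (n + 1) / (n + 1) < n + 1 := by
    rw [Nat.div_lt_iff_lt_mul (by omega), Nat.div_lt_iff_lt_mul (by omega),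
      Nat.div_lt_iff_lt_mul (by omega)]; exact hq
  have h1 : q / (n + 1) / (n + 1) % (n + 1) < n + 1 := Nat.mod_lt _ (by omega)
  have h2 : q / (n + 1) % (n + 1) < n + 1 := Nat.mod_lt _ (by omega)
  have h3 : q % (n + 1) < n + 1 := Nat.mod_lt _ (by omega)
  unfold addElemCode addElem
  split_ifs
  all_goals first
    | exact Nat.zero_le _
    | (exact Nat.succ_le_of_lt (code4_lt (by omega) (by omega) (by omega) (by omega)))

/-- The conflicts tested when `z` is added to the elements of `X` below `z`. -/
def Compatible (ch : ℕ → ℕ) (nr : ℕ → ℕ → ℕ) (X : ℕ → ℕ) (z : ℕ) : Prop :=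
  nr (lastOn ch X 0 z) (z + 1) = 0 ∧ nr (lastOn ch X 1 z) (z + 1) = 0 ∧
    nr (firstOn ch X (1 - ch z) z) (z + 1) = 0

/-- Since missing elements have code 0 and others their position plus one, the four digits of the
new state are the first and last elements after reading position `r`. The three tests are the last
element of each chain and the first of the other. -/
theorem addElemCode_recordOf {n : ℕ} {ch : ℕ → ℕ} {nr : ℕ → ℕ → ℕ} {X : ℕ → ℕ} {r z : ℕ}
    (hch : ch r ≤ 1) (hr : r < n) (hX : X r = 1) :
    addElemCode n ch nr r (recordOf n ch X r) = z + 1 ↔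
      z = recordOf n ch X (r + 1) ∧ Compatible ch nr X r := by
  have a0 := firstOn_le ch X 0 r
  have a1 := firstOn_le ch X 1 r
  have a2 := lastOn_le ch X 0 r
  have a3 := lastOn_le ch X 1 r
  rw [recordOf, addElemCode_code4 (by omega) (by omega) (by omega), addElem, Compatible, recordOf]
  simp only [firstOn, lastOn, hX, true_and]
  rcases Nat.le_one_iff_eq_zero_or_eq_one.1 hch with h | h <;> simp only [h]
  · generalize firstOn ch X 0 r = f₀ at *
    grind
  · generalize firstOn ch X 1 r = f₁ at *
    grind

theorem recordOf_succ_of_ne {n : ℕ} {ch X : ℕ → ℕ} {r : ℕ} (hX : X r ≠ 1) :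
    recordOf n ch X (r + 1) = recordOf n ch X r := by
  simp [recordOf, firstOn, lastOn, hX]

theorem recordOf_lt {n : ℕ} (ch X : ℕ → ℕ) {r : ℕ} (hr : r ≤ n) :
    recordOf n ch X r < numRecords n := by
  have a0 := firstOn_le ch X 0 r
  have a1 := firstOn_le ch X 1 r
  have a2 := lastOn_le ch X 0 r
  have a3 := lastOn_le ch X 1 r
  exact code4_lt (by omega) (by omega) (by omega) (by omega)

/-- The property of conflict tables behind the correctness of the automaton: it suffices to test
the last earlier element of each chain, and the first one of the other chain. -/
def NeighboursSuffice (n : ℕ) (ch : ℕ → ℕ) (nr : ℕ → ℕ → ℕ) : Prop :=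
  ∀ S : ℕ → Prop, (∀ p, S p → p < n) →
    (∀ z r, S z → S r → r < z → (∀ p, S p → p < z → ch p = ch r → p ≤ r) →
      nr (r + 1) (z + 1) = 0) →
    (∀ z r, S z → S r → r < z → ch r ≠ ch z → (∀ p, S p → p < z → ch p = ch r → r ≤ p) →
      nr (r + 1) (z + 1) = 0) →
    ∀ p z, S p → S z → p < z → nr (p + 1) (z + 1) = 0

/-- No two elements of `X` below `n` are in conflict. -/
def Indep (n : ℕ) (nr : ℕ → ℕ → ℕ) (X : ℕ → ℕ) : Prop :=
  ∀ p z, p < z → z < n → X p = 1 → X z = 1 → nr (p + 1) (z + 1) = 0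

/-- The nontrivial direction is `NeighboursSuffice` applied to the set of ones of `X`: by maximality
and minimality its test elements are the recorded last and first elements. In the converse, a
missing neighbour is harmless because code 0 conflicts with nothing. -/
theorem forall_compatible_iff {n : ℕ} {ch : ℕ → ℕ} {nr : ℕ → ℕ → ℕ} (hch : ∀ p < n, ch p ≤ 1)
    (h0 : ∀ q ≤ n, nr 0 q = 0) (hns : NeighboursSuffice n ch nr) (X : ℕ → ℕ) :
    (∀ z < n, X z = 1 → Compatible ch nr X z) ↔ Indep n nr X := by
  constructor
  · intro h p z hpz hz hXp hXz
    refine hns (fun p => p < n ∧ X p = 1) (fun p hp => hp.1) ?_ ?_ p z ⟨hpz.trans hz, hXp⟩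
      ⟨hz, hXz⟩ hpz
    · rintro z r ⟨hz, hXz⟩ ⟨hr, hXr⟩ hrz hmax
      have hl : lastOn ch X (ch r) z = r + 1 := by
        rcases lastOn_spec ch X (ch r) z with ⟨_, h'⟩ | ⟨a, haz, e, hXa, hca, h'⟩
        · exact absurd rfl (h' r hrz hXr)
        · rw [e, le_antisymm (hmax a ⟨by omega, hXa⟩ haz hca) (h' r hrz hXr rfl)]
      have hc := h z hz hXz
      rw [← hl]
      rcases Nat.le_one_iff_eq_zero_or_eq_one.1 (hch r hr) with h' | h' <;> rw [h']
      · exact hc.1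
      · exact hc.2.1
    · rintro z r ⟨hz, hXz⟩ ⟨hr, hXr⟩ hrz hside hmin
      have hl : firstOn ch X (ch r) z = r + 1 := by
        rcases firstOn_spec ch X (ch r) z with ⟨_, h'⟩ | ⟨a, haz, e, hXa, hca, h'⟩
        · exact absurd rfl (h' r hrz hXr)
        · rw [e, le_antisymm (h' r hrz hXr rfl) (hmin a ⟨by omega, hXa⟩ haz hca)]
      have hc := (h z hz hXz).2.2
      have h1 := hch r hr
      have h2 := hch z hz
      rw [← hl]
      rwa [show 1 - ch z = ch r by omega] at hc
  · intro h z hz hXz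
    have hl : ∀ c, nr (lastOn ch X c z) (z + 1) = 0 := by
      intro c
      rcases lastOn_spec ch X c z with ⟨e, _⟩ | ⟨a, haz, e, hXa, _, _⟩
      · rw [e, h0 _ (by omega)]
      · rw [e]; exact h a z haz hz hXa hXz
    refine ⟨hl 0, hl 1, ?_⟩
    rcases firstOn_spec ch X (1 - ch z) z with ⟨e, _⟩ | ⟨a, haz, e, hXa, _, _⟩
    · rw [e, h0 _ (by omega)]
    · rw [e]; exact h a z haz hz hXa hXz

/-! ### Excluding given sets -/

/-- Which rows are to be avoided: all below `K` except `i`. -/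
def Active (i K : ℕ) (j : ℕ) : Prop := j < K ∧ j ≠ i

/-- `v` is a correct successor, after bit `b` at `pos`, of the state `e` of the automaton that
remembers an active row agreeing with what was read (`k` if there is none). -/
def TrieStep (k : ℕ) (row : ℕ → ℕ → ℕ) (act : ℕ → Prop) (pos e b v : ℕ) : Prop :=
  v ≤ k ∧ (e = k → v = k) ∧ (e < k → act e →
    (v = k ∧ ∀ l, act l → (∀ p < pos, row l p = row e p) → row l pos ≠ b) ∨
    (v < k ∧ act v ∧ (∀ p < pos, row v p = row e p) ∧ row v pos = b))

/-- The state of the automaton that remembers an active row agreeing with `X`. -/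
def trieState (ex : ℕ → ℕ → ℕ → ℕ) (X : ℕ → ℕ) (e₀ : ℕ) : ℕ → ℕ
  | 0 => e₀
  | r + 1 => ex r (trieState ex X e₀ r) (X r)

section

variable {n k : ℕ} {row : ℕ → ℕ → ℕ} {act : ℕ → Prop} {ex : ℕ → ℕ → ℕ → ℕ} {X : ℕ → ℕ}

theorem trieState_le (hex : ∀ pos < n, ∀ e ≤ k, ∀ b ≤ 1, TrieStep k row act pos e b (ex pos e b))
    (hX : ∀ p < n, X p ≤ 1) {e₀ : ℕ} (he : e₀ ≤ k) {r : ℕ} (hr : r ≤ n) :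
    trieState ex X e₀ r ≤ k := by
  induction r with
  | zero => exact he
  | succ r ih => exact (hex r (by omega) _ (ih (by omega)) _ (hX r (by omega))).1

theorem trieState_free
    (hex : ∀ pos < n, ∀ e ≤ k, ∀ b ≤ 1, TrieStep k row act pos e b (ex pos e b))
    (hX : ∀ p < n, X p ≤ 1) {r : ℕ} (hr : r ≤ n) : trieState ex X k r = k := by
  induction r with
  | zero => rfl
  | succ r ih =>
    exact (hex r (by omega) _ (ih (by omega)).le _ (hX r (by omega))).2.1 (ih (by omega))

/-- Remembering one agreeing row is enough: rows that agree with the word read so far agree with one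
another on that prefix. So a row that agrees one step further can be searched for by comparing with
the remembered row. Once no row agrees, none will agree later. -/
theorem trieState_spec
    (hex : ∀ pos < n, ∀ e ≤ k, ∀ b ≤ 1, TrieStep k row act pos e b (ex pos e b))
    (hX : ∀ p < n, X p ≤ 1) {e₀ : ℕ} (he : (e₀ = k ∧ ∀ l, ¬ act l) ∨ (e₀ < k ∧ act e₀))
    {r : ℕ} (hr : r ≤ n) :
    (trieState ex X e₀ r = k ∧ ∀ l, act l → ∃ p < r, row l p ≠ X p) ∨
    (trieState ex X e₀ r < k ∧ act (trieState ex X e₀ r) ∧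
      ∀ p < r, row (trieState ex X e₀ r) p = X p) := by
  induction r with
  | zero =>
    rcases he with ⟨h1, h2⟩ | ⟨h1, h2⟩
    · exact .inl ⟨h1, fun l hl => absurd hl (h2 l)⟩
    · exact .inr ⟨h1, h2, by simp⟩
  | succ r ih =>
    rcases ih (by omega) with ⟨h1, h2⟩ | ⟨h1, h2, h3⟩
    · left
      refine ⟨(hex r (by omega) _ h1.le _ (hX r (by omega))).2.1 h1, fun l hl => ?_⟩
      obtain ⟨p, hp, hne⟩ := h2 l hl
      exact ⟨p, by omega, hne⟩
    · rcases (hex r (by omega) _ h1.le _ (hX r (by omega))).2.2 h1 h2 with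
        ⟨g1, g2⟩ | ⟨g1, g2, g3, g4⟩
      · left
        refine ⟨g1, fun l hl => ?_⟩
        by_contra hcon
        push Not at hcon
        refine g2 l hl (fun p hp => ?_) (hcon r (by omega))
        rw [h3 p hp]; exact hcon p (by omega)
      · right
        refine ⟨g1, g2, fun p hp => ?_⟩
        rcases Nat.lt_succ_iff_lt_or_eq.1 hp with h | rfl
        · exact (g3 p h).trans (h3 p h)
        · exact g4

end

/-! ### The product automaton -/

/-- The requirements on the transition table of the product of both automata. -/
def IsProduct (n k : ℕ) (ch : ℕ → ℕ) (nr : ℕ → ℕ → ℕ) (ex nx : ℕ → ℕ → ℕ → ℕ) : Prop :=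
  ∀ pos < n, ∀ e ≤ k, ∀ q < numRecords n,
    nx pos (e * numRecords n + q) 0 =
      ex pos e 0 * numRecords n + q + 1 ∧
    nx pos (e * numRecords n + q) 1 =
      if addElemCode n ch nr pos q = 0 then 0 else
        ex pos e 1 * numRecords n + addElemCode n ch nr pos q

/-- The product state has the exclusion state as high digit and the record as low digit. Only bit 1
can block, exactly when the new element is not compatible. -/
theorem path_iff {n k : ℕ} {ch : ℕ → ℕ} {nr : ℕ → ℕ → ℕ} {ex nx : ℕ → ℕ → ℕ → ℕ}
    (hnx : IsProduct n k ch nr ex nx) (hch : ∀ p < n, ch p ≤ 1)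
    {row : ℕ → ℕ → ℕ} {act : ℕ → Prop} {X : ℕ → ℕ}
    (hex : ∀ pos < n, ∀ e ≤ k, ∀ b ≤ 1, TrieStep k row act pos e b (ex pos e b))
    (hX : ∀ p < n, X p ≤ 1) {e₀ : ℕ} (he : e₀ ≤ k) {r z : ℕ} (hr : r ≤ n) :
    Path nx X (e₀ * numRecords n) r z ↔
      z = trieState ex X e₀ r * numRecords n + recordOf n ch X r ∧
        ∀ p < r, X p = 1 → Compatible ch nr X p := by
  induction r generalizing z with
  | zero => simp [Path, trieState, recordOf, code4, firstOn, lastOn]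
  | succ r ih =>
    have hle := trieState_le hex hX he (r := r) (by omega)
    obtain ⟨n0, n1⟩ := hnx r (by omega) _ hle _ (recordOf_lt ch X (r := r) (by omega))
    simp only [Path, ih (by omega)]
    rcases Nat.le_one_iff_eq_zero_or_eq_one.1 (hX r (by omega)) with h | h
    · have hc : (∀ p < r + 1, X p = 1 → Compatible ch nr X p) ↔
          ∀ p < r, X p = 1 → Compatible ch nr X p := by
        refine ⟨fun hh p hp => hh p (by omega), fun hh p hp hXp => ?_⟩
        rcases Nat.lt_succ_iff_lt_or_eq.1 hp with h' | rfl
        · exact hh p h' hXp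
        · omega
      rw [hc, recordOf_succ_of_ne (by omega), trieState, h]
      constructor
      · rintro ⟨z', ⟨rfl, h1⟩, h2⟩
        rw [n0] at h2
        exact ⟨by omega, h1⟩
      · rintro ⟨rfl, h1⟩
        exact ⟨_, ⟨rfl, h1⟩, n0⟩
    · have hc : (∀ p < r + 1, X p = 1 → Compatible ch nr X p) ↔
          (∀ p < r, X p = 1 → Compatible ch nr X p) ∧ Compatible ch nr X r := by
        refine ⟨fun hh => ⟨fun p hp => hh p (by omega), hh r (by omega) h⟩, fun hh p hp hXp => ?_⟩
        rcases Nat.lt_succ_iff_lt_or_eq.1 hp with h' | rfl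
        · exact hh.1 p h' hXp
        · exact hh.2
      rw [hc, trieState, h]
      have key := fun z => addElemCode_recordOf (n := n) (nr := nr) (X := X) (r := r) (z := z)
        (hch r (by omega)) (by omega) h
      constructor
      · rintro ⟨z', ⟨rfl, h1⟩, h2⟩
        rw [n1] at h2
        split_ifs at h2 with h0
        obtain ⟨q, hq⟩ := Nat.exists_eq_succ_of_ne_zero h0
        obtain ⟨rfl, h3⟩ := (key q).1 hq
        exact ⟨by omega, h1, h3⟩
      · rintro ⟨rfl, h1, h3⟩
        refine ⟨_, ⟨rfl, h1⟩, ?_⟩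
        rw [n1, (key _).2 ⟨rfl, h3⟩, if_neg (by omega)]; rfl

/-- The product automaton accepts exactly the independent sets other than the excluded ones. -/
theorem accepted_iff {n k : ℕ} {ch : ℕ → ℕ} {nr : ℕ → ℕ → ℕ} {ex nx : ℕ → ℕ → ℕ → ℕ}
    (hnx : IsProduct n k ch nr ex nx) (hch : ∀ p < n, ch p ≤ 1)
    (h0 : ∀ q ≤ n, nr 0 q = 0) (hns : NeighboursSuffice n ch nr)
    {row : ℕ → ℕ → ℕ} {act : ℕ → Prop} {X : ℕ → ℕ} {mode : ℕ}
    (hex : ∀ pos < n, ∀ e ≤ k, ∀ b ≤ 1, TrieStep k row act pos e b (ex pos e b))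
    (hX : ∀ p < n, X p ≤ 1) {e₀ : ℕ} (hm : mode ≠ 0 → e₀ = k)
    (he : mode = 0 → (e₀ = k ∧ ∀ l, ¬ act l) ∨ (e₀ < k ∧ act e₀)) :
    (∃ z, Path nx X (e₀ * numRecords n) n z ∧
      k * numRecords n ≤ z) ↔
    Indep n nr X ∧ (mode = 0 → ∀ l, act l → ∃ p < n, row l p ≠ X p) := by
  have hek : e₀ ≤ k := by
    by_cases h : mode = 0
    · rcases he h with h | h
      · exact h.1.le
      · exact h.1.le
    · exact (hm h).le
  have hE : trieState ex X e₀ n = k ↔ (mode = 0 → ∀ l, act l → ∃ p < n, row l p ≠ X p) := by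
    by_cases h : mode = 0
    · rcases trieState_spec hex hX (he h) le_rfl with ⟨h1, h2⟩ | ⟨h1, h2, h3⟩
      · exact iff_of_true h1 fun _ => h2
      · refine iff_of_false h1.ne fun hh => ?_
        obtain ⟨p, hp, hne⟩ := hh h _ h2
        exact hne (h3 p hp)
    · rw [hm h]
      exact iff_of_true (trieState_free hex hX le_rfl) fun h' => absurd h' h
  have hle := trieState_le hex hX hek (r := n) le_rfl
  have hlt := recordOf_lt ch X (n := n) le_rfl
  rw [← hE, ← forall_compatible_iff hch h0 hns]
  simp only [path_iff hnx hch hex hX hek le_rfl]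
  constructor
  · rintro ⟨z, ⟨rfl, h1⟩, h2⟩
    refine ⟨h1, le_antisymm hle ?_⟩
    by_contra hcon
    -- A final state at least k · `numRecords n` means that the high digit is `k`, i.e. no excluded
    -- row agrees with the whole word.
    have := digit_lt (a := trieState ex X e₀ n) (d := k) (by omega) hlt
    omega
  · rintro ⟨h1, h2⟩
    exact ⟨_, ⟨rfl, h1⟩, by rw [h2]; omega⟩

end DiverseOpt

/-! ## The program: table sizes and preprocessing -/

namespace DiverseOpt

open RealRAM

set_option linter.unusedSimpArgs false

/-- The number of states of the product automaton. -/
def numStates (n k : ℕ) : ℕ := (k + 1) * numRecords n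

/-- The number of possible gains. -/
def numGains (n k : ℕ) : ℕ := n * k + 1

/-- The word length suffices to address the largest table. -/
structure Fits (w n k : ℕ) : Prop where
  one_le_n : 1 ≤ n
  one_le_k : 1 ≤ k
  table : (n + 1) * numStates n k * numGains n k < 2 ^ w

namespace Fits

variable {w n k : ℕ}

theorem two_le_gains (h : Fits w n k) : 2 ≤ numGains n k := by
  have := Nat.mul_le_mul h.one_le_n h.one_le_k
  unfold numGains; omega

/-- The factor 2 makes room for the transition tables, whose last coordinate is a bit. It comes from
the fact that at least two gains are possible. -/
theorem states_le (h : Fits w n k) : 2 * ((n + 1) * numStates n k) < 2 ^ w := by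
  refine lt_of_le_of_lt ?_ h.table
  rw [Nat.mul_comm 2]
  exact Nat.mul_le_mul_left _ h.two_le_gains

theorem sq_le_records (n : ℕ) : (n + 1) * (n + 1) ≤ numRecords n := by
  unfold numRecords
  exact (Nat.le_mul_of_pos_right _ (by omega)).trans (Nat.le_mul_of_pos_right _ (by omega))

theorem cube_le_records (n : ℕ) : (n + 1) * (n + 1) * (n + 1) ≤ numRecords n := by
  unfold numRecords
  exact Nat.le_mul_of_pos_right _ (by omega)

theorem records_pos (n : ℕ) : 0 < numRecords n := by unfold numRecords; positivity

theorem states_pos (n k : ℕ) : 0 < numStates n k :=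
  Nat.mul_pos (by omega) (records_pos n)

theorem records_le_states (n k : ℕ) : numRecords n ≤ numStates n k :=
  Nat.le_mul_of_pos_left _ (by omega)

theorem self_le_states (n k : ℕ) : k + 1 ≤ numStates n k :=
  Nat.le_mul_of_pos_right _ (records_pos n)

theorem mul_records_lt (h : Fits w n k) : (n + 1) * numRecords n < 2 ^ w := by
  have h1 := h.states_le
  have h2 := Nat.mul_le_mul_left (n + 1) (records_le_states n k)
  omega

theorem records_lt (h : Fits w n k) : numRecords n < 2 ^ w :=
  (Nat.le_mul_of_pos_left _ (by omega)).trans_lt h.mul_records_lt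

theorem sq_lt (h : Fits w n k) : (n + 1) * (n + 1) < 2 ^ w :=
  (sq_le_records n).trans_lt h.records_lt

theorem succ_lt (h : Fits w n k) : n + 1 < 2 ^ w :=
  (Nat.le_mul_of_pos_left _ (by omega)).trans_lt h.sq_lt

theorem trie_lt (h : Fits w n k) : 2 * ((n + 1) * (k + 1)) < 2 ^ w := by
  have h1 := h.states_le
  have h2 := Nat.mul_le_mul_left (n + 1) (self_le_states n k)
  omega

theorem succ_k_lt (h : Fits w n k) : k + 1 < 2 ^ w := by
  have h1 := h.trie_lt
  have h2 : k + 1 ≤ (n + 1) * (k + 1) := Nat.le_mul_of_pos_left _ (by omega)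
  omega

theorem states_lt (h : Fits w n k) : numStates n k < 2 ^ w := by
  have h1 := h.states_le
  have h2 : numStates n k ≤ (n + 1) * numStates n k := Nat.le_mul_of_pos_left _ (by omega)
  omega

theorem matrix_lt (h : Fits w n k) : (k + 1) * (n + 1) < 2 ^ w := by
  have h1 := h.trie_lt
  rw [Nat.mul_comm]; omega

theorem gains_le (h : Fits w n k) : numGains n k < 2 ^ w := by
  have := h.matrix_lt
  have e : (k + 1) * (n + 1) = n * k + k + n + 1 := by ring
  unfold numGains; omega

end Fits

/-- The memory holds the sizes of the input and of the tables. -/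
structure Sized (w n k : ℕ) (s : State) : Prop extends Fits w n k where
  w0 : s.wvar 0 = n
  w1 : s.wvar 1 = k
  w8 : s.wvar 8 = n + 1
  w9 : s.wvar 9 = numRecords n
  w10 : s.wvar 10 = k + 1
  w11 : s.wvar 11 = numStates n k
  w12 : s.wvar 12 = numGains n k
  w13 : s.wvar 13 = n * n
  w14 : s.wvar 14 = (n + 1) * (n + 1)
  w15 : s.wvar 15 = n * numRecords n
  w16 : s.wvar 16 = n * 2
  w17 : s.wvar 17 = n * (k + 1) * 2
  w18 : s.wvar 18 = n * numStates n k * 2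
  w19 : s.wvar 19 = (n + 1) * numStates n k * numGains n k
  w20 : s.wvar 20 = k * n
  w41 : s.wvar 41 = k * numRecords n

/-- The program does not write to the variables that hold sizes. -/
def keepsSizes (p : Cmd) : Bool :=
  [0, 1, 8, 9, 10, 11, 12, 13, 14, 15, 16, 17, 18, 19, 20, 41].all fun x => !p.writesW x

theorem Sized.frame {w n k : ℕ} {p : Cmd} {s s' : State} (h : Sized w n k s) (hF : Frame p s s')
    (hp : keepsSizes p = true) : Sized w n k s' := by
  simp only [keepsSizes, List.all_cons, List.all_nil, Bool.and_true, Bool.and_eq_true,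
    Bool.not_eq_true'] at hp
  obtain ⟨p0, p1, p8, p9, p10, p11, p12, p13, p14, p15, p16, p17, p18, p19, p20, p41⟩ := hp
  exact ⟨h.toFits, (hF.w _ p0).trans h.w0, (hF.w _ p1).trans h.w1, (hF.w _ p8).trans h.w8,
    (hF.w _ p9).trans h.w9, (hF.w _ p10).trans h.w10, (hF.w _ p11).trans h.w11,
    (hF.w _ p12).trans h.w12, (hF.w _ p13).trans h.w13, (hF.w _ p14).trans h.w14,
    (hF.w _ p15).trans h.w15, (hF.w _ p16).trans h.w16, (hF.w _ p17).trans h.w17,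
    (hF.w _ p18).trans h.w18, (hF.w _ p19).trans h.w19, (hF.w _ p20).trans h.w20,
    (hF.w _ p41).trans h.w41⟩

/-- Compute the table sizes. -/
def sizesP : Cmd :=
  .seq (.wset 8 (.add (.var 0) (.const 1))) <|
  .seq (.wset 9 (.mul (.mul (.mul (.var 8) (.var 8)) (.var 8)) (.var 8))) <|
  .seq (.wset 10 (.add (.var 1) (.const 1))) <|
  .seq (.wset 11 (.mul (.var 10) (.var 9))) <|
  .seq (.wset 12 (.add (.mul (.var 0) (.var 1)) (.const 1))) <|
  .seq (.wset 13 (.mul (.var 0) (.var 0))) <|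
  .seq (.wset 14 (.mul (.var 8) (.var 8))) <|
  .seq (.wset 15 (.mul (.var 0) (.var 9))) <|
  .seq (.wset 16 (.mul (.var 0) (.const 2))) <|
  .seq (.wset 17 (.mul (.mul (.var 0) (.var 10)) (.const 2))) <|
  .seq (.wset 18 (.mul (.mul (.var 0) (.var 11)) (.const 2))) <|
  .seq (.wset 19 (.mul (.mul (.var 8) (.var 11)) (.var 12))) <|
  .seq (.wset 20 (.mul (.var 1) (.var 0))) <|
  .wset 41 (.mul (.var 1) (.var 9))

theorem run_sizesP {w n k : ℕ} {s : State} (hf : Fits w n k) (h0 : s.wvar 0 = n)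
    (h1 : s.wvar 1 = k) : Run w sizesP s 100 (Sized w n k) := by
  have a1 := hf.table
  have a2 := hf.states_le
  have a3 := hf.mul_records_lt
  have a4 := hf.sq_lt
  have a5 := hf.succ_lt
  have a6 := hf.trie_lt
  have a7 := hf.succ_k_lt
  have a8 := hf.matrix_lt
  have a9 := hf.states_lt
  have a10 := hf.records_lt
  have a11 := hf.one_le_n
  have a12 := hf.one_le_k
  have a13 := (Fits.cube_le_records n).trans_lt a10
  have a14 := hf.gains_le
  have b1 : n * n ≤ (n + 1) * (n + 1) := Nat.mul_le_mul (by omega) (by omega)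
  have b2 : n * numRecords n ≤ (n + 1) * numRecords n := Nat.mul_le_mul_right _ (by omega)
  have b3 : n * (k + 1) ≤ (n + 1) * (k + 1) := Nat.mul_le_mul_right _ (by omega)
  have b4 : n * numStates n k ≤ (n + 1) * numStates n k := Nat.mul_le_mul_right _ (by omega)
  have b5 : k * n ≤ (k + 1) * (n + 1) := Nat.mul_le_mul (by omega) (by omega)
  have b6 : k * numRecords n ≤ numStates n k := Nat.mul_le_mul_right _ (by omega)
  have b7 : n * 2 ≤ (n + 1) * (k + 1) := Nat.mul_le_mul (by omega) (by omega)
  refine Run.of_wp ?_ (by decide)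
  simp only [sizesP, Cmd.wp, WExpr.Ok, WExpr.nat, State.setW_wvar]
  simp only [Nat.reduceEqDiff, reduceIte, OfNat.ofNat_ne_zero, h0, h1]
  have c1 : (n + 1) * (n + 1) * (n + 1) * (n + 1) = numRecords n := rfl
  have c2 : (k + 1) * numRecords n = numStates n k := rfl
  have c3 : n * k + 1 = numGains n k := rfl
  have c4 : n * k < 2 ^ w := by omega
  simp only [c1, c2, c3]
  refine ⟨⟨trivial, by omega, a5⟩, ⟨⟨⟨trivial, trivial, a4⟩, trivial, a13⟩, trivial, a10⟩,
    ⟨trivial, by omega, a7⟩, ⟨trivial, trivial, a9⟩,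
    ⟨⟨trivial, trivial, c4⟩, by omega, a14⟩, ⟨trivial, trivial, by omega⟩,
    ⟨trivial, trivial, a4⟩, ⟨trivial, trivial, by omega⟩, ⟨trivial, by omega, by omega⟩,
    ⟨⟨trivial, trivial, by omega⟩, by omega, by omega⟩,
    ⟨⟨trivial, trivial, by omega⟩, by omega, by omega⟩,
    ⟨⟨trivial, trivial, by omega⟩, trivial, a1⟩, ⟨trivial, trivial, by omega⟩,
    ⟨trivial, trivial, by omega⟩, ?_⟩
  constructor <;> simp [h0, h1, hf]

/-! ### The diameter. -/

/-- Squared distance of the points whose indices are in variables `a` and `b`. -/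
def sqDistE (a b : ℕ) : RExpr :=
  .add
    (.mul (.sub (.get 0 (.var a)) (.get 0 (.var b))) (.sub (.get 0 (.var a)) (.get 0 (.var b))))
    (.mul (.sub (.get 1 (.var a)) (.get 1 (.var b))) (.sub (.get 1 (.var a)) (.get 1 (.var b))))

theorem val_sqDistE (s : State) (a b : ℕ) :
    (sqDistE a b).val s = sqDist (s.rarr 0) (s.rarr 1) (s.wvar a) (s.wvar b) := rfl

theorem ok_sqDistE (w : ℕ) (s : State) (a b : ℕ) : (sqDistE a b).Ok w s := by simp [sqDistE]

/-- Find a pair of points at maximum distance. -/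
def diameterP : Cmd :=
  .seq (.wset 2 (.const 0)) <| .seq (.wset 3 (.const 0)) <|
  forLoop 4 13 <|
    .seq (.wset 28 (.div (.var 4) (.var 0))) <|
    .seq (.wset 29 (.mod (.var 4) (.var 0))) <|
    .ite (.rlt (sqDistE 2 3) (sqDistE 28 29))
      (.seq (.wset 2 (.var 28)) (.wset 3 (.var 29))) .skip

theorem run_diameterP {w n k : ℕ} {s : State} (hs : Sized w n k s) :
    Run w diameterP s ((n * n + 1) * 88 + 10) (fun s' => s'.wvar 2 < n ∧ s'.wvar 3 < n ∧
      ∀ a b, a < n → b < n → sqDist (s.rarr 0) (s.rarr 1) a b ≤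
        sqDist (s.rarr 0) (s.rarr 1) (s'.wvar 2) (s'.wvar 3)) := by
  have hn := hs.one_le_n
  have hlt := hs.toFits.sq_lt
  have hnn : n * n ≤ (n + 1) * (n + 1) := Nat.mul_le_mul (by omega) (by omega)
  refine Run.seq (T₁ := 2) (T₂ := (n * n + 1) * 88 + 8) (R := fun s' => s' = s.setW 2 0)
    (Run.of_wp (by simp) (by decide)) ?_ (by omega)
  rintro s₁ rfl -
  refine Run.seq (T₁ := 2) (T₂ := (n * n + 1) * 88) (R := fun s' => s' = (s.setW 2 0).setW 3 0)
    (Run.of_wp (by simp) (by decide)) ?_ (by omega)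
  rintro s₁ rfl -
  -- A single loop runs over all pairs, the pair (a, b) being visited at a * n + b.
  refine Run.forLoop (Tb := 80) (fun i s' => s'.wvar 2 < n ∧ s'.wvar 3 < n ∧
      ∀ t < i, sqDist (s.rarr 0) (s.rarr 1) (t / n) (t % n) ≤
        sqDist (s.rarr 0) (s.rarr 1) (s'.wvar 2) (s'.wvar 3)) rfl rfl ?_ ?_ ?_ ?_ ?_
  · simp [hs.w13]; omega
  · simp; omega
  · rintro t s' ht hF hx ⟨h2, h3, hI⟩
    simp only [State.setW_wvar] at ht
    have e0 : s'.wvar 0 = n := (hF.w 0 rfl).trans (by simp [hs.w0])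
    have r0 : s'.rarr 0 = s.rarr 0 := hF.ra 0 rfl
    have r1 : s'.rarr 1 = s.rarr 1 := hF.ra 1 rfl
    have ht' : t < n * n := by simpa [hs.w13] using ht
    refine Run.of_wp ?_ (by decide)
    simp only [Cmd.wp, WExpr.Ok, WExpr.nat, BExpr.Ok, BExpr.val, ok_sqDistE, val_sqDistE,
      State.setW_wvar, State.setW_rarr]
    simp only [OfNat.ofNat_ne_zero, OfNat.ofNat_ne_one, OfNat.zero_ne_ofNat,
      OfNat.one_ne_ofNat, Nat.reduceEqDiff, if_true, if_false, e0, hx, r0, r1, true_and, and_self]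
    refine ⟨fun hlt => ⟨(Nat.div_lt_iff_lt_mul hn).2 ht', Nat.mod_lt _ hn, fun t' ht' => ?_⟩,
      fun hge => ⟨h2, h3, fun t' ht' => ?_⟩⟩
    · rcases Nat.lt_succ_iff_lt_or_eq.1 ht' with h | rfl
      · exact (hI t' h).trans hlt.le
      · exact le_rfl
    · rcases Nat.lt_succ_iff_lt_or_eq.1 ht' with h | rfl
      · exact hI t' h
      · exact not_lt.1 hge
  · simp [hs.w13]
  · rintro s' hF hx ⟨h2, h3, hI⟩
    refine ⟨h2, h3, fun a b ha hb => ?_⟩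
    have := hI (a * n + b) (by simpa [hs.w13] using digit_lt ha hb)
    rwa [digit_div hb, digit_mod hb] at this

end DiverseOpt

namespace DiverseOpt

open RealRAM

set_option linter.unusedSimpArgs false

/-! ### Sorting -/

/-- The order in which the points are processed: by the key `al`, ties broken by index. -/
def Before (al : ℕ → ℝ) (b a : ℕ) : Prop := al b < al a ∨ (¬ al a < al b ∧ b < a)

open Classical in
/-- The position of `a` in the sorted order. -/
noncomputable def rankOf (al : ℕ → ℝ) (n a : ℕ) : ℕ :=
  ((Finset.range n).filter fun b => Before al b a).card

/-- `Before` is a strict order, so the predecessors of `b` are predecessors of `a`, and `b` itself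
is a predecessor of `a` only. -/
theorem rankOf_lt_rankOf {al : ℕ → ℝ} {n a b : ℕ} (hb : b < n) (h : Before al b a) :
    rankOf al n b < rankOf al n a := by
  classical
  unfold rankOf
  refine Finset.card_lt_card (Finset.ssubset_iff_subset_ne.2 ⟨?_, fun hcon => ?_⟩)
  · intro c hc
    rw [Finset.mem_filter] at hc ⊢
    refine ⟨hc.1, ?_⟩
    rcases hc.2 with h1 | ⟨h1, h2⟩ <;> rcases h with h3 | ⟨h3, h4⟩
    · exact .inl (h1.trans h3)
    · exact .inl (h1.trans_le (not_lt.1 h3))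
    · exact .inl ((not_lt.1 h1).trans_lt h3)
    · exact .inr ⟨not_lt.2 ((not_lt.1 h1).trans (not_lt.1 h3)), h2.trans h4⟩
  · have := hcon.symm ▸ Finset.mem_filter.2 ⟨Finset.mem_range.2 hb, h⟩
    simp [Before] at this

theorem rankOf_lt {al : ℕ → ℝ} {n a : ℕ} (ha : a < n) : rankOf al n a < n := by
  classical
  unfold rankOf
  refine (Finset.card_lt_card (t := Finset.range n) ⟨Finset.filter_subset _ _, fun hcon => ?_⟩).trans_eq
    (by simp)
  have := hcon (Finset.mem_range.2 ha)
  simp [Before] at this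

theorem rankOf_injOn (al : ℕ → ℝ) (n : ℕ) : Set.InjOn (rankOf al n) (Set.Iio n) := by
  intro a ha b hb h
  by_contra hne
  have : Before al a b ∨ Before al b a := by
    rcases lt_trichotomy (al a) (al b) with h1 | h1 | h1
    · exact .inl (.inl h1)
    · rcases Nat.lt_or_gt_of_ne hne with h2 | h2
      · exact .inl (.inr ⟨h1.not_gt, h2⟩)
      · exact .inr (.inr ⟨h1.symm.not_gt, h2⟩)
    · exact .inr (.inl h1)
  rcases this with h1 | h1
  · exact (rankOf_lt_rankOf ha h1).ne h
  · exact (rankOf_lt_rankOf hb h1).ne h.symm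

theorem exists_rankOf_eq (al : ℕ → ℝ) {n p : ℕ} (hp : p < n) : ∃ a < n, rankOf al n a = p := by
  classical
  have himg : (Finset.range n).image (rankOf al n) = Finset.range n := by
    refine Finset.eq_of_subset_of_card_le (fun q hq => ?_) ?_
    · obtain ⟨a, ha, rfl⟩ := Finset.mem_image.1 hq
      exact Finset.mem_range.2 (rankOf_lt (Finset.mem_range.1 ha))
    · rw [Finset.card_image_of_injOn]
      intro a ha b hb h
      exact rankOf_injOn al n (by simpa using ha) (by simpa using hb) h
  have := Finset.mem_range.2 hp
  rw [← himg] at this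
  obtain ⟨a, ha, h⟩ := Finset.mem_image.1 this
  exact ⟨a, Finset.mem_range.1 ha, h⟩

/-- `rk` and `od` are inverse bijections of the numbers below `n`, and `al ∘ od` is monotone. -/
structure IsSorting (n : ℕ) (al : ℕ → ℝ) (rk od : ℕ → ℕ) : Prop where
  rk_lt : ∀ a < n, rk a < n
  od_lt : ∀ p < n, od p < n
  rk_od : ∀ p < n, rk (od p) = p
  od_rk : ∀ a < n, od (rk a) = a
  mono : ∀ p q, p < q → q < n → al (od p) ≤ al (od q)

/-- Injectivity of the rank makes any right inverse two-sided. A descent of the key between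
consecutive positions would contradict strict monotonicity of the rank. -/
theorem isSorting_of_rankOf {n : ℕ} {al : ℕ → ℝ} {rk od : ℕ → ℕ}
    (hrk : ∀ a < n, rk a = rankOf al n a) (hod : ∀ p < n, od p < n ∧ rk (od p) = p) :
    IsSorting n al rk od := by
  have h1 : ∀ a < n, rk a < n := fun a ha => by rw [hrk a ha]; exact rankOf_lt ha
  refine ⟨h1, fun p hp => (hod p hp).1, fun p hp => (hod p hp).2, fun a ha => ?_,
    fun p q hpq hq => ?_⟩
  · refine rankOf_injOn al n (hod _ (h1 a ha)).1 ha ?_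
    rw [← hrk _ (hod _ (h1 a ha)).1, ← hrk a ha, (hod _ (h1 a ha)).2]
  · by_contra hcon
    have hq' := hod q hq
    have hp' := hod p (hpq.trans hq)
    have := rankOf_lt_rankOf hq'.1 (.inl (not_le.1 hcon))
    rw [← hrk _ hq'.1, ← hrk _ hp'.1, hq'.2, hp'.2] at this
    omega

/-- Compute the position of each point in the sorted order. -/
def rankP : Cmd :=
  forLoop 4 0 <| .seq
    (.seq (.wset 7 (.const 0)) <| forLoop 5 0 <|
      .ite (.or (.rlt (.get 3 (.var 5)) (.get 3 (.var 4)))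
          (.and (.not (.rlt (.get 3 (.var 4)) (.get 3 (.var 5)))) (.wlt (.var 5) (.var 4))))
        (.wset 7 (.add (.var 7) (.const 1))) .skip)
    (.wput 1 (.var 4) (.var 7))

theorem run_rankP {w n k : ℕ} {s : State} (hs : Sized w n k s) :
    Run w rankP s ((n + 1) * ((n + 1) * 48 + 13))
      (fun s' => ∀ a < n, s'.warr 1 a = rankOf (s.rarr 3) n a) := by
  classical
  have hn := hs.one_le_n
  have hlt := hs.toFits.succ_lt
  refine Run.fillW (Tb := (n + 1) * 48 + 2) (fun a v => v = rankOf (s.rarr 3) n a) rfl rfl rfl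
    (by rw [hs.w0]; omega) ?_ (by rw [hs.w0]) (fun s' _ h _ => by rwa [hs.w0] at h)
  intro a s' ha hF hx _ _
  have e0 : s'.wvar 0 = n := (hF.w 0 rfl).trans hs.w0
  have r3 : s'.rarr 3 = s.rarr 3 := hF.ra 3 rfl
  refine Run.seq (T₁ := 2) (T₂ := (n + 1) * 48) (R := fun s₁ => s₁ = s'.setW 7 0)
    (Run.of_wp (by simp) (by decide)) ?_ (by omega)
  rintro s₁ rfl -
  refine Run.forLoop (Tb := 40)
    (fun i s₂ => s₂.wvar 7 = ((Finset.range i).filter fun b => Before (s.rarr 3) b a).card) rfl rfl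
    (by simp [e0]; omega) (by simp) ?_ (by simp [e0]) (fun s₂ _ _ h => ?_)
  · intro b s₂ hb hF₂ hx₂ hI
    have hb' : b < n := by simpa [e0] using hb
    have e4 : s₂.wvar 4 = a := (hF₂.w 4 rfl).trans (by simp [hx])
    have r3' : s₂.rarr 3 = s.rarr 3 := (hF₂.ra 3 rfl).trans (by simp [r3])
    have hle := Finset.card_filter_le (Finset.range b) (fun b => Before (s.rarr 3) b a)
    rw [Finset.card_range] at hle
    refine Run.of_wp ?_ (by decide)
    simp only [Cmd.wp, WExpr.Ok, WExpr.nat, RExpr.Ok, RExpr.val, BExpr.Ok, BExpr.val,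
      State.setW_wvar, State.setW_rarr, Nat.reduceEqDiff, reduceIte, e4, hx₂, r3', hI,
      Finset.range_add_one, Finset.filter_insert]
    refine ⟨by simp, fun h => ⟨⟨trivial, by omega, by omega⟩, ?_⟩, fun h => ?_⟩
    · rw [if_pos (by exact h), Finset.card_insert_of_notMem (by simp)]
    · rw [if_neg (by exact h)]
  · simpa [e0, rankOf] using h

/-- Invert the sorting permutation. -/
def orderP : Cmd :=
  forLoop 4 0 <| .seq
    (.seq (.wset 7 (.const 0)) <| forLoop 5 0 <|
      .ite (.weq (.get 1 (.var 5)) (.var 4)) (.wset 7 (.var 5)) .skip)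
    (.wput 2 (.var 4) (.var 7))

/-- The initial value 0 of the search is a placeholder, so correctness is conditional on a match;
that each position occurs is a property of the rank, supplied by `exists_rankOf_eq`. -/
theorem run_orderP {w n k : ℕ} {s : State} (hs : Sized w n k s) :
    Run w orderP s ((n + 1) * ((n + 1) * 28 + 13))
      (fun s' => ∀ p < n, (∃ a < n, s.warr 1 a = p) → s'.warr 2 p < n ∧ s.warr 1 (s'.warr 2 p) = p) := by
  have hn := hs.one_le_n
  have hlt := hs.toFits.succ_lt
  refine Run.fillW (Tb := (n + 1) * 28 + 2)
    (fun p v => (∃ a < n, s.warr 1 a = p) → v < n ∧ s.warr 1 v = p) rfl rfl rfl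
    (by rw [hs.w0]; omega) ?_ (by rw [hs.w0]) (fun s' _ h _ => by rwa [hs.w0] at h)
  intro p s' hp hF hx _ _
  have e0 : s'.wvar 0 = n := (hF.w 0 rfl).trans hs.w0
  have a1 : s'.warr 1 = s.warr 1 := hF.wa 1 rfl
  refine Run.seq (T₁ := 2) (T₂ := (n + 1) * 28) (R := fun s₁ => s₁ = s'.setW 7 0)
    (Run.of_wp (by simp) (by decide)) ?_ (by omega)
  rintro s₁ rfl -
  refine Run.forLoop (Tb := 20)
    (fun i s₂ => (∃ a < i, s.warr 1 a = p) → s₂.wvar 7 < n ∧ s.warr 1 (s₂.wvar 7) = p) rfl rfl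
    (by simp [e0]; omega) (by simp) ?_ (by simp [e0]) (fun s₂ _ _ h => by simpa [e0] using h)
  intro b s₂ hb hF₂ hx₂ hI
  have hb' : b < n := by simpa [e0] using hb
  have e4 : s₂.wvar 4 = p := (hF₂.w 4 rfl).trans (by simp [hx])
  have a1' : s₂.warr 1 = s.warr 1 := (hF₂.wa 1 rfl).trans (by simp [a1])
  refine Run.of_wp ?_ (by decide)
  simp only [Cmd.wp, WExpr.Ok, WExpr.nat, BExpr.Ok, BExpr.val,
    State.setW_wvar, Nat.reduceEqDiff, reduceIte, e4, hx₂, a1']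
  refine ⟨by simp, fun h => ⟨trivial, fun _ => ⟨hb', h⟩⟩, fun h => ?_⟩
  rintro ⟨a, ha, hap⟩
  rcases Nat.lt_succ_iff_lt_or_eq.1 ha with h' | rfl
  · exact hI ⟨a, h', hap⟩
  · exact absurd hap h

/-! ### Coordinates along and across the diameter -/

/-- Compute the coordinates along the diameter. -/
def alongP : Cmd :=
  forLoop 4 0 <| .seq
    (.rset 1 (.add
      (.mul (.sub (.get 0 (.var 4)) (.get 0 (.var 2))) (.sub (.get 0 (.var 3)) (.get 0 (.var 2))))
      (.mul (.sub (.get 1 (.var 4)) (.get 1 (.var 2))) (.sub (.get 1 (.var 3)) (.get 1 (.var 2))))))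
    (.rput 3 (.var 4) (.var 1))

theorem run_alongP {w n k : ℕ} {s : State} (hs : Sized w n k s) :
    Run w alongP s ((n + 1) * 51)
      (fun s' => ∀ a < n, s'.rarr 3 a = along (s.rarr 0) (s.rarr 1) (s.wvar 2) (s.wvar 3) a) := by
  have hlt := hs.toFits.succ_lt
  refine Run.fillR (Tb := 40)
    (fun a v => v = along (s.rarr 0) (s.rarr 1) (s.wvar 2) (s.wvar 3) a) rfl rfl rfl
    (by rw [hs.w0]; omega) ?_ (by rw [hs.w0]) (fun s' _ h => by rwa [hs.w0] at h)
  intro a s' ha hF hx _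
  refine Run.of_wp ?_ (by decide)
  simp [along, hx, hF.ra 0 rfl, hF.ra 1 rfl, hF.w 2 rfl, hF.w 3 rfl]

/-- Compute the coordinates across the diameter. -/
def acrossP : Cmd :=
  forLoop 4 0 <| .seq
    (.rset 1 (.sub
      (.mul (.sub (.get 0 (.var 3)) (.get 0 (.var 2))) (.sub (.get 1 (.var 4)) (.get 1 (.var 2))))
      (.mul (.sub (.get 1 (.var 3)) (.get 1 (.var 2))) (.sub (.get 0 (.var 4)) (.get 0 (.var 2))))))
    (.rput 4 (.var 4) (.var 1))

theorem run_acrossP {w n k : ℕ} {s : State} (hs : Sized w n k s) :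
    Run w acrossP s ((n + 1) * 51)
      (fun s' => ∀ a < n, s'.rarr 4 a = across (s.rarr 0) (s.rarr 1) (s.wvar 2) (s.wvar 3) a) := by
  have hlt := hs.toFits.succ_lt
  refine Run.fillR (Tb := 40)
    (fun a v => v = across (s.rarr 0) (s.rarr 1) (s.wvar 2) (s.wvar 3) a) rfl rfl rfl
    (by rw [hs.w0]; omega) ?_ (by rw [hs.w0]) (fun s' _ h => by rwa [hs.w0] at h)
  intro a s' ha hF hx _
  refine Run.of_wp ?_ (by decide)
  simp [across, hx, hF.ra 0 rfl, hF.ra 1 rfl, hF.w 2 rfl, hF.w 3 rfl]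

/-- List the weights in sorted order. -/
def weightsP : Cmd :=
  forLoop 4 0 <| .seq (.rset 1 (.get 2 (.get 2 (.var 4)))) (.rput 5 (.var 4) (.var 1))

theorem run_weightsP {w n k : ℕ} {s : State} (hs : Sized w n k s) :
    Run w weightsP s ((n + 1) * 21)
      (fun s' => ∀ p < n, s'.rarr 5 p = s.rarr 2 (s.warr 2 p)) := by
  have hlt := hs.toFits.succ_lt
  refine Run.fillR (Tb := 10) (fun p v => v = s.rarr 2 (s.warr 2 p)) rfl rfl rfl
    (by rw [hs.w0]; omega) ?_ (by rw [hs.w0]) (fun s' _ h => by rwa [hs.w0] at h)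
  intro a s' ha hF hx _
  refine Run.of_wp ?_ (by decide)
  simp [hx, hF.ra 2 rfl, hF.wa 2 rfl]

/-- Record on which side of the diameter the points lie. -/
def chainsP : Cmd :=
  forLoop 4 0 <| .seq
    (.ite (.rle (.const 0) (.get 4 (.get 2 (.var 4)))) (.wset 7 (.const 0)) (.wset 7 (.const 1)))
    (.wput 3 (.var 4) (.var 7))

theorem run_chainsP {w n k : ℕ} {s : State} (hs : Sized w n k s) :
    Run w chainsP s ((n + 1) * 31)
      (fun s' => ∀ p < n, s'.warr 3 p = if 0 ≤ s.rarr 4 (s.warr 2 p) then 0 else 1) := by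
  have hlt := hs.toFits.succ_lt
  refine Run.fillW (Tb := 20) (fun p v => v = if 0 ≤ s.rarr 4 (s.warr 2 p) then 0 else 1)
    rfl rfl rfl (by rw [hs.w0]; omega) ?_ (by rw [hs.w0]) (fun s' _ h _ => by rwa [hs.w0] at h)
  intro a s' ha hF hx _ _
  refine Run.of_wp ?_ (by decide)
  simp only [Cmd.wp, WExpr.Ok, WExpr.nat, RExpr.Ok, RExpr.val, BExpr.Ok, BExpr.val, Nat.cast_zero,
    State.setW_wvar, reduceIte, hx, hF.ra 4 rfl, hF.wa 2 rfl]
  refine ⟨by simp, fun h => ⟨by omega, by rw [if_pos h]⟩, fun h => ⟨by omega, by rw [if_neg h]⟩⟩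

/-! ### Conflicts -/

/-- Conflict of the positions `a - 1` and `b - 1`; position `-1` has no conflicts. -/
noncomputable def nearOf (px py : ℕ → ℝ) (od : ℕ → ℕ) (a b : ℕ) : ℕ :=
  open Classical in
  if a = 0 ∨ b = 0 then 0 else if sqDist px py (od (a - 1)) (od (b - 1)) ≤ 1 then 1 else 0

/-- Tabulate the conflicts. -/
def nearP : Cmd :=
  forLoop 4 14 <| .seq
    (.seq (.wset 28 (.div (.var 4) (.var 8))) <|
     .seq (.wset 29 (.mod (.var 4) (.var 8))) <|
     .seq (.wset 7 (.const 0)) <|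
     .ite (.or (.weq (.var 28) (.const 0)) (.weq (.var 29) (.const 0))) .skip <|
     .seq (.wset 30 (.get 2 (.sub (.var 28) (.const 1)))) <|
     .seq (.wset 31 (.get 2 (.sub (.var 29) (.const 1)))) <|
     .ite (.rle (sqDistE 30 31) (.const 1)) (.wset 7 (.const 1)) .skip)
    (.wput 4 (.var 4) (.var 7))

theorem run_nearP {w n k : ℕ} {s : State} (hs : Sized w n k s) :
    Run w nearP s (((n + 1) * (n + 1) + 1) * 91)
      (fun s' => ∀ t < (n + 1) * (n + 1), s'.warr 4 t =
        nearOf (s.rarr 0) (s.rarr 1) (s.warr 2) (t / (n + 1)) (t % (n + 1))) := by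
  have hlt := hs.toFits.sq_lt
  have hlt' := hs.toFits.succ_lt
  refine Run.fillW (Tb := 80) (fun t v => v =
      nearOf (s.rarr 0) (s.rarr 1) (s.warr 2) (t / (n + 1)) (t % (n + 1))) rfl rfl rfl
    (by rw [hs.w14]; omega) ?_ (by rw [hs.w14]) (fun s' _ h _ => by rwa [hs.w14] at h)
  intro t s' ht hF hx _ _
  refine Run.of_wp ?_ (by decide)
  simp only [Cmd.wp, WExpr.Ok, WExpr.nat, RExpr.Ok, RExpr.val, BExpr.Ok, BExpr.val, Nat.cast_one,
    ok_sqDistE, val_sqDistE, State.setW_wvar, State.setW_warr, State.setW_rarr, Nat.reduceEqDiff,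
    reduceIte, hx, hF.w 8 rfl, hs.w8, hF.ra 0 rfl, hF.ra 1 rfl, hF.wa 2 rfl, nearOf]
  have p0 : 0 < 2 ^ w := by omega
  have p1 : 1 < 2 ^ w := by omega
  refine ⟨⟨trivial, trivial⟩, ⟨trivial, trivial⟩, p0, ⟨⟨trivial, p0⟩, fun _ => ⟨trivial, p0⟩⟩,
    fun h => by rw [if_pos h], fun h => ⟨⟨trivial, p1⟩, ⟨trivial, p1⟩, ⟨trivial, trivial⟩,
      fun h' => ⟨p1, ?_⟩, fun h' => ?_⟩⟩
  · rw [if_neg h, if_pos h']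
  · rw [if_neg h, if_neg h']

/-- Read the conflict of the codes in variables `a` and `b`. -/
def nearE (a b : ℕ) : WExpr := .get 4 (.add (.mul (.var a) (.var 8)) (.var b))

/-- The number with the digits in variables `a`, `b`, `c`, `d`, plus one. -/
def code4E (a b c d : ℕ) : WExpr :=
  .add (.add (.mul (.add (.mul (.add (.mul (.var a) (.var 8)) (.var b)) (.var 8)) (.var c)) (.var 8))
    (.var d)) (.const 1)

theorem ok_nearE {w n k : ℕ} (hf : Fits w n k) {s : State} {a b : ℕ} (h8 : s.wvar 8 = n + 1)
    (ha : s.wvar a < n + 1) (hb : s.wvar b < n + 1) : (nearE a b).Ok w s := by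
  have h1 := hf.sq_lt
  have h2 := digit_lt ha hb
  simp only [nearE, WExpr.Ok, WExpr.nat, h8, true_and, and_true]
  omega

theorem ok_code4E {w n k : ℕ} (hf : Fits w n k) {s : State} {a b c d : ℕ} (h8 : s.wvar 8 = n + 1)
    (ha : s.wvar a < n + 1) (hb : s.wvar b < n + 1) (hc : s.wvar c < n + 1) (hd : s.wvar d < n + 1) :
    (code4E a b c d).Ok w s ∧
      (code4E a b c d).nat s = code4 (n + 1) (s.wvar a) (s.wvar b) (s.wvar c) (s.wvar d) + 1 := by
  have h1 := hf.sq_lt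
  have h2 := hf.records_lt
  have h3 := digit_lt ha hb
  have h4 := digit_lt h3 hc
  have h5 := digit_lt h4 hd
  have h6 := Fits.cube_le_records n
  have h7 := hf.succ_lt
  have h9 : (n + 1) * (n + 1) * (n + 1) * (n + 1) = numRecords n := rfl
  have h10 := hf.two_le_gains
  simp only [code4E, WExpr.Ok, WExpr.nat, h8, true_and, and_true, code4]
  omega

/-- One transition of the automaton of independent sets: the position and its successor are in
variables 28 and 36, the digits of the state in 35, 34, 32 and 30. -/
def addElemStepP : Cmd :=
  .ite (.and (.weq (nearE 32 36) (.const 0)) (.weq (nearE 30 36) (.const 0)))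
      (.ite (.weq (.get 3 (.var 28)) (.const 0))
        (.ite (.weq (nearE 34 36) (.const 0))
          (.seq (.ite (.weq (.var 35) (.const 0)) (.wset 35 (.var 36)) .skip)
            (.wset 7 (code4E 35 34 36 30)))
          .skip)
        (.ite (.weq (nearE 35 36) (.const 0))
          (.seq (.ite (.weq (.var 34) (.const 0)) (.wset 34 (.var 36)) .skip)
            (.wset 7 (code4E 35 34 32 36)))
          .skip))
      .skip

/-- Stated for `wp` rather than `Run`, so that `Cmd.wp_mono` can splice it into the loop-free body
of `addElemP`. -/
theorem wp_addElemStepP {w n k : ℕ} (hf : Fits w n k) {s : State} (h8 : s.wvar 8 = n + 1)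
    (h7 : s.wvar 7 = 0) (h36 : s.wvar 36 = s.wvar 28 + 1) (h28 : s.wvar 28 < n)
    (h30 : s.wvar 30 < n + 1) (h32 : s.wvar 32 < n + 1) (h34 : s.wvar 34 < n + 1)
    (h35 : s.wvar 35 < n + 1) :
    addElemStepP.wp w (fun s' => s'.wvar 7 =
      addElem n (s.warr 3) (fun a b => s.warr 4 (a * (n + 1) + b)) (s.wvar 28) (s.wvar 35)
        (s.wvar 34) (s.wvar 32) (s.wvar 30)) s := by
  have p0 : 0 < 2 ^ w := by have := hf.succ_lt; omega
  have okn : ∀ a b, s.wvar a < n + 1 → s.wvar b < n + 1 → (nearE a b).Ok w s :=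
    fun a b => ok_nearE hf h8
  have h36' : s.wvar 36 < n + 1 := by omega
  have vn : ∀ a, (nearE a 36).nat s = s.warr 4 (s.wvar a * (n + 1) + (s.wvar 28 + 1)) := by
    intro a; simp only [nearE, WExpr.nat, h8, h36]
  simp only [addElemStepP, Cmd.wp, BExpr.Ok, BExpr.val, WExpr.Ok, WExpr.nat, vn, p0, okn, h30, h32,
    h34, h35, h36', true_and, and_true, implies_true, addElem]
  refine ⟨fun hA => ?_, fun hA => by rw [if_neg hA, h7]⟩
  simp only [if_pos hA]
  refine ⟨fun hB => ?_, fun hB => ?_⟩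
  · simp only [if_pos hB]
    refine ⟨fun hC => ?_, fun hC => by rw [if_neg hC, h7]⟩
    simp only [if_pos hC]
    refine ⟨fun hD => ?_, fun hD => ?_⟩
    · obtain ⟨g1, g2⟩ := ok_code4E (s := s.setW 35 (s.wvar 36)) (a := 35) (b := 34) (c := 36) (d := 30)
        hf (by simpa using h8) (by simp; omega) (by simp; omega)
        (by simp; omega) (by simp; omega)
      refine ⟨g1, ?_⟩
      rw [State.setW_wvar, if_pos rfl, g2, if_pos hD]
      simp [h36]
    · obtain ⟨g1, g2⟩ := ok_code4E (s := s) (a := 35) (b := 34) (c := 36) (d := 30)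
        hf h8 h35 h34 h36' h30
      refine ⟨g1, ?_⟩
      rw [State.setW_wvar, if_pos rfl, g2, if_neg hD, h36]
  · simp only [if_neg hB]
    refine ⟨fun hC => ?_, fun hC => by rw [if_neg hC, h7]⟩
    simp only [if_pos hC]
    refine ⟨fun hD => ?_, fun hD => ?_⟩
    · obtain ⟨g1, g2⟩ := ok_code4E (s := s.setW 34 (s.wvar 36)) (a := 35) (b := 34) (c := 32) (d := 36)
        hf (by simpa using h8) (by simp; omega) (by simp; omega)
        (by simp; omega) (by simp; omega)
      refine ⟨g1, ?_⟩
      rw [State.setW_wvar, if_pos rfl, g2, if_pos hD]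
      simp [h36]
    · obtain ⟨g1, g2⟩ := ok_code4E (s := s) (a := 35) (b := 34) (c := 32) (d := 36)
        hf h8 h35 h34 h32 h36'
      refine ⟨g1, ?_⟩
      rw [State.setW_wvar, if_pos rfl, g2, if_neg hD, h36]

/-- Tabulate the transitions of the automaton of independent sets. -/
def addElemP : Cmd :=
  forLoop 4 15 <| .seq
    (.seq (.wset 28 (.div (.var 4) (.var 9))) <|
     .seq (.wset 29 (.mod (.var 4) (.var 9))) <|
     .seq (.wset 30 (.mod (.var 29) (.var 8))) <|
     .seq (.wset 31 (.div (.var 29) (.var 8))) <|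
     .seq (.wset 32 (.mod (.var 31) (.var 8))) <|
     .seq (.wset 33 (.div (.var 31) (.var 8))) <|
     .seq (.wset 34 (.mod (.var 33) (.var 8))) <|
     .seq (.wset 35 (.div (.var 33) (.var 8))) <|
     .seq (.wset 36 (.add (.var 28) (.const 1))) <|
     .seq (.wset 7 (.const 0)) <|
     addElemStepP)
    (.wput 5 (.var 4) (.var 7))

theorem run_addElemP {w n k : ℕ} {s : State} (hs : Sized w n k s) :
    Run w addElemP s ((n * numRecords n + 1) * 161)
      (fun s' => ∀ t < n * numRecords n, s'.warr 5 t =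
        addElemCode n (s.warr 3) (fun a b => s.warr 4 (a * (n + 1) + b)) (t / numRecords n)
          (t % numRecords n)) := by
  have hf := hs.toFits
  have hlt := hf.mul_records_lt
  have hle : n * numRecords n ≤ (n + 1) * numRecords n := Nat.mul_le_mul_right _ (by omega)
  have hN := Fits.records_pos n
  have hs1 := hf.succ_lt
  refine Run.fillW (Tb := 150) (fun t v => v =
      addElemCode n (s.warr 3) (fun a b => s.warr 4 (a * (n + 1) + b)) (t / numRecords n)
          (t % numRecords n)) rfl rfl rfl
    (by rw [hs.w15]; omega) ?_ (by rw [hs.w15]) (fun s' _ h _ => by rwa [hs.w15] at h)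
  intro t s' ht hF hx _ _
  rw [hs.w15] at ht
  have hpos : t / numRecords n < n := (Nat.div_lt_iff_lt_mul hN).2 ht
  have hq : t % numRecords n < numRecords n := Nat.mod_lt _ hN
  have p0 : 0 < 2 ^ w := by omega
  have p1 : 1 < 2 ^ w := by have := hf.one_le_n; omega
  have h0 : t % numRecords n / (n + 1) / (n + 1) / (n + 1) < n + 1 := by
    rw [Nat.div_lt_iff_lt_mul (by omega), Nat.div_lt_iff_lt_mul (by omega),
      Nat.div_lt_iff_lt_mul (by omega)]; exact hq
  have h1 : t % numRecords n / (n + 1) / (n + 1) % (n + 1) < n + 1 := Nat.mod_lt _ (by omega)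
  have h2 : t % numRecords n / (n + 1) % (n + 1) < n + 1 := Nat.mod_lt _ (by omega)
  have h3 : t % numRecords n % (n + 1) < n + 1 := Nat.mod_lt _ (by omega)
  unfold addElemCode
  have e8 : s'.wvar 8 = n + 1 := (hF.w 8 rfl).trans hs.w8
  have e9 : s'.wvar 9 = numRecords n := (hF.w 9 rfl).trans hs.w9
  have a3 : s'.warr 3 = s.warr 3 := hF.wa 3 rfl
  have a4 : s'.warr 4 = s.warr 4 := hF.wa 4 rfl
  refine Run.of_wp ?_ (by decide)
  simp only [Cmd.wp, WExpr.Ok, WExpr.nat, State.setW_wvar, State.setW_warr, Nat.reduceEqDiff,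
    reduceIte, true_and, and_self, hx, e8, e9]
  refine ⟨⟨p1, by omega⟩, p0, ?_⟩
  refine Cmd.wp_mono (wp_addElemStepP hf ?_ ?_ ?_ ?_ ?_ ?_ ?_ ?_) fun s'' h => h.trans ?_
  all_goals simp [e8, a3, a4, hpos, h0, h1, h2, h3]

end DiverseOpt

namespace DiverseOpt

open RealRAM

set_option linter.unusedSimpArgs false

/-! ### Gains and exclusion -/

/-- The rows of the matrix of current solutions. -/
def rowOf (n : ℕ) (s : State) (j p : ℕ) : ℕ := s.warr 6 (j * n + p)

open Classical in
/-- The number of active rows whose bit at `pos` differs from `b`. -/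
noncomputable def gainOf (row : ℕ → ℕ → ℕ) (i K pos b : ℕ) : ℕ :=
  ((Finset.range K).filter fun j => j ≠ i ∧ row j pos ≠ b).card

theorem gainOf_le (row : ℕ → ℕ → ℕ) (i K pos b : ℕ) : gainOf row i K pos b ≤ K := by
  classical
  exact (Finset.card_filter_le _ _).trans (by simp)

theorem cell_lt {w n k : ℕ} (hf : Fits w n k) {j p : ℕ} (hj : j < k) (hp : p < n) :
    j * n + p < 2 ^ w := by
  have h1 := digit_lt hj hp
  have h2 := hf.matrix_lt
  have h3 : k * n ≤ (k + 1) * (n + 1) := Nat.mul_le_mul (by omega) (by omega)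
  omega

/-- Tabulate the gains. -/
def gainsP : Cmd :=
  forLoop 4 16 <| .seq
    (.seq (.wset 28 (.div (.var 4) (.const 2))) <|
     .seq (.wset 29 (.mod (.var 4) (.const 2))) <|
     .seq (.wset 7 (.const 0)) <|
     forLoop 5 22 <|
      .ite (.and (.not (.weq (.var 5) (.var 21)))
          (.not (.weq (.get 6 (.add (.mul (.var 5) (.var 0)) (.var 28))) (.var 29))))
        (.wset 7 (.add (.var 7) (.const 1))) .skip)
    (.wput 7 (.var 4) (.var 7))

theorem run_gainsP {w n k i K : ℕ} {s : State} (hs : Sized w n k s) (hi : s.wvar 21 = i)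
    (hK : s.wvar 22 = K) (hKk : K ≤ k) :
    Run w gainsP s ((n * 2 + 1) * ((k + 1) * 38 + 23))
      (fun s' => ∀ t < n * 2, s'.warr 7 t = gainOf (rowOf n s) i K (t / 2) (t % 2)) := by
  classical
  have hf := hs.toFits
  have hlt := hf.trie_lt
  have hle : n * 2 ≤ (n + 1) * (k + 1) := Nat.mul_le_mul (by omega) (by have := hf.one_le_k; omega)
  have hk1 := hf.succ_k_lt
  have hk2 := hf.one_le_k
  have hn1 := hf.succ_lt
  have p2 : 2 < 2 ^ w := by
    have := Nat.mul_le_mul hf.one_le_n hk2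
    have : (n + 1) * (k + 1) = n * k + n + k + 1 := by ring
    omega
  refine Run.fillW (Tb := (k + 1) * 38 + 12) (fun t v => v = gainOf (rowOf n s) i K (t / 2) (t % 2))
    rfl rfl rfl (by rw [hs.w16]; omega) ?_ (by rw [hs.w16])
    (fun s' _ h _ => by rwa [hs.w16] at h)
  intro t s' ht hF hx _ _
  have ht' : t < n * 2 := by rwa [hs.w16] at ht
  refine Run.seq (T₁ := 4) (T₂ := (k + 1) * 38 + 8) (R := fun s₁ => s₁ = s'.setW 28 (t / 2))
    (Run.of_wp (by simp [hx, p2]) (by decide)) ?_ (by omega)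
  rintro s₁ rfl -
  refine Run.seq (T₁ := 4) (T₂ := (k + 1) * 38 + 4)
    (R := fun s₁ => s₁ = (s'.setW 28 (t / 2)).setW 29 (t % 2))
    (Run.of_wp (by simp [hx, p2]) (by decide)) ?_ (by omega)
  rintro s₁ rfl -
  refine Run.seq (T₁ := 2) (T₂ := (k + 1) * 38)
    (R := fun s₁ => s₁ = ((s'.setW 28 (t / 2)).setW 29 (t % 2)).setW 7 0)
    (Run.of_wp (by simp) (by decide)) ?_ (by omega)
  rintro s₁ rfl -
  have e22 : s'.wvar 22 = K := (hF.w 22 rfl).trans hK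
  refine Run.forLoop (Tb := 30) (fun l s₂ => s₂.wvar 7 =
      ((Finset.range l).filter fun j => j ≠ i ∧ rowOf n s j (t / 2) ≠ t % 2).card)
    rfl rfl (by simp [e22]; omega) (by simp) ?_
    (by simp only [State.setW_wvar, Nat.reduceEqDiff, reduceIte, e22]
        exact Nat.mul_le_mul_right _ (by omega))
    (fun s₂ _ _ h => by simpa [e22, gainOf] using h)
  intro j s₂ hj hF₂ hx₂ hI
  have hj' : j < K := by simpa [e22] using hj
  have e0 : s₂.wvar 0 = n := (hF₂.w 0 rfl).trans (by simp [hF.w 0 rfl, hs.w0])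
  have e21 : s₂.wvar 21 = i := (hF₂.w 21 rfl).trans (by simp [hF.w 21 rfl, hi])
  have e28 : s₂.wvar 28 = t / 2 := (hF₂.w 28 rfl).trans (by simp)
  have e29 : s₂.wvar 29 = t % 2 := (hF₂.w 29 rfl).trans (by simp)
  have a6 : s₂.warr 6 = s.warr 6 := (hF₂.wa 6 rfl).trans (by simp [hF.wa 6 rfl])
  have hle := Finset.card_filter_le (Finset.range j) fun j => j ≠ i ∧ rowOf n s j (t / 2) ≠ t % 2
  rw [Finset.card_range] at hle
  have hcell := cell_lt hf (j := j) (p := t / 2) (by omega) (by omega)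
  refine Run.of_wp ?_ (by decide)
  simp only [Cmd.wp, WExpr.Ok, WExpr.nat, BExpr.Ok, BExpr.val,
    State.setW_wvar, Nat.reduceEqDiff, reduceIte, e0, e21, e28, e29, hx₂, a6, hI,
    Finset.range_add_one, Finset.filter_insert]
  refine ⟨⟨⟨trivial, trivial⟩, fun _ => ⟨⟨⟨trivial, trivial, by omega⟩, trivial, by omega⟩, trivial⟩⟩,
    fun h => ⟨⟨trivial, by omega, by omega⟩, ?_⟩, fun h => ?_⟩
  · rw [if_pos (by exact h), Finset.card_insert_of_notMem (by simp)]
  · rw [if_neg (by exact h)]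

/-- Tabulate the transitions of the automaton that compares with the active rows. -/
def trieP : Cmd :=
  forLoop 4 17 <| .seq
    (.seq (.wset 28 (.div (.div (.var 4) (.const 2)) (.var 10))) <|
     .seq (.wset 29 (.mod (.div (.var 4) (.const 2)) (.var 10))) <|
     .seq (.wset 30 (.mod (.var 4) (.const 2))) <|
     .seq (.wset 7 (.var 1)) <|
     .ite (.wlt (.var 29) (.var 1))
      (forLoop 5 22 <|
        .ite (.weq (.var 5) (.var 21)) .skip <|
        .seq (.wset 31 (.const 1)) <|
        .seq
          (forLoop 6 28 <|
            .ite (.weq (.get 6 (.add (.mul (.var 5) (.var 0)) (.var 6)))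
                (.get 6 (.add (.mul (.var 29) (.var 0)) (.var 6))))
              .skip (.wset 31 (.const 0)))
          (.ite (.and (.weq (.var 31) (.const 1))
              (.weq (.get 6 (.add (.mul (.var 5) (.var 0)) (.var 28))) (.var 30)))
            (.wset 7 (.var 5)) .skip))
      .skip)
    (.wput 8 (.var 4) (.var 7))

theorem run_trieP {w n k i K : ℕ} {s : State} (hs : Sized w n k s) (hi : s.wvar 21 = i)
    (hK : s.wvar 22 = K) (hKk : K ≤ k) :
    Run w trieP s ((n * (k + 1) * 2 + 1) * ((k + 1) * ((n + 1) * 38 + 40) + 60))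
      (fun s' => ∀ t < n * (k + 1) * 2, TrieStep k (rowOf n s) (Active i K) (t / 2 / (k + 1))
        (t / 2 % (k + 1)) (t % 2) (s'.warr 8 t)) := by
  have hf := hs.toFits
  have hlt := hf.trie_lt
  have hn1 := hf.succ_lt
  have hk1 := hf.succ_k_lt
  have hle : n * (k + 1) ≤ (n + 1) * (k + 1) := Nat.mul_le_mul_right _ (by omega)
  have p2 : 2 < 2 ^ w := by
    have := Nat.mul_le_mul hf.one_le_n hf.one_le_k
    have : (n + 1) * (k + 1) = n * k + n + k + 1 := by ring
    have := hf.one_le_n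
    omega
  have p0 : 0 < 2 ^ w := by omega
  have p1 : 1 < 2 ^ w := by omega
  refine Run.fillW (Tb := (k + 1) * ((n + 1) * 38 + 40) + 49) (fun t v =>
      TrieStep k (rowOf n s) (Active i K) (t / 2 / (k + 1)) (t / 2 % (k + 1)) (t % 2) v)
    rfl rfl rfl (by rw [hs.w17]; omega) ?_ (by rw [hs.w17])
    (fun s' _ h _ => by rwa [hs.w17] at h)
  intro t s' ht hF hx _ _
  have ht' : t < n * (k + 1) * 2 := by rwa [hs.w17] at ht
  have hpos : t / 2 / (k + 1) < n := by
    rw [Nat.div_lt_iff_lt_mul (by omega), Nat.div_lt_iff_lt_mul (by omega)]; exact ht'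
  have he : t / 2 % (k + 1) < k + 1 := Nat.mod_lt _ (by omega)
  have e0 : s'.wvar 0 = n := (hF.w 0 rfl).trans hs.w0
  have e1 : s'.wvar 1 = k := (hF.w 1 rfl).trans hs.w1
  have e10 : s'.wvar 10 = k + 1 := (hF.w 10 rfl).trans hs.w10
  have e21 : s'.wvar 21 = i := (hF.w 21 rfl).trans hi
  have e22 : s'.wvar 22 = K := (hF.w 22 rfl).trans hK
  have a6 : s'.warr 6 = s.warr 6 := hF.wa 6 rfl
  generalize hposd : t / 2 / (k + 1) = pos at *
  generalize hed : t / 2 % (k + 1) = e at *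
  generalize hbd : t % 2 = b at *
  refine Run.seq (T₁ := 6) (T₂ := (k + 1) * ((n + 1) * 38 + 40) + 43)
    (R := fun s₁ => s₁ = s'.setW 28 pos)
    (Run.of_wp (by simp [hx, p2, e10, hposd]) (by decide)) ?_ (by omega)
  rintro s₁ rfl -
  refine Run.seq (T₁ := 6) (T₂ := (k + 1) * ((n + 1) * 38 + 40) + 37)
    (R := fun s₁ => s₁ = (s'.setW 28 pos).setW 29 e)
    (Run.of_wp (by simp [hx, p2, e10, hed]) (by decide)) ?_ (by omega)
  rintro s₁ rfl -
  refine Run.seq (T₁ := 4) (T₂ := (k + 1) * ((n + 1) * 38 + 40) + 33)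
    (R := fun s₁ => s₁ = ((s'.setW 28 pos).setW 29 e).setW 30 b)
    (Run.of_wp (by simp [hx, p2, hbd]) (by decide)) ?_ (by omega)
  rintro s₁ rfl -
  refine Run.seq (T₁ := 2) (T₂ := (k + 1) * ((n + 1) * 38 + 40) + 31)
    (R := fun s₁ => s₁ = (((s'.setW 28 pos).setW 29 e).setW 30 b).setW 7 k)
    (Run.of_wp (by simp [e1]) (by decide)) ?_ (by omega)
  rintro s₁ rfl -
  refine Run.ite (T := (k + 1) * ((n + 1) * 38 + 40) + 20) (by simp) ?_ ?_
    (by simp [BExpr.cost, WExpr.cost]; omega)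
  swap
  · intro hcon
    have : ¬ e < k := by simpa [e1] using hcon
    refine Run.of_wp ?_ (by simp [Cmd.cst])
    simp only [Cmd.wp, State.setW_wvar, reduceIte]
    exact ⟨le_rfl, fun _ => rfl, fun h => absurd h this⟩
  intro hlt'
  have hek : e < k := by simpa [e1] using hlt'
  -- The invariant says that either no active row below `l` extends the prefix of row `e` by the bit
  -- `b`, and variable 7 still has its default `k`, or variable 7 holds such a row.
  refine Run.forLoop (Tb := (n + 1) * 38 + 32) (fun l s₂ =>
      (s₂.wvar 7 = k ∧ ∀ j, Active i l j → (∀ p < pos, rowOf n s j p = rowOf n s e p) →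
        rowOf n s j pos ≠ b) ∨
      (s₂.wvar 7 < k ∧ Active i K (s₂.wvar 7) ∧
        (∀ p < pos, rowOf n s (s₂.wvar 7) p = rowOf n s e p) ∧ rowOf n s (s₂.wvar 7) pos = b))
    rfl rfl (by simp [e22]; omega) ?_ ?_
    (by simp only [State.setW_wvar, Nat.reduceEqDiff, reduceIte, e22]
        exact (Nat.mul_le_mul_right _ (show K + 1 ≤ k + 1 by omega)).trans
          (Nat.le_add_right _ _)) ?_
  · left
    exact ⟨by simp, fun j hj => absurd hj.1 (Nat.not_lt_zero _)⟩
  swap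
  · intro s₂ _ _ h
    simp only [State.setW_wvar, Nat.reduceEqDiff, reduceIte, e22] at h
    refine ⟨?_, fun h' => absurd h' hek.ne, fun _ _ => h⟩
    rcases h with h | h
    · exact h.1.le
    · exact h.1.le
  intro j s₂ hj hF₂ hx₂ hI
  have hj' : j < K := by simpa [e22] using hj
  have f0 : s₂.wvar 0 = n := (hF₂.w 0 rfl).trans (by simp [e0])
  have f21 : s₂.wvar 21 = i := (hF₂.w 21 rfl).trans (by simp [e21])
  have f28 : s₂.wvar 28 = pos := (hF₂.w 28 rfl).trans (by simp)
  have f29 : s₂.wvar 29 = e := (hF₂.w 29 rfl).trans (by simp)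
  have f30 : s₂.wvar 30 = b := (hF₂.w 30 rfl).trans (by simp)
  have g6 : s₂.warr 6 = s.warr 6 := (hF₂.wa 6 rfl).trans (by simp [a6])
  refine Run.ite (T := (n + 1) * 38 + 26) (by simp) (fun hji => ?_) (fun hji => ?_)
    (by simp [BExpr.cost, WExpr.cost]; omega)
  · simp only [BExpr.val, WExpr.nat, hx₂, f21] at hji
    refine Run.of_wp ?_ (by simp [Cmd.cst])
    simp only [Cmd.wp, State.setW_wvar, Nat.reduceEqDiff, reduceIte]
    rcases hI with ⟨h1, h2⟩ | h
    · refine .inl ⟨h1, fun l hl => h2 l ⟨?_, hl.2⟩⟩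
      have := hl.1; have := hl.2
      omega
    · exact .inr h
  simp only [BExpr.val, WExpr.nat, hx₂, f21] at hji
  refine Run.seq (T₁ := 2) (T₂ := (n + 1) * 38 + 24) (R := fun s₃ => s₃ = s₂.setW 31 1)
    (Run.of_wp (by simp [p1]) (by decide)) ?_ (by omega)
  rintro s₃ rfl -
  refine Run.seq (T₁ := (n + 1) * 38) (T₂ := 24) (R := fun s₃ => s₃.wvar 31 ≤ 1 ∧
    (s₃.wvar 31 = 1 ↔ ∀ p < pos, rowOf n s j p = rowOf n s e p)) ?_ ?_ (by omega)
  · refine Run.forLoop (Tb := 30) (fun r s₃ => s₃.wvar 31 ≤ 1 ∧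
      (s₃.wvar 31 = 1 ↔ ∀ p < r, rowOf n s j p = rowOf n s e p)) rfl rfl
      (by simp [f28]; omega) (by simp) ?_
      (by simp only [State.setW_wvar, Nat.reduceEqDiff, reduceIte, f28]
          exact Nat.mul_le_mul_right _ (by omega))
      (fun s₃ _ _ h => by simpa [f28] using h)
    rintro r s₃ hr hF₃ hx₃ ⟨hI1, hI2⟩
    have hr' : r < pos := by simpa [f28] using hr
    have k0 : s₃.wvar 0 = n := (hF₃.w 0 rfl).trans (by simp [f0])
    have k5 : s₃.wvar 5 = j := (hF₃.w 5 rfl).trans (by simp [hx₂])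
    have k29 : s₃.wvar 29 = e := (hF₃.w 29 rfl).trans (by simp [f29])
    have k6 : s₃.warr 6 = s.warr 6 := (hF₃.wa 6 rfl).trans (by simp [g6])
    have c1 := cell_lt hf (j := j) (p := r) (by omega) (by omega)
    have c2 := cell_lt hf (j := e) (p := r) (by omega) (by omega)
    refine Run.of_wp ?_ (by decide)
    simp only [Cmd.wp, WExpr.Ok, WExpr.nat, BExpr.Ok, BExpr.val,
      State.setW_wvar, Nat.reduceEqDiff, reduceIte, k0, k5, k29, hx₃, k6]
    refine ⟨⟨⟨⟨trivial, trivial, by omega⟩, trivial, by omega⟩,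
      ⟨trivial, trivial, by omega⟩, trivial, by omega⟩, fun h => ⟨hI1, hI2.trans ⟨fun hh p hp => ?_,
        fun hh p hp => hh p (by omega)⟩⟩, fun h => ⟨by omega, by omega, ?_⟩⟩
    · rcases Nat.lt_succ_iff_lt_or_eq.1 hp with h' | rfl
      · exact hh p h'
      · exact h
    · exact iff_of_false (by simp) fun hh => h (hh r (by omega))
  · rintro s₃ ⟨hI1, hI2⟩ hF₃
    have k0 : s₃.wvar 0 = n := (hF₃.w 0 rfl).trans (by simp [f0])
    have k5 : s₃.wvar 5 = j := (hF₃.w 5 rfl).trans (by simp [hx₂])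
    have k7 : s₃.wvar 7 = s₂.wvar 7 := (hF₃.w 7 rfl).trans (by simp)
    have k28 : s₃.wvar 28 = pos := (hF₃.w 28 rfl).trans (by simp [f28])
    have k30 : s₃.wvar 30 = b := (hF₃.w 30 rfl).trans (by simp [f30])
    have k6 : s₃.warr 6 = s.warr 6 := (hF₃.wa 6 rfl).trans (by simp [g6])
    have c1 := cell_lt hf (j := j) (p := pos) (by omega) (by omega)
    refine Run.of_wp ?_ (by decide)
    simp only [Cmd.wp, WExpr.Ok, WExpr.nat, BExpr.Ok, BExpr.val,
      State.setW_wvar, Nat.reduceEqDiff, reduceIte, k0, k5, k28, k30, k7, k6]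
    refine ⟨⟨⟨trivial, p1⟩, fun _ => ⟨⟨⟨trivial, trivial, by omega⟩, trivial, by omega⟩, trivial⟩⟩,
      fun h => ⟨trivial, .inr ⟨by omega, ⟨hj', hji⟩, hI2.1 h.1, h.2⟩⟩, fun h => ?_⟩
    rcases hI with ⟨h1, h2⟩ | hI
    · refine .inl ⟨h1, fun l hl hag => ?_⟩
      by_cases hlj : l = j
      · subst hlj
        exact fun hb => h ⟨hI2.2 hag, hb⟩
      · refine h2 l ⟨?_, hl.2⟩ hag
        have := hl.1
        omega
    · exact .inr hI

/-- Compute the initial state of the product automaton. -/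
def startP : Cmd :=
  .seq (.wset 24 (.var 1)) <|
  .seq
    (.ite (.weq (.var 23) (.const 0))
      (forLoop 5 22 <| .ite (.weq (.var 5) (.var 21)) .skip (.wset 24 (.var 5)))
      .skip)
    (.wset 24 (.mul (.var 24) (.var 9)))

/-- Every row agrees with the empty word, so any active row may be the start. In mode other than 0
the start is the absorbing state `k`, which switches exclusion off. -/
theorem run_startP {w n k i K mode : ℕ} {s : State} (hs : Sized w n k s) (hi : s.wvar 21 = i)
    (hK : s.wvar 22 = K) (hm : s.wvar 23 = mode) (hKk : K ≤ k) :
    Run w startP s ((k + 1) * 18 + 20)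
      (fun s' => ∃ e₀ ≤ k, s'.wvar 24 = e₀ * numRecords n ∧ (mode ≠ 0 → e₀ = k) ∧
        (mode = 0 → (e₀ = k ∧ ∀ l, ¬ Active i K l) ∨ (e₀ < k ∧ Active i K e₀))) := by
  have hf := hs.toFits
  have hk1 := hf.succ_k_lt
  have p0 : 0 < 2 ^ w := by omega
  refine Run.seq (T₁ := 2) (T₂ := (k + 1) * 18 + 18) (R := fun s₁ => s₁ = s.setW 24 k)
    (Run.of_wp (by simp [hs.w1]) (by decide)) ?_ (by omega)
  rintro s₁ rfl -
  refine Run.seq (T₁ := (k + 1) * 18 + 10) (T₂ := 8) (R := fun s₁ => s₁.wvar 24 ≤ k ∧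
    (mode ≠ 0 → s₁.wvar 24 = k) ∧ (mode = 0 → (s₁.wvar 24 = k ∧ ∀ l, ¬ Active i K l) ∨
      (s₁.wvar 24 < k ∧ Active i K (s₁.wvar 24)))) ?_ ?_ (by omega)
  · refine Run.ite (T := (k + 1) * 18) (by simp [p0]) ?_ ?_ (by simp [BExpr.cost, WExpr.cost]; omega)
    · intro h
      have h0 : mode = 0 := by simpa [hm] using h
      refine Run.forLoop (Tb := 10) (fun l s₂ => (s₂.wvar 24 = k ∧ ∀ j, ¬ Active i l j) ∨
        (s₂.wvar 24 < k ∧ Active i K (s₂.wvar 24))) rfl rfl (by simp [hK]; omega)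
        (.inl ⟨by simp, fun j hj => absurd hj.1 (Nat.not_lt_zero _)⟩) ?_
        (by simp only [State.setW_wvar, Nat.reduceEqDiff, reduceIte, hK]
            exact Nat.mul_le_mul_right _ (by omega)) ?_
      · intro j s₂ hj hF₂ hx₂ hI
        have hj' : j < K := by simpa [hK] using hj
        have f21 : s₂.wvar 21 = i := (hF₂.w 21 rfl).trans (by simp [hi])
        refine Run.of_wp ?_ (by decide)
        simp only [Cmd.wp, WExpr.Ok, WExpr.nat, BExpr.Ok, BExpr.val,
          State.setW_wvar, Nat.reduceEqDiff, reduceIte, hx₂, f21]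
        refine ⟨⟨trivial, trivial⟩, fun hji => ?_, fun hji => ⟨trivial, .inr ⟨by omega, hj', hji⟩⟩⟩
        rcases hI with ⟨h1, h2⟩ | hI
        · refine .inl ⟨h1, fun l hl => h2 l ⟨?_, hl.2⟩⟩
          have := hl.1; have := hl.2
          omega
        · exact .inr hI
      · intro s₂ _ _ h
        simp only [State.setW_wvar, Nat.reduceEqDiff, reduceIte, hK] at h
        refine ⟨?_, fun h' => absurd h0 h', fun _ => h⟩
        rcases h with h | h
        · exact h.1.le
        · exact h.1.le
    · intro h
      have h0 : mode ≠ 0 := by simpa [hm] using h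
      refine Run.of_wp ?_ (by simp [Cmd.cst]; omega)
      simp only [Cmd.wp, State.setW_wvar, reduceIte]
      exact ⟨le_rfl, fun _ => trivial, fun h' => absurd h' h0⟩
  · rintro s₁ ⟨h1, h2⟩ hF
    have e9 : s₁.wvar 9 = numRecords n := (hF.w 9 rfl).trans (by simp [hs.w9])
    have hlt : s₁.wvar 24 * numRecords n < 2 ^ w := by
      have b1 := hf.states_lt
      have b2 : s₁.wvar 24 * numRecords n ≤ numStates n k := Nat.mul_le_mul_right _ (by omega)
      omega
    refine Run.of_wp ?_ (by decide)
    simp only [Cmd.wp, WExpr.Ok, WExpr.nat, State.setW_wvar, reduceIte, e9]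
    exact ⟨⟨trivial, trivial, hlt⟩, _, h1, rfl, h2⟩

end DiverseOpt

namespace DiverseOpt

open RealRAM

set_option linter.unusedSimpArgs false

/-! ### The product automaton and the table of best weights -/

/-- The transitions of the product automaton, as stored. -/
def nextOf (n k : ℕ) (s : State) (pos z b : ℕ) : ℕ :=
  s.warr 9 ((pos * numStates n k + z) * 2 + b)

/-- The transitions of the exclusion automaton, as stored. -/
def excludeOf (k : ℕ) (s : State) (pos e b : ℕ) : ℕ := s.warr 8 ((pos * (k + 1) + e) * 2 + b)

/-- Tabulate the product automaton. -/
def productP : Cmd :=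
  forLoop 4 18 <| .seq
    (.seq (.wset 28 (.div (.div (.var 4) (.const 2)) (.var 11))) <|
     .seq (.wset 29 (.mod (.div (.var 4) (.const 2)) (.var 11))) <|
     .seq (.wset 30 (.div (.var 29) (.var 9))) <|
     .seq (.wset 31 (.mod (.var 29) (.var 9))) <|
     .seq (.wset 32 (.mul (.add (.mul (.var 28) (.var 10)) (.var 30)) (.const 2))) <|
     .ite (.weq (.mod (.var 4) (.const 2)) (.const 0))
      (.wset 7 (.add (.add (.mul (.get 8 (.var 32)) (.var 9)) (.var 31)) (.const 1)))
      (.seq (.wset 33 (.get 5 (.add (.mul (.var 28) (.var 9)) (.var 31)))) <|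
       .ite (.weq (.var 33) (.const 0)) (.wset 7 (.const 0))
        (.wset 7 (.add (.mul (.get 8 (.add (.var 32) (.const 1))) (.var 9)) (.var 33)))))
    (.wput 9 (.var 4) (.var 7))

theorem run_productP {w n k : ℕ} {s : State} {ch : ℕ → ℕ} {nr : ℕ → ℕ → ℕ} (hs : Sized w n k s)
    (hex : ∀ t < n * (k + 1) * 2, s.warr 8 t ≤ k)
    (htk : ∀ t < n * numRecords n, s.warr 5 t =
      addElemCode n ch nr (t / numRecords n) (t % numRecords n)) :
    Run w productP s ((n * numStates n k * 2 + 1) * 71)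
      (fun s' => (∀ t < n * numStates n k * 2, s'.warr 9 t ≤ numStates n k) ∧
        IsProduct n k ch nr (excludeOf k s) (nextOf n k s')) := by
  have hf := hs.toFits
  have hN := Fits.records_pos n
  have hZ := Fits.states_pos n k
  have hn1 := hf.one_le_n
  have l1 := hf.states_lt
  have l2 := hf.trie_lt
  have l3 := hf.mul_records_lt
  have l4 := hf.states_le
  have l5 := hf.succ_k_lt
  have hle : n * (k + 1) ≤ (n + 1) * (k + 1) := Nat.mul_le_mul_right _ (by omega)
  have hle2 : n * numRecords n ≤ (n + 1) * numRecords n := Nat.mul_le_mul_right _ (by omega)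
  have hle3 : n * numStates n k ≤ (n + 1) * numStates n k := Nat.mul_le_mul_right _ (by omega)
  have p2 : 2 < 2 ^ w := by
    have : numStates n k ≤ n * numStates n k := Nat.le_mul_of_pos_left _ hn1
    have := Nat.mul_le_mul hn1 hN
    have : 1 * numStates n k + numStates n k ≤ (n + 1) * numStates n k := by
      rw [← Nat.succ_mul]; exact Nat.mul_le_mul_right _ (by omega)
    omega
  have hP : ∀ v ≤ k, ∀ q, q + 1 ≤ numRecords n →
      v * numRecords n + q + 1 ≤ numStates n k := fun v hv q hq =>
    digit_lt (d := k + 1) (by omega) hq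
  have hdec : ∀ t pos e q b, q < numRecords n → e ≤ k → b ≤ 1 →
      t = (pos * numStates n k + (e * numRecords n + q)) * 2 + b →
      t / 2 / numStates n k = pos ∧ t / 2 % numStates n k / numRecords n = e ∧
      t / 2 % numStates n k % numRecords n = q ∧ t % 2 = b := by
    rintro t pos e q b hq he hb rfl
    have hz : e * numRecords n + q < numStates n k :=
      digit_lt (d := k + 1) (by omega) hq
    rw [digit_div (a := pos * numStates n k + _) (by omega),
      digit_mod (a := pos * numStates n k + _) (by omega), digit_div hz, digit_mod hz,
      digit_div hq, digit_mod hq]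
    exact ⟨rfl, rfl, rfl, rfl⟩
  -- The property is stated for every decomposition of the address `t`; the digits are unique by
  -- `hdec`, so the entry just computed has to serve only one.
  refine Run.fillW (Tb := 60) (fun t v =>
      v ≤ numStates n k ∧ ∀ pos e q b, q < numRecords n → e ≤ k → b ≤ 1 → pos < n →
        t = (pos * numStates n k + (e * numRecords n + q)) * 2 + b →
        (b = 0 → v = excludeOf k s pos e 0 * numRecords n + q + 1) ∧
        (b = 1 → v = if addElemCode n ch nr pos q = 0 then 0 else
          excludeOf k s pos e 1 * numRecords n + addElemCode n ch nr pos q))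
    rfl rfl rfl (by rw [hs.w18]; omega) ?_ (by rw [hs.w18]) ?_
  · intro t s' ht hF hx _ _
    have ht' : t < n * numStates n k * 2 := by rwa [hs.w18] at ht
    have hpos : t / 2 / numStates n k < n := by
      rw [Nat.div_lt_iff_lt_mul hZ, Nat.div_lt_iff_lt_mul (by omega)]; exact ht'
    have hz : t / 2 % numStates n k < numStates n k := Nat.mod_lt _ hZ
    have he : t / 2 % numStates n k / numRecords n < k + 1 := by
      rw [Nat.div_lt_iff_lt_mul hN]; exact hz
    have hq : t / 2 % numStates n k % numRecords n < numRecords n := Nat.mod_lt _ hN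
    have hb : t % 2 < 2 := Nat.mod_lt _ (by omega)
    have e9 : s'.wvar 9 = numRecords n := (hF.w 9 rfl).trans hs.w9
    have e10 : s'.wvar 10 = k + 1 := (hF.w 10 rfl).trans hs.w10
    have e11 : s'.wvar 11 = numStates n k := (hF.w 11 rfl).trans hs.w11
    have a5 : s'.warr 5 = s.warr 5 := hF.wa 5 rfl
    have a8 : s'.warr 8 = s.warr 8 := hF.wa 8 rfl
    generalize hposd : t / 2 / numStates n k = pos at *
    generalize hed : t / 2 % numStates n k / numRecords n = e at *
    generalize hqd : t / 2 % numStates n k % numRecords n = q at *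
    generalize hbd : t % 2 = b at *
    have d1 := digit_lt hpos he
    have d2 := digit_lt hpos hq
    have d3 := hex ((pos * (k + 1) + e) * 2) (by omega)
    have d4 := hex ((pos * (k + 1) + e) * 2 + 1) (by omega)
    have d5 := htk _ d2
    rw [digit_div hq, digit_mod hq] at d5
    have d6 := addElemCode_le (ch := ch) (nr := nr) hpos hq
    have d7 := hP _ d3 q hq
    have d8 : addElemCode n ch nr pos q ≠ 0 →
        s.warr 8 ((pos * (k + 1) + e) * 2 + 1) * numRecords n + addElemCode n ch nr pos q ≤
          numStates n k := fun h => by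
      have := hP _ d4 (addElemCode n ch nr pos q - 1) (by omega)
      omega
    refine Run.of_wp ?_ (by decide)
    simp only [Cmd.wp, WExpr.Ok, WExpr.nat, BExpr.Ok, BExpr.val, State.setW_warr,
      State.setW_wvar, Nat.reduceEqDiff, reduceIte, hx, e9, e10, e11, a5, a8, hposd, hed, hqd, hbd,
      d5]
    refine ⟨⟨⟨trivial, p2⟩, trivial⟩, ⟨⟨trivial, p2⟩, trivial⟩, ⟨trivial, trivial⟩,
      ⟨trivial, trivial⟩, ⟨⟨⟨trivial, trivial, by omega⟩, trivial, by omega⟩, p2, by omega⟩,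
      ⟨⟨trivial, p2⟩, by omega⟩, fun h0 => ⟨⟨⟨⟨trivial, trivial, by omega⟩, trivial, by omega⟩,
        by omega, by omega⟩, d7, ?_⟩, fun h0' => ⟨⟨⟨trivial, trivial, by omega⟩, trivial, by omega⟩,
        ⟨trivial, by omega⟩, fun h => ⟨by omega, by omega, ?_⟩,
        fun h => ⟨⟨⟨⟨trivial, by omega, by omega⟩, trivial, ?_⟩, trivial, ?_⟩, d8 h, ?_⟩⟩⟩
    · rintro pos' e' q' b' h1 h2 h3 h4 h5
      have hd := hdec t pos' e' q' b' h1 h2 h3 h5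
      rw [hposd, hed, hqd, hbd] at hd
      obtain ⟨rfl, rfl, rfl, rfl⟩ := hd
      exact ⟨fun _ => rfl, fun h => by omega⟩
    · rintro pos' e' q' b' h1 h2 h3 h4 h5
      have hd := hdec t pos' e' q' b' h1 h2 h3 h5
      rw [hposd, hed, hqd, hbd] at hd
      obtain ⟨rfl, rfl, rfl, rfl⟩ := hd
      exact ⟨fun h' => absurd h' h0', fun _ => by rw [if_pos h]⟩
    · have := d8 h; omega
    · have := d8 h; omega
    · rintro pos' e' q' b' h1 h2 h3 h4 h5
      have hd := hdec t pos' e' q' b' h1 h2 h3 h5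
      rw [hposd, hed, hqd, hbd] at hd
      obtain ⟨rfl, rfl, rfl, rfl⟩ := hd
      exact ⟨fun h' => absurd h' h0', fun _ => by rw [if_neg h]; rfl⟩
  · intro s' _ h _
    rw [hs.w18] at h
    refine ⟨fun t ht => (h t ht).1, fun pos hpos e he q hq => ?_⟩
    have hlt : pos * numStates n k + (e * numRecords n + q) < n * numStates n k :=
      digit_lt hpos (digit_lt (d := k + 1) (by omega) hq)
    exact ⟨((h _ (by omega)).2 pos e q 0 hq he (by omega) hpos rfl).1 rfl,
      ((h _ (by omega)).2 pos e q 1 hq he le_rfl hpos rfl).2 rfl⟩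

end DiverseOpt

namespace DiverseOpt

open RealRAM

set_option linter.unusedSimpArgs false

/-! ### The table of best weights -/

/-- `v` is the largest number satisfying the downward closed property `S`, and negative if no
nonnegative number does. -/
def IsBest (v : ℝ) (S : ℝ → Prop) : Prop := ∀ τ, (0 ≤ v ∧ τ ≤ v) ↔ S τ

theorem IsBest.none {v : ℝ} {S : ℝ → Prop} (hv : v < 0) (h : ∀ τ, ¬ S τ) : IsBest v S :=
  fun τ => iff_of_false (fun h' => by linarith [h'.1]) (h τ)

/-- With two alternatives, the second earning an extra `x`, the best value is the larger of `a` and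
v + x. Sign conventions survive because `x` is nonnegative. -/
theorem IsBest.or_of_lt {a v x : ℝ} {S T : ℝ → Prop} (ha : IsBest a S) (hv : IsBest v T)
    (hx : 0 ≤ x) (h0 : 0 ≤ v) (hlt : a < v + x) : IsBest (v + x) fun τ => S τ ∨ T (τ - x) := by
  intro τ
  change _ ↔ S τ ∨ T (τ - x)
  rw [← ha τ, ← hv (τ - x)]
  constructor
  · rintro ⟨_, h2⟩
    exact .inr ⟨h0, by linarith⟩
  · rintro (⟨h1, h2⟩ | ⟨h1, h2⟩)
    · exact ⟨by linarith, by linarith⟩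
    · exact ⟨by linarith, by linarith⟩

theorem IsBest.or_of_not_lt {a v x : ℝ} {S T : ℝ → Prop} (ha : IsBest a S) (hv : IsBest v T)
    (hx : 0 ≤ x) (h : ¬ (0 ≤ v ∧ a < v + x)) : IsBest a fun τ => S τ ∨ T (τ - x) := by
  intro τ
  change _ ↔ S τ ∨ T (τ - x)
  rw [← ha τ, ← hv (τ - x)]
  refine ⟨.inl, ?_⟩
  rintro (h' | ⟨h1, h2⟩)
  · exact h'
  · have h3 : v + x ≤ a := by
      by_contra h'
      exact h ⟨h1, by linarith⟩
    exact ⟨by linarith, by linarith⟩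

theorem IsBest.congr {v : ℝ} {S T : ℝ → Prop} (h : IsBest v S) (hST : ∀ τ, S τ ↔ T τ) :
    IsBest v T := fun τ => (h τ).trans (hST τ)

/-- Only the write set of a command matters for frames, so a dummy assignment to `x` stands in for
the update. -/
theorem Sized.setW {w n k x v : ℕ} {s : State} (h : Sized w n k s)
    (hx : keepsSizes (.wset x (.const 0)) = true) : Sized w n k (s.setW x v) :=
  h.frame (p := .wset x (.const 0)) ⟨fun y hy => by
    simp only [Cmd.writesW, beq_eq_false_iff_ne] at hy
    simp [hy], fun _ _ => rfl, fun _ _ => rfl, fun _ _ => rfl⟩ hx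

theorem Sized.setR {w n k x : ℕ} {v : ℝ} {s : State} (h : Sized w n k s) :
    Sized w n k (s.setR x v) :=
  h.frame (p := .rset x (.const 0)) ⟨fun _ _ => rfl, fun y hy => by
    simp only [Cmd.writesR, beq_eq_false_iff_ne] at hy
    simp [hy], fun _ _ => rfl, fun _ _ => rfl⟩ rfl

/-- Load the successor along bit `b`, and the gain. -/
def loadStepP (b : ℕ) : Cmd :=
  .seq (.wset 32 (.get 9 (.add (.mul (.add (.mul (.var 31) (.var 11)) (.var 29)) (.const 2))
    (.const b))))
    (.wset 33 (.get 7 (.add (.mul (.var 31) (.const 2)) (.const b))))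

/-- There is a successor, and the gain does not exceed the total. -/
def canStepE : BExpr := .and (.not (.weq (.var 32) (.const 0))) (.not (.wlt (.var 30) (.var 33)))

/-- The address of the table entry for the remaining bits. -/
def restE : WExpr :=
  .add (.mul (.add (.mul (.sub (.var 28) (.const 1)) (.var 11)) (.sub (.var 32) (.const 1)))
    (.var 12)) (.sub (.var 30) (.var 33))

/-- Tabulate the best weights. -/
def tableP : Cmd :=
  forLoop 4 19 <| .seq
    (.seq (.wset 28 (.div (.div (.var 4) (.var 12)) (.var 11))) <|
     .seq (.wset 29 (.mod (.div (.var 4) (.var 12)) (.var 11))) <|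
     .seq (.wset 30 (.mod (.var 4) (.var 12))) <|
     .seq (.rset 1 (.sub (.const 0) (.const 1))) <|
     .ite (.weq (.var 28) (.const 0))
      (.ite (.and (.weq (.var 30) (.const 0)) (.not (.wlt (.var 29) (.var 41))))
        (.rset 1 (.const 0)) .skip)
      (.seq (.wset 31 (.sub (.var 0) (.var 28))) <|
       .seq (loadStepP 0) <|
       .seq (.ite canStepE (.rset 1 (.get 6 restE)) .skip) <|
       .seq (loadStepP 1) <|
       .ite canStepE
        (.seq (.rset 4 (.get 6 restE)) <|
         .ite (.and (.rle (.const 0) (.var 4)) (.rlt (.var 1) (.add (.var 4) (.get 5 (.var 31)))))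
          (.rset 1 (.add (.var 4) (.get 5 (.var 31)))) .skip)
        .skip))
    (.rput 6 (.var 4) (.var 1))

/-- The gains, as stored. -/
def gainAt (s : State) (pos b : ℕ) : ℕ := s.warr 7 (pos * 2 + b)

/-- The sets that can be completed, according to the stored automaton. -/
def Completes (n k : ℕ) (s : State) (m z d : ℕ) (τ : ℝ) : Prop :=
  Sol (nextOf n k s) (gainAt s) (s.rarr 5) (k * numRecords n ≤ ·) n m z d τ

@[simp] theorem nextOf_setW (n k : ℕ) (s : State) (x v : ℕ) :
    nextOf n k (s.setW x v) = nextOf n k s := rfl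

@[simp] theorem gainAt_setW (s : State) (x v : ℕ) : gainAt (s.setW x v) = gainAt s := rfl

theorem nextOf_congr {n k : ℕ} {s s' : State} (h : s'.warr 9 = s.warr 9) :
    nextOf n k s' = nextOf n k s := by
  funext a b c; simp only [nextOf, h]

theorem gainAt_congr {s s' : State} (h : s'.warr 7 = s.warr 7) : gainAt s' = gainAt s := by
  funext a b; simp only [gainAt, h]

theorem run_loadStepP {w n k b pos z : ℕ} {s : State} (hs : Sized w n k s) (hpos : pos < n)
    (hz : z < numStates n k) (hb : b ≤ 1) (h29 : s.wvar 29 = z) (h31 : s.wvar 31 = pos) :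
    Run w (loadStepP b) s 18
      (fun s' => s' = (s.setW 32 (nextOf n k s pos z b)).setW 33 (gainAt s pos b)) := by
  have l1 := hs.toFits.states_le
  have l2 := hs.toFits.two_le_gains
  have l3 := hs.one_le_n
  have l4 := Fits.states_pos n k
  have c1 := digit_lt hpos hz
  have c2 : n * numStates n k ≤ (n + 1) * numStates n k := Nat.mul_le_mul_right _ (by omega)
  have c3 : n ≤ n * numStates n k := Nat.le_mul_of_pos_right _ l4
  have c5 := hs.toFits.states_lt
  have c6 : n * numStates n k + numStates n k = (n + 1) * numStates n k := by ring
  refine Run.of_wp ?_ (by simp [loadStepP, Cmd.cst, WExpr.cost])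
  simp only [loadStepP, Cmd.wp, WExpr.Ok, WExpr.nat, State.setW_warr, State.setW_wvar,
    Nat.reduceEqDiff, reduceIte, h29, h31, hs.w11]
  exact ⟨⟨⟨⟨⟨trivial, trivial, by omega⟩, trivial, by omega⟩, by omega, by omega⟩, by omega,
    by omega⟩, ⟨⟨trivial, by omega, by omega⟩, by omega, by omega⟩, rfl⟩

theorem ok_canStepE {w : ℕ} {s : State} : canStepE.Ok w s := by
  simp [canStepE]

theorem val_canStepE {s : State} : canStepE.val s ↔ s.wvar 32 ≠ 0 ∧ s.wvar 33 ≤ s.wvar 30 := by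
  simp [canStepE]

/-- The entry needed has one bit fewer to go, so it precedes `t` in the order in which the table is
filled. The last three equations decode its address. -/
theorem restE_spec {w n k m d t z' g : ℕ} {s : State} (hs : Sized w n k s)
    (ht : t < (n + 1) * numStates n k * numGains n k)
    (hm : m + 1 = t / numGains n k / numStates n k) (hd : d < numGains n k)
    (h28 : s.wvar 28 = m + 1)
    (h30 : s.wvar 30 = d) (h32 : s.wvar 32 = z' + 1) (h33 : s.wvar 33 = g)
    (hz : z' < numStates n k) :
    restE.Ok w s ∧ restE.nat s = (m * numStates n k + z') * numGains n k + (d - g) ∧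
      (m * numStates n k + z') * numGains n k + (d - g) < t ∧
      ((m * numStates n k + z') * numGains n k + (d - g)) / numGains n k / numStates n k = m ∧
      ((m * numStates n k + z') * numGains n k + (d - g)) / numGains n k % numStates n k = z' ∧
      ((m * numStates n k + z') * numGains n k + (d - g)) % numGains n k = d - g := by
  have hD : 0 < numGains n k := by have := hs.toFits.two_le_gains; omega
  have l1 := hs.toFits.table
  have l2 := hs.toFits.succ_lt
  have h1 : m * numStates n k + z' < (m + 1) * numStates n k := digit_lt (by omega) hz
  have h2 : (m + 1) * numStates n k ≤ t / numGains n k := by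
    rw [hm]; exact Nat.div_mul_le_self _ _
  have h3 : (m * numStates n k + z') * numGains n k + (d - g) <
      t / numGains n k * numGains n k := digit_lt (by omega) (by omega)
  have h4 := Nat.div_mul_le_self t (numGains n k)
  have h5 : m * numStates n k + z' ≤ (m * numStates n k + z') * numGains n k :=
    Nat.le_mul_of_pos_right _ hD
  refine ⟨?_, ?_, by omega, ?_, ?_, ?_⟩
  · simp only [restE, WExpr.Ok, WExpr.nat, h28, h30, h32, h33, hs.w11, hs.w12,
      Nat.add_sub_cancel]
    exact ⟨⟨⟨⟨⟨trivial, by omega⟩, trivial, by omega⟩, ⟨trivial, by omega⟩, by omega⟩, trivial,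
      by omega⟩, ⟨trivial, trivial⟩, by omega⟩
  · simp only [restE, WExpr.nat, h28, h30, h32, h33, hs.w11, hs.w12, Nat.add_sub_cancel]
  · rw [digit_div (by omega), digit_div hz]
  · rw [digit_div (by omega), digit_mod hz]
  · rw [digit_mod (by omega)]

theorem Completes.succ {n k : ℕ} {s : State} {m z d : ℕ} {τ : ℝ} :
    Completes n k s (m + 1) z d τ ↔
      (∃ z', nextOf n k s (n - (m + 1)) z 0 = z' + 1 ∧ gainAt s (n - (m + 1)) 0 ≤ d ∧
        Completes n k s m z' (d - gainAt s (n - (m + 1)) 0) τ) ∨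
      (∃ z', nextOf n k s (n - (m + 1)) z 1 = z' + 1 ∧ gainAt s (n - (m + 1)) 1 ≤ d ∧
        Completes n k s m z' (d - gainAt s (n - (m + 1)) 1) (τ - s.rarr 5 (n - (m + 1)))) :=
  Iff.rfl

theorem run_tableP {w n k : ℕ} {s : State} (hs : Sized w n k s)
    (hnx : ∀ t < n * numStates n k * 2, s.warr 9 t ≤ numStates n k)
    (hwt : ∀ p < n, 0 ≤ s.rarr 5 p) :
    Run w tableP s (((n + 1) * numStates n k * numGains n k + 1) * 150)
      (fun s' => ∀ t < (n + 1) * numStates n k * numGains n k,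
        IsBest (s'.rarr 6 t) (Completes n k s (t / numGains n k / numStates n k)
          (t / numGains n k % numStates n k) (t % numGains n k))) := by
  have hf := hs.toFits
  have hZ := Fits.states_pos n k
  have hD : 0 < numGains n k := by have := hf.two_le_gains; omega
  have l1 := hf.table
  have l2 := hf.succ_lt
  refine Run.fillR (Tb := 139) (fun t v =>
    IsBest v (Completes n k s (t / numGains n k / numStates n k)
          (t / numGains n k % numStates n k) (t % numGains n k))) rfl rfl rfl
    (by rw [hs.w19]; exact l1) ?_ (by rw [hs.w19]) (fun s' _ h => by rwa [hs.w19] at h)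
  intro t s' ht hF hx hB
  have ht' : t < (n + 1) * numStates n k * numGains n k := by rwa [hs.w19] at ht
  have hm : t / numGains n k / numStates n k < n + 1 := by
    rw [Nat.div_lt_iff_lt_mul hZ, Nat.div_lt_iff_lt_mul hD]; exact ht'
  have hz : t / numGains n k % numStates n k < numStates n k := Nat.mod_lt _ hZ
  have hd : t % numGains n k < numGains n k := Nat.mod_lt _ hD
  have hs' : Sized w n k s' := hs.frame hF rfl
  have n' : nextOf n k s' = nextOf n k s := nextOf_congr (hF.wa 9 rfl)
  have g' : gainAt s' = gainAt s := gainAt_congr (hF.wa 7 rfl)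
  have r5 : s'.rarr 5 = s.rarr 5 := hF.ra 5 rfl
  have p0 : 0 < 2 ^ w := by omega
  generalize hmd : t / numGains n k / numStates n k = m at *
  generalize hzd : t / numGains n k % numStates n k = z at *
  generalize hdd : t % numGains n k = d at *
  refine Run.seq (T₁ := 6) (T₂ := 133) (R := fun s₁ => s₁ = s'.setW 28 m)
    (Run.of_wp (by simp [hx, hs'.w11, hs'.w12, hmd]) (by decide)) ?_ (by omega)
  rintro s₁ rfl -
  refine Run.seq (T₁ := 6) (T₂ := 127) (R := fun s₁ => s₁ = (s'.setW 28 m).setW 29 z)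
    (Run.of_wp (by simp [hx, hs'.w11, hs'.w12, hzd]) (by decide)) ?_ (by omega)
  rintro s₁ rfl -
  refine Run.seq (T₁ := 4) (T₂ := 123)
    (R := fun s₁ => s₁ = ((s'.setW 28 m).setW 29 z).setW 30 d)
    (Run.of_wp (by simp [hx, hs'.w12, hdd]) (by decide)) ?_ (by omega)
  rintro s₁ rfl -
  -- The default -1 means that there is no completion; it cannot be mistaken for a weight, since
  -- weights are nonnegative.
  refine Run.seq (T₁ := 4) (T₂ := 119)
    (R := fun s₁ => s₁ = (((s'.setW 28 m).setW 29 z).setW 30 d).setR 1 (-1))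
    (Run.of_wp (by simp) (by decide)) ?_ (by omega)
  rintro s₁ rfl -
  have hs₁ : Sized w n k ((((s'.setW 28 m).setW 29 z).setW 30 d).setR 1 (-1)) :=
    (((hs'.setW rfl).setW rfl).setW rfl).setR
  have h28 : ((((s'.setW 28 m).setW 29 z).setW 30 d).setR 1 (-1)).wvar 28 = m := by simp
  have h29 : ((((s'.setW 28 m).setW 29 z).setW 30 d).setR 1 (-1)).wvar 29 = z := by simp
  have h30 : ((((s'.setW 28 m).setW 29 z).setW 30 d).setR 1 (-1)).wvar 30 = d := by simp
  have hv : ((((s'.setW 28 m).setW 29 z).setW 30 d).setR 1 (-1)).rvar 1 < 0 := by simp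
  have hr : ((((s'.setW 28 m).setW 29 z).setW 30 d).setR 1 (-1)).rarr = s'.rarr := rfl
  have hw : ((((s'.setW 28 m).setW 29 z).setW 30 d).setR 1 (-1)).warr = s'.warr := rfl
  generalize (((s'.setW 28 m).setW 29 z).setW 30 d).setR 1 (-1) = s₁ at *
  refine Run.ite (T := 114) (by simp [p0]) (fun h0 => ?_) (fun h0 => ?_)
    (by simp [BExpr.cost, WExpr.cost])
  · simp only [BExpr.val, WExpr.nat, h28] at h0
    subst h0
    refine Run.of_wp ?_ (by decide)
    simp only [Cmd.wp, WExpr.Ok, WExpr.nat, BExpr.Ok, BExpr.val, RExpr.Ok, RExpr.val, h29, h30,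
      hs₁.w41, State.setR_rvar, reduceIte]
    refine ⟨⟨⟨trivial, p0⟩, fun _ => ⟨trivial, trivial⟩⟩, ?_, fun h => .none hv fun τ hτ => h ?_⟩
    · rintro ⟨rfl, h⟩
      refine ⟨trivial, fun τ => ?_⟩
      simp only [Nat.cast_zero, le_refl, true_and]
      exact ⟨fun h' => ⟨not_lt.1 h, rfl, h'⟩, fun h' => h'.2.2⟩
    · exact ⟨hτ.2.1, not_lt.2 hτ.1⟩
  simp only [BExpr.val, WExpr.nat, h28] at h0
  obtain ⟨m, rfl⟩ := Nat.exists_eq_succ_of_ne_zero h0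
  rw [Nat.succ_eq_add_one] at *
  have hpos : n - (m + 1) < n := by have := hs.one_le_n; omega
  refine Run.seq (T₁ := 4) (T₂ := 110) (R := fun s₂ => s₂ = s₁.setW 31 (n - (m + 1)))
    (Run.of_wp (by simp [hs₁.w0, h28]) (by decide)) ?_ (by omega)
  rintro s₂ rfl -
  have n₁ : nextOf n k s₁ = nextOf n k s := (nextOf_congr (by rw [hw])).trans n'
  have g₁ : gainAt s₁ = gainAt s := (gainAt_congr (by rw [hw])).trans g'
  have hnx' : ∀ b ≤ 1, nextOf n k s (n - (m + 1)) z b ≤ numStates n k := fun b hb =>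
    hnx _ (by have := digit_lt hpos hz; omega)
  generalize hp : n - (m + 1) = pos at *
  -- This serves both bits: if there is a successor and its gain fits, the entry read describes
  -- exactly the completions through that successor; otherwise there are none.
  have look : ∀ b ≤ 1, ∀ s₂ : State, Sized w n k s₂ → s₂.wvar 28 = m + 1 → s₂.wvar 30 = d →
      s₂.wvar 32 = nextOf n k s pos z b → s₂.wvar 33 = gainAt s pos b → s₂.rarr 6 = s'.rarr 6 →
      (canStepE.val s₂ → restE.Ok w s₂ ∧ IsBest (s₂.rarr 6 (restE.nat s₂)) fun τ =>
        ∃ z', nextOf n k s pos z b = z' + 1 ∧ gainAt s pos b ≤ d ∧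
          Completes n k s m z' (d - gainAt s pos b) τ) ∧
      (¬ canStepE.val s₂ → ∀ τ, ¬ ∃ z', nextOf n k s pos z b = z' + 1 ∧ gainAt s pos b ≤ d ∧
          Completes n k s m z' (d - gainAt s pos b) τ) := by
    intro b hb s₂ hs₂ i28 i30 i32 i33 i6
    rw [val_canStepE, i30, i32, i33]
    refine ⟨fun ⟨c1, c2⟩ => ?_, fun h τ ⟨z', c1, c2, _⟩ => h ⟨by omega, c2⟩⟩
    obtain ⟨z', hz'⟩ := Nat.exists_eq_succ_of_ne_zero c1
    have hz'' : z' < numStates n k := by have := hnx' b hb; omega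
    obtain ⟨q1, q2, q3, q4, q5, q6⟩ := restE_spec (z' := z') (g := gainAt s pos b) hs₂ ht' hmd.symm hd
      i28 i30 (i32.trans hz') i33 hz''
    refine ⟨q1, ?_⟩
    have := hB _ q3
    rw [q4, q5, q6] at this
    rw [q2, i6]
    refine this.congr fun τ => ⟨fun h => ⟨z', hz', c2, h⟩, ?_⟩
    rintro ⟨z₁, e, _, h⟩
    obtain rfl : z₁ = z' := by omega
    exact h
  refine Run.seq (T₁ := 18) (T₂ := 92) (run_loadStepP (b := 0) (hs₁.setW rfl) hpos hz (by omega)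
    (by simp [h29]) (by simp)) ?_ (by omega)
  rintro s₂ rfl -
  have hs₂ : Sized w n k (((s₁.setW 31 pos).setW 32 (nextOf n k (s₁.setW 31 pos) pos z 0)).setW 33
    (gainAt (s₁.setW 31 pos) pos 0)) := ((hs₁.setW rfl).setW rfl).setW rfl
  refine Run.seq (T₁ := 30) (T₂ := 62) (R := fun s₂ => IsBest (s₂.rvar 1) fun τ =>
        ∃ z', nextOf n k s pos z 0 = z' + 1 ∧ gainAt s pos 0 ≤ d ∧
          Completes n k s m z' (d - gainAt s pos 0) τ) ?_ ?_ (by omega)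
  · obtain ⟨c1, c2⟩ := look 0 (by omega) _ hs₂ (by simp [h28]) (by simp [h30])
      (by simp [n₁]) (by simp [g₁]) (by simp [hr])
    refine Run.of_wp ⟨ok_canStepE, fun h => ⟨(c1 h).1, ?_⟩, fun h => ?_⟩ (by decide)
    · simpa using (c1 h).2
    · exact .none (by simpa using hv) (c2 h)
  intro s₃ hb₀ hF₃
  have hs₃ := hs₂.frame hF₃ rfl
  refine Run.seq (T₁ := 18) (T₂ := 44) (run_loadStepP (b := 1) hs₃ hpos hz le_rfl
    ((hF₃.w 29 rfl).trans (by simp [h29])) ((hF₃.w 31 rfl).trans (by simp))) ?_ (by omega)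
  rintro s₄ rfl -
  have n₃ : nextOf n k s₃ = nextOf n k s := (nextOf_congr (hF₃.wa 9 rfl)).trans (by simp [n₁])
  have g₃ : gainAt s₃ = gainAt s := (gainAt_congr (hF₃.wa 7 rfl)).trans (by simp [g₁])
  have hs₄ : Sized w n k ((s₃.setW 32 (nextOf n k s₃ pos z 1)).setW 33 (gainAt s₃ pos 1)) :=
    (hs₃.setW rfl).setW rfl
  obtain ⟨c1, c2⟩ := look 1 le_rfl _ hs₄ (by simp [hF₃.w 28 rfl, h28])
    (by simp [hF₃.w 30 rfl, h30]) (by simp [n₃]) (by simp [g₃]) (by simp [hF₃.ra 6 rfl, hr])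
  have j31 : s₃.wvar 31 = pos := (hF₃.w 31 rfl).trans (by simp)
  have j5 : s₃.rarr 5 = s.rarr 5 := (hF₃.ra 5 rfl).trans (by simp [hr, r5])
  refine Run.of_wp ⟨ok_canStepE, fun h => ⟨(c1 h).1, ⟨⟨trivial, trivial⟩,
    fun _ => ⟨trivial, trivial, trivial⟩⟩, fun h' => ⟨⟨trivial, trivial⟩, ?_⟩, fun h' => ?_⟩, fun h => ?_⟩ (by decide)
  · have c3 := (c1 h).2
    simp only [BExpr.val, RExpr.val, WExpr.nat, State.setR_rvar, State.setR_wvar, State.setR_rarr,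
      State.setW_rvar, State.setW_wvar, State.setW_rarr, Nat.reduceEqDiff, reduceIte, j31, j5,
      Nat.cast_zero] at h' c3 ⊢
    exact (hb₀.or_of_lt c3 (hwt pos hpos) h'.1 h'.2).congr fun τ => by
      rw [Completes.succ, hp]
  · have c3 := (c1 h).2
    simp only [BExpr.val, RExpr.val, WExpr.nat, State.setR_rvar, State.setR_wvar, State.setR_rarr,
      State.setW_rvar, State.setW_wvar, State.setW_rarr, Nat.reduceEqDiff, reduceIte, j31, j5,
      Nat.cast_zero] at h' c3 ⊢
    exact (hb₀.or_of_not_lt c3 (hwt pos hpos) h').congr fun τ => by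
      rw [Completes.succ, hp]
  · refine IsBest.congr (S := _) (by simpa using hb₀) fun τ => ?_
    rw [Completes.succ, hp]
    exact ⟨.inl, fun h' => h'.resolve_right (c2 h _)⟩

end DiverseOpt

namespace DiverseOpt

open RealRAM

set_option linter.unusedSimpArgs false

/-! ### Selecting the best gain and reading off a set -/

/-- The table of best weights is correct. -/
def TableCorrect (n k : ℕ) (s : State) : Prop :=
  ∀ t < (n + 1) * numStates n k * numGains n k,
    IsBest (s.rarr 6 t) (Completes n k s (t / numGains n k / numStates n k)
      (t / numGains n k % numStates n k) (t % numGains n k))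

theorem Completes.congr {n k : ℕ} {s s' : State} (h7 : s'.warr 7 = s.warr 7)
    (h9 : s'.warr 9 = s.warr 9) (h5 : s'.rarr 5 = s.rarr 5) : Completes n k s' = Completes n k s := by
  funext m z d τ
  simp only [Completes, nextOf_congr h9, gainAt_congr h7, h5]

theorem TableCorrect.entry {n k : ℕ} {s : State} (h : TableCorrect n k s) {m z d : ℕ} (hm : m ≤ n)
    (hz : z < numStates n k) (hd : d < numGains n k) :
    IsBest (s.rarr 6 ((m * numStates n k + z) * numGains n k + d)) (Completes n k s m z d) := by
  have := h _ (digit_lt (digit_lt (Nat.lt_succ_of_le hm) hz) hd)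
  rwa [digit_div hd, digit_mod hd, digit_div hz, digit_mod hz] at this

/-- Find the largest gain of an accepted set of weight at least the real variable `2`. -/
def selectP : Cmd :=
  .seq (.wset 25 (.const 0)) <|
  .seq (.wset 28 (.mul (.add (.mul (.var 0) (.var 11)) (.var 24)) (.var 12))) <|
  forLoop 4 12 <|
    .ite (.and (.rle (.const 0) (.get 6 (.add (.var 28) (.var 4))))
        (.rle (.var 2) (.get 6 (.add (.var 28) (.var 4)))))
      (.seq (.wset 25 (.const 1)) (.wset 26 (.var 4))) .skip

/-- The gains are scanned in increasing order, so the last hit is the largest. By `IsBest`,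
comparing one table entry with the threshold decides whether a set of that exact gain exists. -/
theorem run_selectP {w n k z₀ : ℕ} {s : State} (hs : Sized w n k s) (ht : TableCorrect n k s)
    (h24 : s.wvar 24 = z₀) (hz : z₀ < numStates n k) :
    Run w selectP s ((numGains n k + 1) * 30 + 20) (fun s' =>
      (s'.wvar 25 = 0 ∧ ∀ d < numGains n k, ¬ Completes n k s n z₀ d (s.rvar 2)) ∨
      (s'.wvar 25 = 1 ∧ s'.wvar 26 < numGains n k ∧ Completes n k s n z₀ (s'.wvar 26) (s.rvar 2) ∧
        ∀ d < numGains n k, Completes n k s n z₀ d (s.rvar 2) → d ≤ s'.wvar 26)) := by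
  have hf := hs.toFits
  have hD : 0 < numGains n k := by have := hf.two_le_gains; omega
  have l1 := hf.table
  have l2 := hf.succ_lt
  have l3 := hf.states_le
  have c1 := digit_lt (a := n) (d := n + 1) (by omega) hz
  have c2 : ∀ d < numGains n k, (n * numStates n k + z₀) * numGains n k + d < 2 ^ w := fun d hd =>
    (digit_lt c1 hd).trans l1
  have c3 := c2 0 hD
  refine Run.seq (T₁ := 2) (T₂ := (numGains n k + 1) * 30 + 18) (R := fun s' => s' = s.setW 25 0)
    (Run.of_wp (by simp) (by decide)) ?_ (by omega)
  rintro s₁ rfl -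
  refine Run.seq (T₁ := 8) (T₂ := (numGains n k + 1) * 30 + 10) (R := fun s' => s' =
    (s.setW 25 0).setW 28 ((n * numStates n k + z₀) * numGains n k)) (Run.of_wp ?_ (by decide)) ?_
    (by omega)
  · simp only [Cmd.wp, WExpr.Ok, WExpr.nat, State.setW_wvar, Nat.reduceEqDiff, reduceIte, hs.w0,
      hs.w11, hs.w12, h24]
    simp [hs.w0]
    omega
  rintro s₁ rfl -
  refine Run.forLoop (Tb := 22) (fun i s' =>
      (s'.wvar 25 = 0 ∧ ∀ d < i, ¬ Completes n k s n z₀ d (s.rvar 2)) ∨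
      (s'.wvar 25 = 1 ∧ s'.wvar 26 < numGains n k ∧ Completes n k s n z₀ (s'.wvar 26) (s.rvar 2) ∧
        ∀ d < i, Completes n k s n z₀ d (s.rvar 2) → d ≤ s'.wvar 26)) rfl rfl
    (by simp [hs.w12, hf.gains_le]) (.inl (by simp)) ?_ (by simp [hs.w12])
    (fun s' _ _ h => by simpa [hs.w12] using h)
  intro d s' hd hF hx hI
  have hd' : d < numGains n k := by simpa [hs.w12] using hd
  have e28 : s'.wvar 28 = (n * numStates n k + z₀) * numGains n k :=
    (hF.w 28 rfl).trans (by simp)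
  have e6 : s'.rarr 6 = s.rarr 6 := hF.ra 6 rfl
  have er : s'.rvar 2 = s.rvar 2 := hF.r 2 rfl
  have hb := ht.entry le_rfl hz hd' (s.rvar 2)
  refine Run.of_wp ?_ (by decide)
  simp only [Cmd.wp, WExpr.Ok, WExpr.nat, BExpr.Ok, BExpr.val, RExpr.Ok, RExpr.val,
    State.setW_wvar, Nat.reduceEqDiff, reduceIte, hx, e28, e6, er, Nat.cast_zero]
  refine ⟨⟨⟨trivial, trivial, trivial, c2 d hd'⟩, fun _ => ⟨trivial, trivial, trivial, c2 d hd'⟩⟩,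
    fun h => ⟨by omega, trivial, .inr ⟨trivial, hd', hb.1 h, fun d' h' _ => by omega⟩⟩, fun h => ?_⟩
  have hn := fun h' => h (hb.2 h')
  rcases hI with ⟨h1, h2⟩ | ⟨h1, h2, h3, h4⟩
  · refine .inl ⟨h1, fun d' hd' => ?_⟩
    rcases Nat.lt_succ_iff_lt_or_eq.1 hd' with h | rfl
    · exact h2 _ h
    · exact hn
  · refine .inr ⟨h1, h2, h3, fun d' hd' hc => ?_⟩
    rcases Nat.lt_succ_iff_lt_or_eq.1 hd' with h | rfl
    · exact h4 _ h hc
    · exact absurd hc hn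

theorem TableCorrect.restE {w n k m d z' g : ℕ} {s s₂ : State} (ht : TableCorrect n k s)
    (hs : Sized w n k s₂) (hm : m + 1 ≤ n) (hd : d < numGains n k) (h28 : s₂.wvar 28 = m + 1)
    (h30 : s₂.wvar 30 = d) (h32 : s₂.wvar 32 = z' + 1) (h33 : s₂.wvar 33 = g)
    (hz : z' < numStates n k) (h6 : s₂.rarr 6 = s.rarr 6) :
    restE.Ok w s₂ ∧ IsBest (s₂.rarr 6 (restE.nat s₂)) (Completes n k s m z' (d - g)) := by
  have hD : 0 < numGains n k := by have := hs.toFits.two_le_gains; omega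
  have hZ := Fits.states_pos n k
  obtain ⟨q1, q2, -⟩ := restE_spec (t := ((m + 1) * numStates n k + 0) * numGains n k + 0) hs
    (digit_lt (digit_lt (by omega) hZ) hD) (by rw [digit_div hD, digit_div hZ]) hd h28 h30 h32 h33
    hz
  exact ⟨q1, by rw [q2, h6]; exact ht.entry (by omega) hz (by omega)⟩

/-- Read off an accepted set of the selected gain. -/
def walkP : Cmd :=
  .seq (.rset 3 (.var 2)) <|
  .seq (.wset 29 (.var 24)) <|
  .seq (.wset 30 (.var 26)) <|
  forLoop 4 0 <|
    .seq (.wset 31 (.var 4)) <|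
    .seq (.wset 28 (.sub (.var 0) (.var 4))) <|
    .seq (loadStepP 0) <|
    .seq
      (.ite (.and canStepE (.and (.rle (.const 0) (.get 6 restE)) (.rle (.var 3) (.get 6 restE))))
        (.wput 10 (.var 4) (.const 0))
        (.seq (loadStepP 1) <|
         .seq (.wput 10 (.var 4) (.const 1)) <|
         .rset 3 (.sub (.var 3) (.get 5 (.var 31))))) <|
    .seq (.wset 29 (.sub (.var 32) (.const 1)))
      (.wset 30 (.sub (.var 30) (.var 33)))

theorem run_walkP {w n k z₀ d₀ : ℕ} {s : State} (hs : Sized w n k s) (ht : TableCorrect n k s)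
    (hnx : ∀ t < n * numStates n k * 2, s.warr 9 t ≤ numStates n k)
    (h24 : s.wvar 24 = z₀) (hz : z₀ < numStates n k) (h26 : s.wvar 26 = d₀)
    (hd : d₀ < numGains n k) (hc : Completes n k s n z₀ d₀ (s.rvar 2)) :
    Run w walkP s ((n + 1) * 150) (fun s' =>
      (∀ p < n, s'.warr 10 p ≤ 1) ∧
      (∃ z, Path (nextOf n k s) (s'.warr 10) z₀ n z ∧ k * numRecords n ≤ z) ∧
      (∑ p ∈ Finset.range n, gainAt s p (s'.warr 10 p)) = d₀ ∧
      s.rvar 2 ≤ ∑ p ∈ Finset.range n, if s'.warr 10 p = 1 then s.rarr 5 p else 0) := by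
  have hf := hs.toFits
  have hn1 := hf.one_le_n
  have hD : 0 < numGains n k := by have := hf.two_le_gains; omega
  have hZ := Fits.states_pos n k
  have l1 := hf.table
  have l2 := hf.succ_lt
  refine Run.seq (T₁ := 2) (T₂ := (n + 1) * 130 + 4) (R := fun s' => s' = s.setR 3 (s.rvar 2))
    (Run.of_wp (by simp) (by decide)) ?_ (by omega)
  rintro s₁ rfl -
  refine Run.seq (T₁ := 2) (T₂ := (n + 1) * 130 + 2)
    (R := fun s' => s' = (s.setR 3 (s.rvar 2)).setW 29 z₀)
    (Run.of_wp (by simp [h24]) (by decide)) ?_ (by omega)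
  rintro s₁ rfl -
  refine Run.seq (T₁ := 2) (T₂ := (n + 1) * 130)
    (R := fun s' => s' = ((s.setR 3 (s.rvar 2)).setW 29 z₀).setW 30 d₀)
    (Run.of_wp (by simp [h26]) (by decide)) ?_ (by omega)
  rintro s₁ rfl -
  -- Invariant of the walk: the remaining gain and the remaining weight requirement (real variable
  -- 3) can still be met from the current state. What has been collected accounts for the rest.
  refine Run.forLoop (Tb := 122) (fun i s' =>
      s'.wvar 29 < numStates n k ∧ s'.wvar 30 < numGains n k ∧
      (∀ p < i, s'.warr 10 p ≤ 1) ∧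
      Path (nextOf n k s) (s'.warr 10) z₀ i (s'.wvar 29) ∧
      (∑ p ∈ Finset.range i, gainAt s p (s'.warr 10 p)) + s'.wvar 30 = d₀ ∧
      (s.rvar 2 ≤ s'.rvar 3 + ∑ p ∈ Finset.range i, if s'.warr 10 p = 1 then s.rarr 5 p else 0) ∧
      Completes n k s (n - i) (s'.wvar 29) (s'.wvar 30) (s'.rvar 3)) rfl rfl
    (by simp [hs.w0]; omega) (by simpa [Path, hz, hd] using hc) ?_ (by simp [hs.w0]) ?_
  swap
  · rintro s' hF hx ⟨-, -, h1, h2, h3, h4, h5⟩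
    simp only [State.setW_wvar, State.setR_wvar, hs.w0, Nat.reduceEqDiff, OfNat.zero_ne_ofNat,
      reduceIte, Nat.sub_self] at h1 h2 h3 h4 h5
    obtain ⟨g1, g2, g3⟩ := h5
    rw [g2, add_zero] at h3
    exact ⟨h1, ⟨_, h2, g1⟩, h3, by linarith⟩
  rintro pos s' hp hF hx ⟨i1, i2, i3, i4, i5, i6, i7⟩
  have hpos : pos < n := by simpa [hs.w0] using hp
  obtain ⟨m, hm⟩ : ∃ m, n - pos = m + 1 := ⟨n - pos - 1, by omega⟩
  have hs' : Sized w n k s' := (((hs.setR).setW rfl).setW rfl).frame hF rfl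
  have n' : nextOf n k s' = nextOf n k s := nextOf_congr ((hF.wa 9 rfl).trans rfl)
  have g' : gainAt s' = gainAt s := gainAt_congr ((hF.wa 7 rfl).trans rfl)
  have r5 : s'.rarr 5 = s.rarr 5 := hF.ra 5 rfl
  have r6 : s'.rarr 6 = s.rarr 6 := hF.ra 6 rfl
  have hm' : n - (pos + 1) = m := by omega
  rw [hm, Completes.succ, show n - (m + 1) = pos by omega] at i7
  have hnx' : ∀ b ≤ 1, nextOf n k s pos (s'.wvar 29) b ≤ numStates n k := fun b hb =>
    hnx _ (by have := digit_lt hpos i1; omega)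
  generalize hzd : s'.wvar 29 = z at *
  generalize hdd : s'.wvar 30 = d at *
  refine Run.seq (T₁ := 2) (T₂ := 120) (R := fun s₁ => s₁ = s'.setW 31 pos)
    (Run.of_wp (by simp [hx]) (by decide)) ?_ (by omega)
  rintro s₁ rfl -
  refine Run.seq (T₁ := 4) (T₂ := 116) (R := fun s₁ => s₁ = (s'.setW 31 pos).setW 28 (m + 1))
    (Run.of_wp (by simp [hx, hs'.w0, hm]) (by decide)) ?_ (by omega)
  rintro s₁ rfl -
  refine Run.seq (T₁ := 18) (T₂ := 98) (run_loadStepP (b := 0) ((hs'.setW rfl).setW rfl) hpos i1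
    (by omega) (by simp [hzd]) (by simp)) ?_ (by omega)
  rintro s₁ rfl -
  refine Run.seq (T₁ := 90) (T₂ := 8) (R := fun s₁ => s₁.wvar 30 = d ∧
    (∀ p < pos, s₁.warr 10 p = s'.warr 10 p) ∧ s₁.warr 10 pos ≤ 1 ∧ ∃ z',
      nextOf n k s pos z (s₁.warr 10 pos) = z' + 1 ∧ s₁.wvar 32 = z' + 1 ∧
      s₁.wvar 33 = gainAt s pos (s₁.warr 10 pos) ∧ gainAt s pos (s₁.warr 10 pos) ≤ d ∧
      s₁.rvar 3 = s'.rvar 3 - (if s₁.warr 10 pos = 1 then s.rarr 5 pos else 0) ∧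
      Completes n k s m z' (d - gainAt s pos (s₁.warr 10 pos)) (s₁.rvar 3)) ?_ ?_ (by omega)
  · simp only [nextOf_setW, gainAt_setW, n', g']
    set s₂ := (((s'.setW 31 pos).setW 28 (m + 1)).setW 32 (nextOf n k s pos z 0)).setW
      33 (gainAt s pos 0) with hs₂d
    have hs₂ : Sized w n k s₂ := (((hs'.setW rfl).setW rfl).setW rfl).setW rfl
    have f28 : s₂.wvar 28 = m + 1 := by simp [hs₂d]
    have f29 : s₂.wvar 29 = z := by simp [hs₂d, hzd]
    have f30 : s₂.wvar 30 = d := by simp [hs₂d, hdd]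
    have f31 : s₂.wvar 31 = pos := by simp [hs₂d]
    have f32 : s₂.wvar 32 = nextOf n k s pos z 0 := by simp [hs₂d]
    have f33 : s₂.wvar 33 = gainAt s pos 0 := by simp [hs₂d]
    have f4 : s₂.wvar 4 = pos := by simp [hs₂d, hx]
    have fr : s₂.rvar = s'.rvar := rfl
    have look : canStepE.val s₂ → ∃ z', nextOf n k s pos z 0 = z' + 1 ∧ gainAt s pos 0 ≤ d ∧
        restE.Ok w s₂ ∧
        IsBest (s₂.rarr 6 (restE.nat s₂)) (Completes n k s m z' (d - gainAt s pos 0)) := by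
      rw [val_canStepE, f30, f32, f33]
      rintro ⟨c1, c2⟩
      obtain ⟨z', hz'⟩ := Nat.exists_eq_succ_of_ne_zero c1
      exact ⟨z', hz', c2, ht.restE hs₂ (by omega) i2 f28 f30 (f32.trans hz') f33
        (by have := hnx' 0 (by omega); omega) r6⟩
    refine Run.ite (T := 30) ⟨ok_canStepE, fun h => ?_⟩ ?_ ?_ (by decide)
    · obtain ⟨z', -, -, h3, -⟩ := look h
      exact ⟨⟨trivial, h3⟩, fun _ => ⟨trivial, h3⟩⟩
    · rintro ⟨hcan, hge⟩
      obtain ⟨z', e1, e2, -, e4⟩ := look hcan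
      simp only [BExpr.val, RExpr.val, fr, Nat.cast_zero] at hge
      refine Run.of_wp ?_ (by decide)
      simp only [Cmd.wp, WExpr.Ok, WExpr.nat, State.putW_wvar, State.putW_warr, State.putW_rvar,
        true_and, f4, f30, f32, f33, fr, reduceIte, zero_ne_one, sub_zero]
      exact ⟨by omega, fun p hp => by rw [if_neg hp.ne]; rfl, by omega, z', e1, e1, e2,
        (e4 _).1 hge⟩
    · intro hno
      -- If the table refuses bit 0, a completion through bit 0 would contradict the correctness of
      -- the entry, so the promised completion uses bit 1.
      have hone := i7.resolve_left fun ⟨z', e1, e2, e3⟩ => by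
        have hcan : canStepE.val s₂ := by
          rw [val_canStepE, f30, f32, f33]; exact ⟨by omega, e2⟩
        obtain ⟨z₁, e1', -, -, e4⟩ := look hcan
        obtain rfl : z₁ = z' := by omega
        refine hno ⟨hcan, ?_⟩
        simp only [BExpr.val, RExpr.val, fr, Nat.cast_zero]
        exact (e4 _).2 e3
      obtain ⟨z', e1, e2, e3⟩ := hone
      refine Run.seq (T₁ := 18) (T₂ := 12) (run_loadStepP (b := 1) hs₂ hpos i1 le_rfl f29 f31) ?_
        (by omega)
      rintro s₃ rfl -
      have p1 : 1 < 2 ^ w := by omega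
      refine Run.of_wp ?_ (by decide)
      have n₂ : nextOf n k s₂ = nextOf n k s := n'
      have g₂ : gainAt s₂ = gainAt s := g'
      have w₂ : s₂.warr = s'.warr := rfl
      have ra₂ : s₂.rarr 5 = s.rarr 5 := r5
      simp only [Cmd.wp, WExpr.Ok, WExpr.nat, RExpr.Ok, RExpr.val, State.putW_wvar,
        State.putW_warr, State.putW_rvar, State.putW_rarr, State.setR_rvar, State.setR_wvar,
        State.setR_warr, State.setW_wvar, State.setW_warr, State.setW_rvar, State.setW_rarr,
        Nat.reduceEqDiff, true_and, f4, f30, f31, fr, n₂, g₂, w₂, ra₂, reduceIte]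
      exact ⟨p1, fun p hp => by rw [if_neg hp.ne], le_rfl, z', e1, e1, e2, e3⟩
  · rintro s₁ ⟨j1, j2, j3, z', j4, j5, j6, j7, j8, j9⟩ hF₁
    have hzz := hnx' _ j3
    refine Run.of_wp ?_ (by decide)
    simp only [Cmd.wp, WExpr.Ok, WExpr.nat, State.setW_wvar, State.setW_warr, State.setW_rvar,
      Nat.reduceEqDiff, reduceIte, j1, j5, j6, Nat.add_sub_cancel, Finset.sum_range_succ]
    have s1 : ∑ p ∈ Finset.range pos, gainAt s p (s₁.warr 10 p) =
        ∑ p ∈ Finset.range pos, gainAt s p (s'.warr 10 p) :=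
      Finset.sum_congr rfl fun p hp => by rw [j2 p (Finset.mem_range.1 hp)]
    have s2 : ∑ p ∈ Finset.range pos, (if s₁.warr 10 p = 1 then s.rarr 5 p else 0) =
        ∑ p ∈ Finset.range pos, (if s'.warr 10 p = 1 then s.rarr 5 p else 0) :=
      Finset.sum_congr rfl fun p hp => by rw [j2 p (Finset.mem_range.1 hp)]
    rw [s1, s2]
    refine ⟨⟨trivial, by omega⟩, ⟨trivial, trivial⟩, by omega, by omega, fun p hp => ?_,
      ⟨z, i4.congr fun p hp => (j2 p hp).symm, j4⟩, by omega, by linarith, ?_⟩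
    · rcases Nat.lt_succ_iff_lt_or_eq.1 hp with h | rfl
      · rw [j2 p h]; exact i3 p h
      · exact j3
    · rw [hm']
      exact j9

/-! ### Finding a set of largest gain -/

/-- The memory after preprocessing. -/
structure Prepared (w n k : ℕ) (s : State) : Prop extends Sized w n k s where
  chain_le : ∀ p < n, s.warr 3 p ≤ 1
  near_zero : ∀ q ≤ n, s.warr 4 q = 0
  neighboursSuffice : NeighboursSuffice n (s.warr 3) fun a b => s.warr 4 (a * (n + 1) + b)
  add : ∀ t < n * numRecords n, s.warr 5 t = addElemCode n (s.warr 3)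
    (fun a b => s.warr 4 (a * (n + 1) + b)) (t / numRecords n) (t % numRecords n)
  weight_nonneg : ∀ p < n, 0 ≤ s.rarr 5 p

/-- The program does not write to the memory filled by the preprocessing. -/
def keepsPrepared (p : Cmd) : Bool :=
  keepsSizes p && !p.writesWA 3 && !p.writesWA 4 && !p.writesWA 5 && !p.writesRA 5

theorem Prepared.frame {w n k : ℕ} {p : Cmd} {s s' : State} (h : Prepared w n k s)
    (hF : Frame p s s') (hp : keepsPrepared p = true) : Prepared w n k s' := by
  simp only [keepsPrepared, Bool.and_eq_true, Bool.not_eq_true'] at hp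
  obtain ⟨⟨⟨⟨h0, h3⟩, h4⟩, h5⟩, h6⟩ := hp
  have e3 := hF.wa 3 h3
  have e4 := hF.wa 4 h4
  have e5 := hF.wa 5 h5
  have e6 := hF.ra 5 h6
  refine ⟨h.toSized.frame hF h0, ?_, ?_, ?_, ?_, ?_⟩
  · rw [e3]; exact h.chain_le
  · rw [e4]; exact h.near_zero
  · rw [e3, e4]; exact h.neighboursSuffice
  · rw [e3, e4, e5]; exact h.add
  · rw [e6]; exact h.weight_nonneg

/-- `X` is an independent set of weight at least `θ`, other than the active rows in mode `0`. -/
structure Candidate (n : ℕ) (s : State) (i K mode : ℕ) (θ : ℝ) (X : ℕ → ℕ) : Prop where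
  le_one : ∀ p < n, X p ≤ 1
  indep : Indep n (fun a b => s.warr 4 (a * (n + 1) + b)) X
  differs : mode = 0 → ∀ l, Active i K l → ∃ p < n, rowOf n s l p ≠ X p
  le_weight : θ ≤ ∑ p ∈ Finset.range n, if X p = 1 then s.rarr 5 p else 0

/-- The distance of `X` from the active rows. -/
noncomputable def totalGain (n : ℕ) (s : State) (i K : ℕ) (X : ℕ → ℕ) : ℕ :=
  ∑ p ∈ Finset.range n, gainOf (rowOf n s) i K p (X p)

theorem totalGain_lt {n k K : ℕ} (s : State) (i : ℕ) (hK : K ≤ k) (X : ℕ → ℕ) :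
    totalGain n s i K X < numGains n k := by
  refine Nat.lt_succ_of_le ((Finset.sum_le_sum fun p _ =>
    (gainOf_le (rowOf n s) i K p (X p)).trans hK).trans ?_)
  simp

/-- Compute all tables. -/
def tablesP : Cmd :=
  .seq gainsP <| .seq trieP <| .seq startP <| .seq productP tableP

/-- The running time of `tablesP`. -/
def tablesTime (n k : ℕ) : ℕ :=
  (n * 2 + 1) * ((k + 1) * 38 + 23) +
  ((n * (k + 1) * 2 + 1) * ((k + 1) * ((n + 1) * 38 + 40) + 60) +
  (((k + 1) * 18 + 20) +
  ((n * numStates n k * 2 + 1) * 71 +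
  ((n + 1) * numStates n k * numGains n k + 1) * 150)))

/-- The tables in `s'` are those for the data in `s`. -/
structure Tables (n k i K mode : ℕ) (s s' : State) : Prop where
  start_lt : s'.wvar 24 < numStates n k
  correct : TableCorrect n k s'
  next_le : ∀ t < n * numStates n k * 2, s'.warr 9 t ≤ numStates n k
  gains : ∀ t < n * 2, s'.warr 7 t = gainOf (rowOf n s) i K (t / 2) (t % 2)
  accepted : ∀ X : ℕ → ℕ, (∀ p < n, X p ≤ 1) →
    ((∃ z, Path (nextOf n k s') X (s'.wvar 24) n z ∧ k * numRecords n ≤ z) ↔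
      Indep n (fun a b => s.warr 4 (a * (n + 1) + b)) X ∧
        (mode = 0 → ∀ l, Active i K l → ∃ p < n, rowOf n s l p ≠ X p))

theorem Tables.frame {n k i K mode : ℕ} {s s' s'' : State} {p : Cmd}
    (h : Tables n k i K mode s s') (hF : Frame p s' s'') (h24 : p.writesW 24 = false)
    (h7 : p.writesWA 7 = false) (h9 : p.writesWA 9 = false) (h5 : p.writesRA 5 = false)
    (h6 : p.writesRA 6 = false) : Tables n k i K mode s s'' where
  start_lt := by rw [hF.w _ h24]; exact h.start_lt
  correct := by
    rw [TableCorrect, Completes.congr (hF.wa _ h7) (hF.wa _ h9) (hF.ra _ h5), hF.ra _ h6]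
    exact h.correct
  next_le := by rw [hF.wa _ h9]; exact h.next_le
  gains := by rw [hF.wa _ h7]; exact h.gains
  accepted := by rw [nextOf_congr (hF.wa _ h9), hF.w _ h24]; exact h.accepted

theorem Tables.sum_gain {n k i K mode : ℕ} {s s' : State} (h : Tables n k i K mode s s')
    {X : ℕ → ℕ} (hX : ∀ p < n, X p ≤ 1) :
    ∑ p ∈ Finset.range n, gainAt s' p (X p) = totalGain n s i K X :=
  Finset.sum_congr rfl fun p hp => by
    have hp' := Finset.mem_range.1 hp
    have hXp := hX p hp'
    have := h.gains (p * 2 + X p) (by omega)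
    rw [digit_div (by omega), digit_mod (by omega)] at this
    rw [gainAt, this]

theorem run_tablesP {w n k i K mode : ℕ} {s : State} (hs : Prepared w n k s) (hi : s.wvar 21 = i)
    (hK : s.wvar 22 = K) (hm : s.wvar 23 = mode) (hKk : K ≤ k) :
    Run w tablesP s (tablesTime n k) (Tables n k i K mode s) := by
  refine Run.seq (run_gainsP hs.toSized hi hK hKk) ?_ le_rfl
  intro s₁ hg hF₁
  have hs₁ := hs.frame hF₁ rfl
  have row₁ : rowOf n s₁ = rowOf n s := by funext j p; simp only [rowOf, hF₁.wa 6 rfl]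
  refine Run.seq (run_trieP hs₁.toSized ((hF₁.w 21 rfl).trans hi) ((hF₁.w 22 rfl).trans hK) hKk)
    ?_ le_rfl
  intro s₂ hex hF₂
  rw [row₁] at hex
  have hs₂ := hs₁.frame hF₂ rfl
  refine Run.seq (run_startP hs₂.toSized (i := i) (K := K) (mode := mode)
    ((hF₂.w 21 rfl).trans ((hF₁.w 21 rfl).trans hi))
    ((hF₂.w 22 rfl).trans ((hF₁.w 22 rfl).trans hK))
    ((hF₂.w 23 rfl).trans ((hF₁.w 23 rfl).trans hm)) hKk) ?_ le_rfl
  rintro s₃ ⟨e₀, he₀, h24, hm1, hm2⟩ hF₃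
  have hs₃ := hs₂.frame hF₃ rfl
  have e8 : s₃.warr 8 = s₂.warr 8 := hF₃.wa 8 rfl
  refine Run.seq (run_productP hs₃.toSized (fun t ht => by rw [e8]; exact (hex t ht).1) hs₃.add)
    ?_ le_rfl
  rintro s₄ ⟨hle, hprod⟩ hF₄
  have hs₄ := hs₃.frame hF₄ rfl
  refine (run_tableP hs₄.toSized hle hs₄.weight_nonneg).frame.mono le_rfl ?_
  rintro s₅ ⟨hB, hF₅⟩
  have h24' : s₅.wvar 24 = e₀ * numRecords n :=
    (hF₅.w 24 rfl).trans ((hF₄.w 24 rfl).trans h24)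
  have nr₃ : s₃.warr 4 = s.warr 4 :=
    (hF₃.wa 4 rfl).trans ((hF₂.wa 4 rfl).trans (hF₁.wa 4 rfl))
  refine ⟨?_, ?_, ?_, ?_, fun X hX => ?_⟩
  · rw [h24']
    exact Nat.mul_lt_mul_of_pos_right (Nat.lt_succ_of_le he₀) (Fits.records_pos n)
  · rw [TableCorrect, Completes.congr (hF₅.wa 7 rfl) (hF₅.wa 9 rfl) (hF₅.ra 5 rfl)]
    exact hB
  · rw [hF₅.wa 9 rfl]; exact hle
  · rw [hF₅.wa 7 rfl, hF₄.wa 7 rfl, hF₃.wa 7 rfl, hF₂.wa 7 rfl]; exact hg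
  · rw [nextOf_congr (hF₅.wa 9 rfl), h24', ← nr₃]
    refine accepted_iff hprod hs₃.chain_le (fun q hq => by simpa using hs₃.near_zero q hq)
      hs₃.neighboursSuffice (row := rowOf n s) (act := Active i K) (X := X) (mode := mode)
      (fun pos hpos e he b hb => ?_) hX hm1 hm2
    have h1 : pos * (k + 1) + e < n * (k + 1) := digit_lt hpos (Nat.lt_succ_of_le he)
    have := hex ((pos * (k + 1) + e) * 2 + b) (by omega)
    rw [digit_div (a := pos * (k + 1) + e) (by omega),
      digit_mod (a := pos * (k + 1) + e) (by omega), digit_div (by omega),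
      digit_mod (by omega)] at this
    simpa only [excludeOf, e8] using this

/-- Each candidate appears in the table under its own gain; this is why the largest gain selected
dominates all candidates. -/
theorem Tables.completes {n k i K mode : ℕ} {s s' : State} (h : Tables n k i K mode s s')
    (h5 : s'.rarr 5 = s.rarr 5) {θ : ℝ} {X : ℕ → ℕ}
    (hX : Candidate n s i K mode θ X) :
    Completes n k s' n (s'.wvar 24) (totalGain n s i K X) θ := by
  obtain ⟨z, hz1, hz2⟩ := (h.accepted X hX.le_one).2 ⟨hX.indep, hX.differs⟩
  rw [← h.sum_gain hX.le_one]
  exact Path.sol hX.le_one hz1 hz2 (by rw [h5]; exact hX.le_weight)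

/-- Find a candidate of largest gain. -/
def findP : Cmd :=
  .seq tablesP <| .seq selectP <| .ite (.weq (.var 25) (.const 1)) walkP .skip

/-- The running time of `findP`. -/
def findTime (n k : ℕ) : ℕ :=
  tablesTime n k + (((numGains n k + 1) * 30 + 20) + ((n + 1) * 150 + 4))

theorem run_findP {w n k i K mode : ℕ} {s : State} (hs : Prepared w n k s) (hi : s.wvar 21 = i)
    (hK : s.wvar 22 = K) (hm : s.wvar 23 = mode) (hKk : K ≤ k) :
    Run w findP s (findTime n k) (fun s' =>
      (∀ X : ℕ → ℕ, (∀ p < n, X p ≤ 1) →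
        ∑ p ∈ Finset.range n, gainAt s' p (X p) = totalGain n s i K X) ∧
      ((s'.wvar 25 = 0 ∧ ∀ X, ¬ Candidate n s i K mode (s.rvar 2) X) ∨
       (s'.wvar 25 = 1 ∧ Candidate n s i K mode (s.rvar 2) (s'.warr 10) ∧
        s'.wvar 26 = totalGain n s i K (s'.warr 10) ∧
        ∀ X, Candidate n s i K mode (s.rvar 2) X →
          totalGain n s i K X ≤ totalGain n s i K (s'.warr 10)))) := by
  have hf := hs.toFits
  refine Run.seq (run_tablesP hs hi hK hm hKk) ?_ le_rfl
  intro s₅ ht hF₅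
  have hs₅ := hs.frame hF₅ rfl
  have hr2 : s₅.rvar 2 = s.rvar 2 := hF₅.r 2 rfl
  have wt₅ : s₅.rarr 5 = s.rarr 5 := hF₅.ra 5 rfl
  refine Run.seq (run_selectP hs₅.toSized ht.correct rfl ht.start_lt) ?_ le_rfl
  intro s₆ hsel hF₆
  rw [hr2] at hsel
  have hs₆ := hs₅.frame hF₆ rfl
  have p1 : 1 < 2 ^ w := by have := hf.succ_lt; have := hf.one_le_n; omega
  have ht₆ := ht.frame hF₆ rfl rfl rfl rfl rfl
  refine Run.ite (T := (n + 1) * 150) (by simp [p1]) (fun h1 => ?_) (fun h1 => ?_)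
    (by simp [BExpr.cost, WExpr.cost]; omega)
  · simp only [BExpr.val, WExpr.nat] at h1
    obtain ⟨-, h26, hcomp', hmax⟩ := hsel.resolve_left fun h => by omega
    have hcomp₆ : Completes n k s₆ = Completes n k s₅ :=
      Completes.congr (hF₆.wa 7 rfl) (hF₆.wa 9 rfl) (hF₆.ra 5 rfl)
    have hr6 : s₆.rvar 2 = s.rvar 2 := (hF₆.r 2 rfl).trans hr2
    refine (run_walkP hs₆.toSized ht₆.correct ht₆.next_le rfl ht₆.start_lt rfl h26
      (by rw [hcomp₆, hr6, hF₆.w 24 rfl]; exact hcomp')).frame.mono le_rfl ?_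
    rintro s₇ ⟨⟨q1, q2, q3, q4⟩, hF₇⟩
    have ht₇ := ht₆.frame hF₇ rfl rfl rfl rfl rfl
    rw [hr6, hF₆.ra 5 rfl, wt₅] at q4
    rw [ht₆.sum_gain q1] at q3
    obtain ⟨a1, a2⟩ := (ht₆.accepted _ q1).1 q2
    refine ⟨fun X hX => ht₇.sum_gain hX, .inr ⟨(hF₇.w 25 rfl).trans h1,
      ⟨q1, a1, a2, q4⟩, by rw [hF₇.w 26 rfl, q3], fun X hX => ?_⟩⟩
    rw [q3]
    exact hmax _ (totalGain_lt s i hKk X) (ht.completes wt₅ hX)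
  · simp only [BExpr.val, WExpr.nat] at h1
    obtain ⟨h0, hno⟩ := hsel.resolve_right fun h => h1 h.1
    refine Run.of_wp ⟨fun X hX => ht₆.sum_gain hX, .inl ⟨h0, fun X hX => ?_⟩⟩
      (by simp [Cmd.cst]; omega)
    exact hno _ (totalGain_lt s i hKk X) (ht.completes wt₅ hX)

end DiverseOpt

namespace DiverseOpt

open RealRAM

set_option linter.unusedSimpArgs false

/-! ### The maximum weight -/

/-- Converse of `Path.sol`, needed to show that the optimum stored in the table is attained by an
actual set. -/
theorem Sol.exists_path {nx : ℕ → ℕ → ℕ → ℕ} {g : ℕ → ℕ → ℕ} {wt : ℕ → ℝ} {acc : ℕ → Prop}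
    {n m z₀ z d : ℕ} {τ : ℝ} {X : ℕ → ℕ} (h : Sol nx g wt acc n m z d τ) (hm : m ≤ n)
    (hX : ∀ p < n - m, X p ≤ 1) (hp : Path nx X z₀ (n - m) z) :
    ∃ Y : ℕ → ℕ, (∀ p < n, Y p ≤ 1) ∧ (∀ p < n - m, Y p = X p) ∧
      (∃ zn, Path nx Y z₀ n zn ∧ acc zn) ∧
      τ ≤ ∑ p ∈ Finset.Ico (n - m) n, if Y p = 1 then wt p else 0 := by
  induction m generalizing z d τ X with
  | zero => exact ⟨X, hX, fun _ _ => rfl, ⟨z, hp, h.1⟩, by simpa using h.2.2⟩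
  | succ m ih =>
    have he : n - m = n - (m + 1) + 1 := by omega
    have hlt : n - (m + 1) < n := by omega
    have step : ∀ b ≤ 1, ∀ z', nx (n - (m + 1)) z b = z' + 1 →
        (∀ p < n - m, Function.update X (n - (m + 1)) b p ≤ 1) ∧
        Path nx (Function.update X (n - (m + 1)) b) z₀ (n - m) z' := by
      intro b hb z' hz'
      refine ⟨fun p hp => ?_, ?_⟩
      · by_cases h : p = n - (m + 1)
        · subst h; simpa using hb
        · rw [Function.update_of_ne h]; exact hX p (by omega)
      · rw [he]
        exact ⟨z, hp.congr fun p hp => (Function.update_of_ne hp.ne _ _).symm, by simpa using hz'⟩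
    have fin : ∀ (b : ℕ) (Y : ℕ → ℕ),
        (∀ p < n - m, Y p = Function.update X (n - (m + 1)) b p) →
        (∀ p < n - (m + 1), Y p = X p) ∧ Y (n - (m + 1)) = b := fun b Y hY =>
      ⟨fun p hp => by rw [hY p (by omega), Function.update_of_ne hp.ne],
        by rw [hY _ (by omega), Function.update_self]⟩
    rcases h with ⟨z', h1, -, h3⟩ | ⟨z', h1, -, h3⟩
    · obtain ⟨h4, h5⟩ := step 0 (by omega) z' h1
      obtain ⟨Y, y1, y2, y3, y4⟩ := ih h3 (by omega) h4 h5
      obtain ⟨y5, y6⟩ := fin 0 Y y2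
      refine ⟨Y, y1, y5, y3, ?_⟩
      rw [Finset.sum_eq_sum_Ico_succ_bot hlt, ← he, y6]
      simpa using y4
    · obtain ⟨h4, h5⟩ := step 1 le_rfl z' h1
      obtain ⟨Y, y1, y2, y3, y4⟩ := ih h3 (by omega) h4 h5
      obtain ⟨y5, y6⟩ := fin 1 Y y2
      refine ⟨Y, y1, y5, y3, ?_⟩
      rw [Finset.sum_eq_sum_Ico_succ_bot hlt, ← he, y6]
      simp only [reduceIte]
      linarith

/-- Compute the maximum weight of an independent set in real variable `5`. -/
def optimumP : Cmd :=
  .seq (.wset 21 (.const 0)) <|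
  .seq (.wset 22 (.const 0)) <|
  .seq (.wset 23 (.const 1)) <|
  .seq tablesP <|
  .rset 5 (.get 6 (.mul (.add (.mul (.var 0) (.var 11)) (.var 24)) (.var 12)))

/-- Without active rows and without exclusion every gain is 0, so the entry for all `n` bits, the
start state and gain 0 is the maximum weight of an independent set. -/
theorem run_optimumP {w n k : ℕ} {s : State} (hs : Prepared w n k s) :
    Run w optimumP s (tablesTime n k + 20) (fun s' =>
      (∃ X, Candidate n s 0 0 1 (s'.rvar 5) X) ∧
      ∀ X, Candidate n s 0 0 1 0 X →
        (∑ p ∈ Finset.range n, if X p = 1 then s.rarr 5 p else 0) ≤ s'.rvar 5) := by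
  have hf := hs.toFits
  have hD : 0 < numGains n k := by have := hf.two_le_gains; omega
  have p1 : 1 < 2 ^ w := by have := hf.succ_lt; have := hf.one_le_n; omega
  refine Run.seq (T₁ := 2) (T₂ := tablesTime n k + 18) (R := fun s₁ => s₁ = s.setW 21 0)
    (Run.of_wp (by simp) (by decide)) ?_ (by omega)
  rintro s₁ rfl -
  refine Run.seq (T₁ := 2) (T₂ := tablesTime n k + 16) (R := fun s₁ => s₁ = (s.setW 21 0).setW 22 0)
    (Run.of_wp (by simp) (by decide)) ?_ (by omega)
  rintro s₁ rfl -
  refine Run.seq (T₁ := 2) (T₂ := tablesTime n k + 14)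
    (R := fun s₁ => s₁ = ((s.setW 21 0).setW 22 0).setW 23 1)
    (Run.of_wp (by simp [p1]) (by decide)) ?_ (by omega)
  rintro s₁ rfl -
  have hs₁ : Prepared w n k (((s.setW 21 0).setW 22 0).setW 23 1) :=
    ⟨((hs.toSized.setW rfl).setW rfl).setW rfl, hs.chain_le, hs.near_zero, hs.neighboursSuffice,
      hs.add, hs.weight_nonneg⟩
  refine Run.seq (run_tablesP hs₁ (i := 0) (K := 0) (mode := 1) rfl rfl rfl (Nat.zero_le _))
    (T₂ := 14) ?_ (by omega)
  intro s₂ ht hF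
  have hs₂ := hs₁.toSized.frame hF rfl
  have h5 : s₂.rarr 5 = s.rarr 5 := hF.ra 5 rfl
  have hb := ht.correct.entry le_rfl ht.start_lt hD
  have hz := ht.start_lt
  have c1 := digit_lt (digit_lt (a := n) (d := n + 1) (by omega) hz) hD
  have c2 := hf.states_le
  have c3 := digit_lt (a := n) (d := n + 1) (by omega) hz
  have c4 := hf.table
  have zero_gain : ∀ (s : State) X, totalGain n s 0 0 X = 0 := fun s X => by
    refine Finset.sum_eq_zero fun p _ => ?_
    simp [gainOf]
  -- The empty set guarantees that the entry is not the negative default.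
  have h0 : Candidate n s 0 0 1 0 fun _ => 0 :=
    ⟨fun p _ => by omega, fun p z _ _ h => by omega, fun h => by omega, by simp⟩
  have hcomp : ∀ {θ X}, Candidate n s 0 0 1 θ X → Completes n k s₂ n (s₂.wvar 24) 0 θ := by
    intro θ X hX
    have := ht.completes h5 (θ := θ) (X := X) ⟨hX.le_one, hX.indep, hX.differs, hX.le_weight⟩
    rwa [zero_gain] at this
  rw [add_zero] at hb c1
  refine Run.of_wp ?_ (by decide)
  simp only [Cmd.wp, WExpr.Ok, WExpr.nat, RExpr.Ok, RExpr.val, State.setR_rvar, reduceIte, hs₂.w0,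
    hs₂.w11, hs₂.w12]
  refine ⟨⟨⟨⟨trivial, trivial, by omega⟩, trivial, by omega⟩, trivial, by omega⟩, ?_, fun X hX => ?_⟩
  · have hnn := ((hb 0).2 (hcomp h0)).1
    obtain ⟨Y, y1, -, y2, y3⟩ := Sol.exists_path (X := fun _ => 0) (z₀ := s₂.wvar 24)
      ((hb _).1 ⟨hnn, le_rfl⟩) le_rfl (fun _ _ => by omega) (by rw [Nat.sub_self]; rfl)
    obtain ⟨a1, a2⟩ := (ht.accepted Y y1).1 y2
    refine ⟨Y, y1, a1, fun h => by omega, ?_⟩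
    rw [Nat.sub_self, h5] at y3
    simpa using y3
  · exact ((hb _).2 (hcomp ⟨hX.le_one, hX.indep, hX.differs, le_rfl⟩)).2

/-! ### Sets of positions -/

/-- The set of the positions of the ones of `X`. -/
def bitsOf (n : ℕ) (X : ℕ → ℕ) : Finset (Fin n) := Finset.univ.filter fun p => X p = 1

/-- The independent sets of weight at least `θ`. -/
def Feasible (n : ℕ) (s : State) (θ : ℝ) : Set (Finset (Fin n)) :=
  {S | (∀ p ∈ S, ∀ z ∈ S, p < z → s.warr 4 ((p + 1) * (n + 1) + (z + 1)) = 0) ∧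
    θ ≤ ∑ p ∈ S, s.rarr 5 p}

/-- `S` differs from the active rows, in mode `0`. -/
def Allowed (n : ℕ) (s : State) (i K mode : ℕ) (S : Finset (Fin n)) : Prop :=
  mode = 0 → ∀ l, Active i K l → S ≠ bitsOf n (rowOf n s l)

open Classical in
/-- The sum of the distances from the active rows. -/
noncomputable def gainOfSet (n : ℕ) (s : State) (i K : ℕ) (S : Finset (Fin n)) : ℕ :=
  ∑ j ∈ (Finset.range K).filter (· ≠ i), (symmDiff S (bitsOf n (rowOf n s j))).card

theorem exists_bitsOf {n : ℕ} (S : Finset (Fin n)) :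
    ∃ X : ℕ → ℕ, (∀ p < n, X p ≤ 1) ∧ bitsOf n X = S := by
  classical
  refine ⟨fun p => if ∃ h : p < n, (⟨p, h⟩ : Fin n) ∈ S then 1 else 0, fun p _ => ?_, ?_⟩
  · dsimp only; split_ifs <;> omega
  · ext p; simp [bitsOf]

theorem bitsOf_eq_iff {n : ℕ} {X Y : ℕ → ℕ} (hX : ∀ p < n, X p ≤ 1) (hY : ∀ p < n, Y p ≤ 1) :
    bitsOf n X = bitsOf n Y ↔ ∀ p < n, X p = Y p := by
  constructor
  · intro h p hp
    have h1 : (⟨p, hp⟩ : Fin n) ∈ bitsOf n X ↔ (⟨p, hp⟩ : Fin n) ∈ bitsOf n Y := by rw [h]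
    simp only [bitsOf, Finset.mem_filter, Finset.mem_univ, true_and] at h1
    have := hX p hp
    have := hY p hp
    omega
  · intro h
    ext p
    simp [bitsOf, h p p.2]

theorem candidate_iff {n i K mode : ℕ} {s : State} {θ : ℝ} {X : ℕ → ℕ} (hX : ∀ p < n, X p ≤ 1)
    (hrow : ∀ l < K, ∀ p < n, rowOf n s l p ≤ 1) :
    Candidate n s i K mode θ X ↔
      bitsOf n X ∈ Feasible n s θ ∧ Allowed n s i K mode (bitsOf n X) := by
  have hsum : (∑ p ∈ bitsOf n X, s.rarr 5 p) =
      ∑ p ∈ Finset.range n, if X p = 1 then s.rarr 5 p else 0 := by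
    rw [bitsOf, Finset.sum_filter, Finset.sum_range]
  have hind : (∀ p ∈ bitsOf n X, ∀ z ∈ bitsOf n X, p < z →
      s.warr 4 ((p + 1) * (n + 1) + (z + 1)) = 0) ↔
      Indep n (fun a b => s.warr 4 (a * (n + 1) + b)) X := by
    simp only [bitsOf, Finset.mem_filter, Finset.mem_univ, true_and]
    exact ⟨fun h p z hpz hz hp hz' => h ⟨p, by omega⟩ hp ⟨z, hz⟩ hz' hpz,
      fun h p hp z hz hpz => h p z hpz z.2 hp hz⟩
  have hall : Allowed n s i K mode (bitsOf n X) ↔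
      (mode = 0 → ∀ l, Active i K l → ∃ p < n, rowOf n s l p ≠ X p) := by
    refine imp_congr_right fun _ => forall_congr' fun l => imp_congr_right fun hl => ?_
    rw [ne_comm, Ne, bitsOf_eq_iff (hrow l hl.1) hX]
    push Not
    rfl
  rw [Feasible, Set.mem_ofPred_eq, hsum, hind, hall]
  exact ⟨fun h => ⟨⟨h.indep, h.le_weight⟩, h.differs⟩, fun h => ⟨hX, h.1.1, h.2, h.1.2⟩⟩

/-- Double counting of the pairs (position, active row) at which the bits differ. -/
theorem totalGain_eq {n i K : ℕ} {s : State} {X : ℕ → ℕ} (hX : ∀ p < n, X p ≤ 1)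
    (hrow : ∀ l < K, ∀ p < n, rowOf n s l p ≤ 1) :
    totalGain n s i K X = gainOfSet n s i K (bitsOf n X) := by
  classical
  unfold totalGain gainOfSet gainOf
  simp_rw [Finset.card_filter]
  rw [Finset.sum_comm, Finset.sum_filter]
  refine Finset.sum_congr rfl fun j hj => ?_
  split_ifs with h
  · rw [Finset.sum_range, ← Finset.card_filter]
    congr 1
    ext p
    simp only [Finset.mem_filter, Finset.mem_univ, true_and, Finset.mem_symmDiff, bitsOf, h,
      not_false_eq_true, ne_eq]
    have := hX p p.2
    have := hrow j (Finset.mem_range.1 hj) p p.2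
    omega
  · exact Finset.sum_eq_zero fun p _ => by simp [h]

theorem run_findP_sets {w n k i K mode : ℕ} {s : State} (hs : Prepared w n k s)
    (hi : s.wvar 21 = i) (hK : s.wvar 22 = K) (hm : s.wvar 23 = mode) (hKk : K ≤ k)
    (hrow : ∀ l < K, ∀ p < n, rowOf n s l p ≤ 1) :
    Run w findP s (findTime n k) (fun s' =>
      (∀ X : ℕ → ℕ, (∀ p < n, X p ≤ 1) →
        ∑ p ∈ Finset.range n, gainAt s' p (X p) = gainOfSet n s i K (bitsOf n X)) ∧
      ((s'.wvar 25 = 0 ∧ ∀ S ∈ Feasible n s (s.rvar 2), ¬ Allowed n s i K mode S) ∨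
       (s'.wvar 25 = 1 ∧ (∀ p < n, s'.warr 10 p ≤ 1) ∧
        bitsOf n (s'.warr 10) ∈ Feasible n s (s.rvar 2) ∧
        Allowed n s i K mode (bitsOf n (s'.warr 10)) ∧
        s'.wvar 26 = gainOfSet n s i K (bitsOf n (s'.warr 10)) ∧
        ∀ S ∈ Feasible n s (s.rvar 2), Allowed n s i K mode S →
          gainOfSet n s i K S ≤ gainOfSet n s i K (bitsOf n (s'.warr 10))))) := by
  refine (run_findP hs hi hK hm hKk).mono le_rfl ?_
  rintro s' ⟨h1, h2⟩
  refine ⟨fun X hX => (h1 X hX).trans (totalGain_eq hX hrow), ?_⟩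
  rcases h2 with ⟨h2, h3⟩ | ⟨h2, h3, h4, h5⟩
  · refine .inl ⟨h2, fun S hS hA => ?_⟩
    obtain ⟨X, hX, rfl⟩ := exists_bitsOf S
    exact h3 X ((candidate_iff hX hrow).2 ⟨hS, hA⟩)
  · obtain ⟨g1, g2⟩ := (candidate_iff h3.le_one hrow).1 h3
    refine .inr ⟨h2, h3.le_one, g1, g2, h4.trans (totalGain_eq h3.le_one hrow), fun S hS hA => ?_⟩
    obtain ⟨X, hX, rfl⟩ := exists_bitsOf S
    rw [← totalGain_eq hX hrow, ← totalGain_eq h3.le_one hrow]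
    exact h5 X ((candidate_iff hX hrow).2 ⟨hS, hA⟩)

end DiverseOpt

namespace DiverseOpt

open RealRAM

set_option linter.unusedSimpArgs false

/-! ### The initial collection -/

/-- The current collection. -/
def rowsOf (n k : ℕ) (s : State) (j : Fin k) : Finset (Fin n) := bitsOf n (rowOf n s j)

/-- The first `K` rows consist of zeros and ones. -/
def BitRows (n K : ℕ) (s : State) : Prop := ∀ l < K, ∀ p < n, rowOf n s l p ≤ 1

theorem rowOf_congr {n : ℕ} {s s' : State} (h : s'.warr 6 = s.warr 6) :
    rowOf n s' = rowOf n s := by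
  funext j p; simp only [rowOf, h]

@[simp] theorem rowOf_setW (n : ℕ) (s : State) (x v : ℕ) : rowOf n (s.setW x v) = rowOf n s := rfl

theorem Feasible.congr {n : ℕ} {s s' : State} {θ : ℝ} (h4 : s'.warr 4 = s.warr 4)
    (h5 : s'.rarr 5 = s.rarr 5) : Feasible n s' θ = Feasible n s θ := by
  simp only [Feasible, h4, h5]

/-- Copy the set found to the row in variable `21`. -/
def copyP : Cmd :=
  forLoop 4 20 <| .seq
    (.ite (.weq (.div (.var 4) (.var 0)) (.var 21)) (.wset 7 (.get 10 (.mod (.var 4) (.var 0))))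
      (.wset 7 (.get 6 (.var 4))))
    (.wput 6 (.var 4) (.var 7))

theorem run_copyP {w n k i : ℕ} {s : State} (hs : Sized w n k s) (hi : s.wvar 21 = i) :
    Run w copyP s ((k * n + 1) * 25) (fun s' => ∀ j < k, ∀ p < n,
      rowOf n s' j p = if j = i then s.warr 10 p else rowOf n s j p) := by
  have hlt := hs.toFits.matrix_lt
  have hle : k * n ≤ (k + 1) * (n + 1) := Nat.mul_le_mul (by omega) (by omega)
  -- The matrix is rewritten in place. A cell still holds its old value when the loop reaches it, so
  -- rows other than the selected one are reproduced.
  refine Run.fillW (Tb := 14)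
    (fun t v => v = if t / n = i then s.warr 10 (t % n) else s.warr 6 t) rfl rfl rfl
    (by rw [hs.w20]; omega) ?_ (by rw [hs.w20]) ?_
  · intro t s' ht hF hx _ hold
    have e0 : s'.wvar 0 = n := (hF.w 0 rfl).trans hs.w0
    have e21 : s'.wvar 21 = i := (hF.w 21 rfl).trans hi
    refine Run.of_wp ?_ (by decide)
    simp only [Cmd.wp, WExpr.Ok, WExpr.nat, BExpr.Ok, BExpr.val, State.setW_wvar, reduceIte, hx,
      e0, e21, hF.wa 10 rfl, hold t le_rfl, and_self, true_and]
    exact ⟨fun h => (if_pos h).symm, fun h => (if_neg h).symm⟩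
  · intro s' _ h _ j hj p hp
    rw [hs.w20] at h
    have := h _ (digit_lt hj hp)
    rwa [digit_div hp, digit_mod hp] at this

/-- Compute an initial collection. -/
def initialP : Cmd :=
  .seq (.wset 23 (.const 0)) <|
  forLoop 21 1 <|
    .seq (.wset 22 (.var 21)) <|
    .seq findP <|
    .seq (.ite (.weq (.var 25) (.const 0)) (.seq (.wset 23 (.const 1)) findP) .skip)
    copyP

/-- The rows below `K` belong to `F`; they are pairwise distinct if variable `23` is `0`, and
otherwise `F` has fewer than `k` members. -/
structure Collected (n k K : ℕ) (F : Set (Finset (Fin n))) (s : State) : Prop where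
  bits : BitRows n K s
  mem : ∀ j < K, bitsOf n (rowOf n s j) ∈ F
  distinct : (s.wvar 23 = 0 ∧ ∀ j < K, ∀ j' < K, j ≠ j' →
    bitsOf n (rowOf n s j) ≠ bitsOf n (rowOf n s j')) ∨ (s.wvar 23 = 1 ∧ F.ncard < k)

theorem Prepared.setW {w n k x v : ℕ} {s : State} (h : Prepared w n k s)
    (hx : keepsSizes (.wset x (.const 0)) = true) : Prepared w n k (s.setW x v) :=
  ⟨h.toSized.setW hx, h.chain_le, h.near_zero, h.neighboursSuffice, h.add, h.weight_nonneg⟩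

/-- Rows are added greedily outside the earlier ones. The first failure proves that the family is
small, after which the flag in variable 23 stays 1 and repetitions are permitted. -/
theorem run_initialP {w n k : ℕ} {s : State} (hs : Prepared w n k s)
    (hne : (Feasible n s (s.rvar 2)).Nonempty) :
    Run w initialP s ((k + 1) * (2 * findTime n k + (k * n + 1) * 25 + 20) + 2)
      (Collected n k k (Feasible n s (s.rvar 2))) := by
  have hf := hs.toFits
  have hk1 := hf.succ_k_lt
  have p1 : 1 < 2 ^ w := by have := hf.one_le_k; omega
  have p0 : 0 < 2 ^ w := by omega
  set F := Feasible n s (s.rvar 2) with hFdef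
  refine Run.seq (T₁ := 2) (T₂ := (k + 1) * (2 * findTime n k + (k * n + 1) * 25 + 20))
    (R := fun s₁ => s₁ = s.setW 23 0) (Run.of_wp (by simp) (by decide)) ?_ (by omega)
  rintro s₁ rfl -
  refine Run.forLoop (Tb := 2 * findTime n k + (k * n + 1) * 25 + 12)
    (fun l s' => Collected n k l F s') rfl rfl (by simp [hs.w1]; omega)
    ⟨fun l hl => absurd hl (Nat.not_lt_zero _), fun l hl => absurd hl (Nat.not_lt_zero _),
      .inl ⟨by simp, fun l hl => absurd hl (Nat.not_lt_zero _)⟩⟩ ?_ (by simp [hs.w1])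
    (fun s' _ _ h => by simpa [hs.w1] using h)
  intro l s' hl hF hx hI
  have hl' : l < k := by simpa [hs.w1] using hl
  have hs' : Prepared w n k s' := (hs.setW rfl).frame hF rfl
  have hFe : ∀ s₂ : State, s₂.warr 4 = s'.warr 4 → s₂.rarr 5 = s'.rarr 5 →
      s₂.rvar 2 = s'.rvar 2 → Feasible n s₂ (s₂.rvar 2) = F := fun s₂ h4 h5 hr => by
    rw [Feasible.congr (h4.trans (hF.wa 4 rfl)) (h5.trans (hF.ra 5 rfl)), hr, hF.r 2 rfl]
    rfl
  refine Run.seq (T₁ := 2) (T₂ := 2 * findTime n k + (k * n + 1) * 25 + 10)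
    (R := fun s₁ => s₁ = s'.setW 22 l) (Run.of_wp (by simp [hx]) (by decide)) ?_ (by omega)
  rintro s₁ rfl -
  have hs₁ : Prepared w n k (s'.setW 22 l) := hs'.setW rfl
  refine Run.seq (T₁ := findTime n k) (T₂ := findTime n k + (k * n + 1) * 25 + 10)
    (run_findP_sets hs₁ (i := l) (K := l) (mode := s'.wvar 23) (by simp [hx]) (by simp) (by simp)
      hl'.le hI.bits) ?_ (by omega)
  rintro s₂ ⟨-, hfind⟩ hF₂
  rw [hFe (s'.setW 22 l) rfl rfl rfl] at hfind
  have hs₂ := hs₁.frame hF₂ rfl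
  have r₂ : rowOf n s₂ = rowOf n s' := rowOf_congr (hF₂.wa 6 rfl)
  have e23 : s₂.wvar 23 = s'.wvar 23 := (hF₂.w 23 rfl).trans (by simp)
  refine Run.seq (T₁ := findTime n k + 10) (T₂ := (k * n + 1) * 25)
    (R := fun s₃ => (∀ p < n, s₃.warr 10 p ≤ 1) ∧ bitsOf n (s₃.warr 10) ∈ F ∧
      ((s₃.wvar 23 = 0 ∧ s'.wvar 23 = 0 ∧ ∀ j < l, bitsOf n (s₃.warr 10) ≠ bitsOf n (rowOf n s' j)) ∨
      (s₃.wvar 23 = 1 ∧ F.ncard < k))) ?_ ?_ (by omega)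
  · refine Run.ite (T := findTime n k + 4) (by simp [p0]) (fun h => ?_) (fun h => ?_)
      (by simp [BExpr.cost, WExpr.cost]; omega)
    · simp only [BExpr.val, WExpr.nat] at h
      obtain ⟨-, hno⟩ := hfind.resolve_right fun h' => by omega
      have hcard : F.ncard < k := by
        rcases hI.distinct with ⟨h0, -⟩ | ⟨-, h⟩
        -- Nothing was found, so every member of `F` is one of the `l` earlier rows.
        · have hsub : F ⊆ ↑((Finset.range l).image fun j => bitsOf n (rowOf n s' j)) := by
            intro S hS
            have := hno S hS
            unfold Allowed at this
            push Not at this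
            obtain ⟨-, j, hj, rfl⟩ := this
            simp only [Finset.coe_image, Set.mem_image, Finset.coe_range, Set.mem_Iio]
            exact ⟨j, hj.1, rfl⟩
          have h1 := Set.ncard_le_ncard hsub (Finset.finite_toSet _)
          rw [Set.ncard_coe_finset] at h1
          have h2 := Finset.card_image_le (s := Finset.range l)
            (f := fun j => bitsOf n (rowOf n s' j))
          rw [Finset.card_range] at h2
          omega
        · exact h
      refine Run.seq (T₁ := 2) (T₂ := findTime n k) (R := fun s₃ => s₃ = s₂.setW 23 1)
        (Run.of_wp (by simp [p1]) (by decide)) ?_ (by omega)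
      rintro s₃ rfl -
      refine (run_findP_sets (hs₂.setW (x := 23) (v := 1) rfl) (i := l) (K := l) (mode := 1)
        (by simp [hF₂.w 21 rfl, hx]) (by simp [hF₂.w 22 rfl]) (by simp) hl'.le
        (by rw [rowOf_setW, r₂]; exact hI.bits)).frame.mono le_rfl ?_
      rintro s₃ ⟨⟨-, hfind'⟩, hF₃⟩
      rw [hFe (s₂.setW 23 1) (hF₂.wa 4 rfl) (hF₂.ra 5 rfl) (hF₂.r 2 rfl)] at hfind'
      -- In mode 1 nothing is excluded, so the second search succeeds because `F` is nonempty.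
      obtain ⟨-, q1, q2, -⟩ := hfind'.resolve_left fun h' => by
        obtain ⟨S, hS⟩ := hne
        exact h'.2 S hS fun h => by omega
      exact ⟨q1, q2, .inr ⟨(hF₃.w 23 rfl).trans (by simp), hcard⟩⟩
    · simp only [BExpr.val, WExpr.nat] at h
      obtain ⟨-, q1, q2, q3, -⟩ := hfind.resolve_left fun h' => by omega
      refine Run.of_wp ⟨q1, q2, ?_⟩ (by simp [Cmd.cst])
      rcases hI.distinct with ⟨h0, -⟩ | ⟨h1, h2⟩
      · exact .inl ⟨by omega, h0, fun j hj => q3 h0 j ⟨hj, hj.ne⟩⟩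
      · exact .inr ⟨by omega, h2⟩
  · rintro s₃ ⟨q1, q2, q3⟩ hF₃
    have hs₃ := hs₂.frame hF₃ rfl
    have r₃ : rowOf n s₃ = rowOf n s' := (rowOf_congr (hF₃.wa 6 rfl)).trans r₂
    refine (run_copyP hs₃.toSized (i := l) ((hF₃.w 21 rfl).trans ((hF₂.w 21 rfl).trans
      (by simp [hx])))).frame.mono le_rfl ?_
    rintro s₄ ⟨hc, hF₄⟩
    rw [r₃] at hc
    have hnew : bitsOf n (rowOf n s₄ l) = bitsOf n (s₃.warr 10) := by
      ext p; simp [bitsOf, hc l hl' p p.2]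
    have hold : ∀ j < l, bitsOf n (rowOf n s₄ j) = bitsOf n (rowOf n s' j) := fun j hj => by
      ext p; simp [bitsOf, hc j (by omega) p p.2, hj.ne]
    have e23' : s₄.wvar 23 = s₃.wvar 23 := hF₄.w 23 rfl
    refine ⟨fun j hj p hp => ?_, fun j hj => ?_, ?_⟩
    · change rowOf n s₄ j p ≤ 1
      rw [hc j (by omega) p hp]
      split_ifs with h
      · exact q1 p hp
      · exact hI.bits j (by omega) p hp
    · change bitsOf n (rowOf n s₄ j) ∈ F
      rcases Nat.lt_succ_iff_lt_or_eq.1 hj with h | rfl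
      · rw [hold j h]; exact hI.mem j h
      · rw [hnew]; exact q2
    · simp only [State.setW_wvar, Nat.reduceEqDiff, reduceIte, e23']
      refine q3.imp (fun ⟨a0, a1, a2⟩ => ⟨a0, ?_⟩) id
      have hd := (hI.distinct.resolve_right fun h => by omega).2
      intro j hj j' hj' hne
      change bitsOf n (rowOf n s₄ j) ≠ bitsOf n (rowOf n s₄ j')
      rcases Nat.lt_succ_iff_lt_or_eq.1 hj with h | rfl <;>
        rcases Nat.lt_succ_iff_lt_or_eq.1 hj' with h' | rfl
      · rw [hold j h, hold j' h']; exact hd j h j' h' hne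
      · rw [hold j h, hnew]; exact (a2 j h).symm
      · rw [hnew, hold j' h']; exact a2 j' h'
      · exact absurd rfl hne

end DiverseOpt

namespace DiverseOpt

open RealRAM

set_option linter.unusedSimpArgs false

/-! ### Local search -/

theorem gainOfSet_lt {n k K : ℕ} (s : State) (i : ℕ) (hK : K ≤ k) (S : Finset (Fin n)) :
    gainOfSet n s i K S < numGains n k := by
  classical
  refine Nat.lt_succ_of_le ?_
  calc gainOfSet n s i K S ≤ ∑ _j ∈ (Finset.range K).filter (· ≠ i), n :=
        Finset.sum_le_sum fun j _ => (Finset.card_le_univ _).trans (by simp)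
    _ ≤ K * n := by
        rw [Finset.sum_const, smul_eq_mul]
        exact Nat.mul_le_mul_right _ ((Finset.card_filter_le _ _).trans (by simp))
    _ ≤ n * k := by rw [Nat.mul_comm]; exact Nat.mul_le_mul_left _ hK

theorem gainOfSet_eq {n k : ℕ} (s : State) (i : Fin k) (S : Finset (Fin n)) :
    gainOfSet n s i k S = ∑ j ∈ Finset.univ.erase i, (symmDiff S (rowsOf n k s j)).card := by
  classical
  have : (Finset.univ.erase i : Finset (Fin k)) = Finset.univ.filter fun j : Fin k => (j : ℕ) ≠ i := by
    ext j; simp [Fin.ext_iff]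
  rw [this, gainOfSet, Finset.sum_filter, Finset.sum_filter, Finset.sum_range]
  rfl

theorem allowed_iff {n k : ℕ} {s : State} {i : Fin k} {mode : ℕ} {S : Finset (Fin n)} :
    Allowed n s i k mode S ↔ (mode = 0 → ∀ j, j ≠ i → S ≠ rowsOf n k s j) :=
  imp_congr_right fun _ => ⟨fun h j hj => h j ⟨j.2, fun h' => hj (Fin.ext h')⟩,
    fun h l hl => h ⟨l, hl.1⟩ fun h' => hl.2 (by rw [← h'])⟩

/-- Add up the gains of the row in variable `21`. -/
def rowGainP : Cmd :=
  .seq (.wset 39 (.const 0)) <|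
  forLoop 4 0 <|
    .wset 39 (.add (.var 39) (.get 7 (.add (.mul (.var 4) (.const 2))
      (.get 6 (.add (.mul (.var 21) (.var 0)) (.var 4))))))

theorem run_rowGainP {w n k i : ℕ} {s : State} (hs : Sized w n k s) (hi : s.wvar 21 = i)
    (hik : i < k) (hb : ∀ p < n, rowOf n s i p ≤ 1)
    (hG : ∑ p ∈ Finset.range n, gainAt s p (rowOf n s i p) < 2 ^ w) :
    Run w rowGainP s ((n + 1) * 25 + 2)
      (fun s' => s'.wvar 39 = ∑ p ∈ Finset.range n, gainAt s p (rowOf n s i p)) := by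
  have hf := hs.toFits
  have hlt := hf.trie_lt
  have hle : (n + 1) * 2 ≤ (n + 1) * (k + 1) :=
    Nat.mul_le_mul_left _ (by have := hf.one_le_k; omega)
  have hn1 := hf.one_le_n
  refine Run.seq (T₁ := 2) (T₂ := (n + 1) * 25) (R := fun s₁ => s₁ = s.setW 39 0)
    (Run.of_wp (by simp) (by decide)) ?_ (by omega)
  rintro s₁ rfl -
  refine Run.forLoop (Tb := 17) (fun l s' => s'.wvar 39 =
    ∑ p ∈ Finset.range l, gainAt s p (rowOf n s i p)) rfl rfl
    (by simp [hs.w0]; omega) (by simp) ?_ (by simp [hs.w0]) (fun s' _ _ h => by simpa [hs.w0] using h)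
  intro p s' hp hF hx hI
  have hp' : p < n := by simpa [hs.w0] using hp
  have e0 : s'.wvar 0 = n := (hF.w 0 rfl).trans (by simp [hs.w0])
  have e21 : s'.wvar 21 = i := (hF.w 21 rfl).trans (by simp [hi])
  have a6 : s'.warr 6 (i * n + p) = rowOf n s i p := by rw [hF.wa 6 rfl]; rfl
  have a7 : ∀ b, s'.warr 7 (p * 2 + b) = gainAt s p b := fun b => by rw [hF.wa 7 rfl]; rfl
  have hcell := cell_lt hf hik hp'
  have hbit := hb p hp'
  have hsum : ∑ p ∈ Finset.range p, gainAt s p (rowOf n s i p) + gainAt s p (rowOf n s i p) ≤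
      ∑ p ∈ Finset.range n, gainAt s p (rowOf n s i p) := by
    rw [← Finset.sum_range_succ]
    exact Finset.sum_le_sum_of_subset (Finset.range_subset_range.2 hp')
  refine Run.of_wp ?_ (by decide)
  simp only [Cmd.wp, WExpr.Ok, WExpr.nat, State.setW_wvar, Nat.reduceEqDiff, reduceIte, hx, e0,
    e21, a6, a7, hI, Finset.sum_range_succ]
  exact ⟨⟨trivial, ⟨⟨trivial, by omega, by omega⟩, ⟨⟨trivial, trivial, by omega⟩, trivial,
    by omega⟩, by omega⟩, by omega⟩, trivial⟩

/-- Replace single rows as long as this increases the diversity. -/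
def searchP : Cmd :=
  .seq (.wset 22 (.var 1)) <|
  .seq (.wset 27 (.const 1)) <|
  .loop (.weq (.var 27) (.const 1)) <|
    .seq (.wset 27 (.const 0)) <|
    forLoop 21 1 <|
      .seq findP <|
      .ite (.weq (.var 25) (.const 1))
        (.seq rowGainP <|
          .ite (.wlt (.var 39) (.var 26)) (.seq copyP (.wset 27 (.const 1))) .skip)
        .skip

/-- Row `i` cannot be replaced by an element of `F` to increase the diversity. -/
def LocallyOptimal {n k : ℕ} (F : Set (Finset (Fin n))) (distinct : Prop) (A : Fin k → Finset (Fin n))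
    (i : Fin k) : Prop :=
  ∀ S ∈ F, (distinct → ∀ j, j ≠ i → S ≠ A j) →
    ∑ j ∈ Finset.univ.erase i, (symmDiff S (A j)).card ≤
      ∑ j ∈ Finset.univ.erase i, (symmDiff (A i) (A j)).card

/-- The rows form a collection in `F`. -/
structure IsState (n k : ℕ) (F : Set (Finset (Fin n))) (mode : ℕ) (s : State) : Prop where
  bits : BitRows n k s
  mem : ∀ j, rowsOf n k s j ∈ F
  inj : mode = 0 → Function.Injective (rowsOf n k s)

theorem IsState.congr {n k mode : ℕ} {F : Set (Finset (Fin n))} {s s' : State}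
    (h : IsState n k F mode s) (h6 : rowOf n s' = rowOf n s) : IsState n k F mode s' := by
  have hr : rowsOf n k s' = rowsOf n k s := by funext j; rw [rowsOf, h6]; rfl
  exact ⟨by rw [BitRows, h6]; exact h.bits, by rw [hr]; exact h.mem, by rw [hr]; exact h.inj⟩

theorem rowsOf_copy {n k : ℕ} {i : Fin k} {s s' : State} {X : ℕ → ℕ}
    (h : ∀ j < k, ∀ p < n, rowOf n s' j p = if j = i then X p else rowOf n s j p) :
    rowsOf n k s' = Function.update (rowsOf n k s) i (bitsOf n X) := by
  funext j
  by_cases hj : j = i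
  · subst hj
    ext p; simp [rowsOf, bitsOf, h j j.2 p p.2]
  · have hj' : (j : ℕ) ≠ i := fun h => hj (Fin.ext h)
    rw [Function.update_of_ne hj]
    ext p; simp [rowsOf, bitsOf, h j j.2 p p.2, hj']

/-- One round of the local search at row `i`. -/
theorem run_searchStep {w n k i mode : ℕ} {s : State} (hs : Prepared w n k s) (hik : i < k)
    (hi : s.wvar 21 = i) (hK : s.wvar 22 = k) (hm : s.wvar 23 = mode)
    (hA : IsState n k (Feasible n s (s.rvar 2)) mode s) :
    Run w (.seq findP <|
      .ite (.weq (.var 25) (.const 1))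
        (.seq rowGainP <|
          .ite (.wlt (.var 39) (.var 26)) (.seq copyP (.wset 27 (.const 1))) .skip)
        .skip) s (findTime n k + ((n + 1) * 25 + ((k * n + 1) * 25 + 20)))
      (fun s' => IsState n k (Feasible n s (s.rvar 2)) mode s' ∧
        ((s'.wvar 27 = s.wvar 27 ∧ rowsOf n k s' = rowsOf n k s ∧
          LocallyOptimal (Feasible n s (s.rvar 2)) (mode = 0) (rowsOf n k s) ⟨i, hik⟩) ∨
        (s'.wvar 27 = 1 ∧ diversity (rowsOf n k s) < diversity (rowsOf n k s')))) := by
  have hf := hs.toFits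
  have p1 : 1 < 2 ^ w := by have := hf.one_le_n; have := hf.succ_lt; omega
  refine Run.seq (run_findP_sets hs hi hK hm le_rfl hA.bits) ?_ le_rfl
  rintro s₁ ⟨hg, hfind⟩ hF₁
  have hs₁ := hs.frame hF₁ rfl
  have r₁ : rowOf n s₁ = rowOf n s := rowOf_congr (hF₁.wa 6 rfl)
  have rs₁ : rowsOf n k s₁ = rowsOf n k s := by funext j; rw [rowsOf, r₁]; rfl
  have hA₁ := hA.congr r₁
  refine Run.ite (T := (n + 1) * 25 + ((k * n + 1) * 25 + 14)) (by simp [p1]) (fun h => ?_)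
    (fun h => ?_) (by simp [BExpr.cost, WExpr.cost]; omega)
  · simp only [BExpr.val, WExpr.nat] at h
    obtain ⟨-, q1, q2, q3, q4, q5⟩ := hfind.resolve_left fun h' => by omega
    have hold := hg (rowOf n s i) (hA.bits i hik)
    refine Run.seq (T₁ := (n + 1) * 25 + 2) (T₂ := (k * n + 1) * 25 + 12)
      (run_rowGainP hs₁.toSized ((hF₁.w 21 rfl).trans hi) hik (by rw [r₁]; exact hA.bits i hik)
        ?_) ?_ (by omega)
    · rw [r₁, hold]
      exact (gainOfSet_lt s i le_rfl _).trans hf.gains_le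
    intro s₂ h39 hF₂
    rw [r₁, hold] at h39
    have hs₂ := hs₁.frame hF₂ rfl
    have r₂ : rowOf n s₂ = rowOf n s := (rowOf_congr (hF₂.wa 6 rfl)).trans r₁
    have rs₂ : rowsOf n k s₂ = rowsOf n k s := by funext j; rw [rowsOf, r₂]; rfl
    have e26 := hF₂.w 26 rfl
    rw [q4] at e26
    refine Run.ite (T := (k * n + 1) * 25 + 2) (by simp) (fun hlt => ?_) (fun hlt => ?_)
      (by simp [BExpr.cost, WExpr.cost]; omega)
    · simp only [BExpr.val, WExpr.nat, h39, e26] at hlt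
      refine Run.seq (run_copyP hs₂.toSized (i := i)
        ((hF₂.w 21 rfl).trans ((hF₁.w 21 rfl).trans hi))) ?_ le_rfl
      intro s₃ hc hF₃
      rw [hF₂.wa 10 rfl, r₂] at hc
      have hup := rowsOf_copy (i := ⟨i, hik⟩) (s := s) hc
      refine Run.of_wp ⟨by simpa using p1, ⟨?_, ?_, ?_⟩, .inr ⟨by simp, ?_⟩⟩ (by decide)
      · intro j hj p hp
        change rowOf n s₃ j p ≤ 1
        rw [hc j hj p hp]
        split_ifs
        · exact q1 p hp
        · exact hA.bits j hj p hp
      · intro j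
        change rowsOf n k s₃ j ∈ _
        rw [hup]
        by_cases hj : j = ⟨i, hik⟩
        · subst hj; simpa using q2
        · rw [Function.update_of_ne hj]; exact hA.mem j
      · intro h0
        change Function.Injective (rowsOf n k s₃)
        have hall := (allowed_iff (i := ⟨i, hik⟩)).1 q3 h0
        have hinj := hA.inj h0
        intro j j' hjj
        rw [hup] at hjj
        by_cases hj : j = ⟨i, hik⟩ <;> by_cases hj' : j' = ⟨i, hik⟩
        · rw [hj, hj']
        · rw [hj, Function.update_self, Function.update_of_ne hj'] at hjj
          exact absurd hjj (hall j' hj')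
        · rw [hj', Function.update_self, Function.update_of_ne hj] at hjj
          exact absurd hjj.symm (hall j hj)
        · rw [Function.update_of_ne hj, Function.update_of_ne hj'] at hjj
          exact hinj hjj
      · change _ < diversity (rowsOf n k s₃)
        rw [hup]
        -- The increase of the diversity is the new gain minus the old one, and the test has just
        -- found this to be positive.
        have := diversity_update (rowsOf n k s) ⟨i, hik⟩ (bitsOf n (s₁.warr 10))
        have g1 : gainOfSet n s i k (bitsOf n (s₁.warr 10)) = _ := gainOfSet_eq s ⟨i, hik⟩ _
        have g2 : gainOfSet n s i k (rowsOf n k s ⟨i, hik⟩) = _ := gainOfSet_eq s ⟨i, hik⟩ _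
        have g3 : rowsOf n k s ⟨i, hik⟩ = bitsOf n (rowOf n s i) := rfl
        rw [g3] at g2 this
        omega
    · simp only [BExpr.val, WExpr.nat, h39, e26] at hlt
      refine Run.of_wp ⟨hA.congr r₂, .inl ⟨(hF₂.w 27 rfl).trans (hF₁.w 27 rfl), rs₂, ?_⟩⟩
        (by simp [Cmd.cst])
      intro S hS hd
      have g2 := gainOfSet_eq s ⟨i, hik⟩ (rowsOf n k s ⟨i, hik⟩)
      rw [← gainOfSet_eq s ⟨i, hik⟩ S, ← g2]
      exact (q5 S hS ((allowed_iff (i := ⟨i, hik⟩)).2 hd)).trans (not_lt.1 hlt)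
  · simp only [BExpr.val, WExpr.nat] at h
    obtain ⟨-, hno⟩ := hfind.resolve_right fun h' => h h'.1
    refine Run.of_wp ⟨hA₁, .inl ⟨hF₁.w 27 rfl, rs₁, ?_⟩⟩ (by simp [Cmd.cst]; omega)
    exact fun S hS hd => absurd ((allowed_iff (i := ⟨i, hik⟩)).2 hd) (hno S hS)

/-- The running time of one round. -/
def roundTime (n k : ℕ) : ℕ :=
  (k + 1) * (findTime n k + ((n + 1) * 25 + ((k * n + 1) * 25 + 20)) + 8)

/-- Rows may change in the course of a round, so local optimality is concluded only from a round in
which nothing changed: then all rows were tested against the same collection. -/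
theorem run_searchP {w n k mode : ℕ} {s : State} (hs : Prepared w n k s)
    (hm : s.wvar 23 = mode) (hA : IsState n k (Feasible n s (s.rvar 2)) mode s) :
    Run w searchP s ((n * (k * k) + 1) * (roundTime n k + 6) + 10) (fun s' =>
      IsState n k (Feasible n s (s.rvar 2)) mode s' ∧
      SwapOptimal (Feasible n s (s.rvar 2)) (mode = 0) (rowsOf n k s')) := by
  have hf := hs.toFits
  have hk1 := hf.succ_k_lt
  have p1 : 1 < 2 ^ w := by have := hf.one_le_k; omega
  set F := Feasible n s (s.rvar 2) with hFdef
  refine Run.seq (T₁ := 2) (T₂ := (n * (k * k) + 1) * (roundTime n k + 6) + 8)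
    (R := fun s₁ => s₁ = s.setW 22 k) (Run.of_wp (by simp [hs.w1]) (by decide)) ?_ (by omega)
  rintro s₁ rfl -
  refine Run.seq (T₁ := 2) (T₂ := (n * (k * k) + 1) * (roundTime n k + 6) + 6)
    (R := fun s₁ => s₁ = (s.setW 22 k).setW 27 1) (Run.of_wp (by simp [p1]) (by decide)) ?_
    (by omega)
  rintro s₁ rfl -
  have hdiv : ∀ s₂ : State, diversity (rowsOf n k s₂) ≤ n * (k * k) := fun s₂ => by
    simpa using diversity_le (rowsOf n k s₂)
  have key := Run.while (w := w) (b := .weq (.var 27) (.const 1))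
    (p := .seq (.wset 27 (.const 0)) <|
      forLoop 21 1 <|
        .seq findP <|
        .ite (.weq (.var 25) (.const 1))
          (.seq rowGainP <|
            .ite (.wlt (.var 39) (.var 26)) (.seq copyP (.wset 27 (.const 1))) .skip)
          .skip)
    (s := (s.setW 22 k).setW 27 1) (Tb := roundTime n k + 2)
    (fun s' => Prepared w n k s' ∧ s'.wvar 22 = k ∧ s'.wvar 23 = mode ∧
      Feasible n s' (s'.rvar 2) = F ∧ IsState n k F mode s' ∧
      (s'.wvar 27 = 1 ∨ (s'.wvar 27 = 0 ∧ SwapOptimal F (mode = 0) (rowsOf n k s'))))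
    -- An improving round raises the diversity, which is at most n k^2. The flag in variable 27 is
    -- added so that the final, unsuccessful round also lowers the measure.
    (fun s' => (n * (k * k) - diversity (rowsOf n k s')) + s'.wvar 27)
    (fun s' _ => by simp [p1]) ?_
    ⟨(hs.setW rfl).setW rfl, by simp, by simp [hm], rfl, hA.congr rfl, .inl (by simp)⟩
  · refine key.mono ?_ ?_
    · simp only [State.setW_wvar, reduceIte, BExpr.cost, WExpr.cost]
      rw [show roundTime n k + 2 + (1 + 1 + 1) + 1 = roundTime n k + 6 from rfl]
      have := Nat.mul_le_mul_right (roundTime n k + 6)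
        (show n * (k * k) - diversity (rowsOf n k ((s.setW 22 k).setW 27 1)) + 1 ≤
          n * (k * k) + 1 by omega)
      omega
    · rintro s' ⟨⟨-, -, -, -, h1, h2⟩, h3⟩
      simp only [BExpr.val, WExpr.nat] at h3
      exact ⟨h1, (h2.resolve_left h3).2⟩
  rintro s' ⟨hs', h22, h23, hFe, hA', -⟩ h27
  simp only [BExpr.val, WExpr.nat] at h27
  refine Run.seq (T₁ := 2) (T₂ := roundTime n k) (R := fun s₁ => s₁ = s'.setW 27 0)
    (Run.of_wp (by simp) (by decide)) ?_ (by omega)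
  rintro s₁ rfl -
  refine Run.forLoop (Tb := findTime n k + ((n + 1) * 25 + ((k * n + 1) * 25 + 20)))
    (fun l s₂ => IsState n k F mode s₂ ∧
      ((s₂.wvar 27 = 0 ∧ rowsOf n k s₂ = rowsOf n k s' ∧
        ∀ j : Fin k, (j : ℕ) < l → LocallyOptimal F (mode = 0) (rowsOf n k s₂) j) ∨
      (s₂.wvar 27 = 1 ∧ diversity (rowsOf n k s') < diversity (rowsOf n k s₂)))) rfl rfl
    (by simp [hs'.w1]; omega)
    ⟨hA'.congr rfl, .inl ⟨by simp, rfl, fun j hj => absurd hj (Nat.not_lt_zero _)⟩⟩ ?_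
    (by simp only [State.setW_wvar, hs'.w1, Nat.reduceEqDiff, OfNat.one_ne_ofNat, reduceIte]
        exact le_rfl) ?_
  · rintro l s₂ hl hF hx ⟨hA₂, hI⟩
    have hl' : l < k := by simpa [hs'.w1] using hl
    have hs₂ : Prepared w n k s₂ := (hs'.setW rfl).frame hF rfl
    have hFe₂ : Feasible n s₂ (s₂.rvar 2) = F := by
      rw [Feasible.congr (hF.wa 4 rfl) (hF.ra 5 rfl), hF.r 2 rfl]; exact hFe
    have := run_searchStep (mode := mode) hs₂ hl' hx ((hF.w 22 rfl).trans (by simp [h22]))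
      ((hF.w 23 rfl).trans (by simp [h23])) (by rw [hFe₂]; exact hA₂)
    rw [hFe₂] at this
    refine this.mono le_rfl ?_
    rintro s₃ ⟨g1, g2⟩
    refine ⟨g1.congr rfl, ?_⟩
    change ((s₃.setW 21 (l + 1)).wvar 27 = 0 ∧ rowsOf n k s₃ = _ ∧
      ∀ j : Fin k, (j : ℕ) < l + 1 → LocallyOptimal F (mode = 0) (rowsOf n k s₃) j) ∨
      ((s₃.setW 21 (l + 1)).wvar 27 = 1 ∧ _ < diversity (rowsOf n k s₃))
    simp only [State.setW_wvar, Nat.reduceEqDiff, reduceIte]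
    rcases g2 with ⟨g2, g3, g4⟩ | ⟨g2, g3⟩
    · rw [g2, g3]
      refine hI.imp (fun ⟨a1, a2, a3⟩ => ⟨a1, a2, fun j hj => ?_⟩) id
      rcases Nat.lt_succ_iff_lt_or_eq.1 hj with h | h
      · exact a3 j h
      · obtain rfl : j = ⟨l, hl'⟩ := Fin.ext h
        exact g4
    · right
      refine ⟨g2, ?_⟩
      rcases hI with ⟨-, a2, -⟩ | ⟨-, a2⟩
      · rw [← a2]; exact g3
      · exact a2.trans g3
  · rintro s₂ hF - ⟨hA₂, hI⟩
    have hFr : Feasible n s₂ (s₂.rvar 2) = F := by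
      rw [Feasible.congr (hF.wa 4 rfl) (hF.ra 5 rfl), hF.r 2 rfl]; exact hFe
    have hb := hdiv s₂
    refine ⟨⟨(hs'.setW rfl).frame hF rfl, (hF.w 22 rfl).trans (by simp [h22]),
      (hF.w 23 rfl).trans (by simp [h23]), hFr, hA₂, ?_⟩, ?_⟩
    · rcases hI with ⟨a1, -, a3⟩ | ⟨a1, -⟩
      · exact .inr ⟨a1, fun j => a3 j (by simp [hs'.w1])⟩
      · exact .inl a1
    · rcases hI with ⟨a1, a2, -⟩ | ⟨a1, a2⟩
      · rw [a1, a2, h27]; omega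
      · rw [a1, h27]; omega

end DiverseOpt

namespace DiverseOpt

open RealRAM

set_option linter.unusedSimpArgs false

/-! ### Preprocessing -/

/-- Compute the sorted order and the tables that depend on the input only. -/
def prepareP : Cmd :=
  .seq sizesP <| .seq diameterP <| .seq alongP <| .seq acrossP <| .seq rankP <| .seq orderP <|
  .seq weightsP <| .seq chainsP <| .seq nearP addElemP

/-- The running time of `prepareP`. -/
def prepareTime (n : ℕ) : ℕ :=
  100 + (((n * n + 1) * 88 + 10) + ((n + 1) * 51 + ((n + 1) * 51 + ((n + 1) * ((n + 1) * 48 + 13) +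
    ((n + 1) * ((n + 1) * 28 + 13) + ((n + 1) * 21 + ((n + 1) * 31 +
      (((n + 1) * (n + 1) + 1) * 91 + (n * numRecords n + 1) * 161))))))))

/-- The memory holds the instance. -/
structure HasInput {n : ℕ} (I : UDGInput n) (s : State) : Prop where
  w0 : s.wvar 0 = n
  w1 : s.wvar 1 = I.k
  r0 : s.rvar 0 = I.c
  px : ∀ v : Fin n, s.rarr 0 v = I.pt v 0
  py : ∀ v : Fin n, s.rarr 1 v = I.pt v 1
  weight : ∀ v : Fin n, s.rarr 2 v = I.weight v

theorem HasInput.frame {n : ℕ} {I : UDGInput n} {p : Cmd} {s s' : State} (h : HasInput I s)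
    (hF : Frame p s s') (h0 : p.writesW 0 = false) (h1 : p.writesW 1 = false)
    (hr : p.writesR 0 = false) (hx : p.writesRA 0 = false) (hy : p.writesRA 1 = false)
    (hw : p.writesRA 2 = false) : HasInput I s' :=
  ⟨(hF.w _ h0).trans h.w0, (hF.w _ h1).trans h.w1, (hF.r _ hr).trans h.r0,
    by rw [hF.ra _ hx]; exact h.px, by rw [hF.ra _ hy]; exact h.py,
    by rw [hF.ra _ hw]; exact h.weight⟩

/-- The positions in memory are those of the vertices under `σ`. -/
structure Placed {n : ℕ} (I : UDGInput n) (σ : Fin n ≃ Fin n) (s : State) : Prop where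
  rank : ∀ v : Fin n, s.warr 1 v = σ v
  near : ∀ a b : Fin n, s.warr 4 ((a + 1) * (n + 1) + (b + 1)) = 0 ↔
    1 < dist (I.pt (σ.symm a)) (I.pt (σ.symm b))
  weight : ∀ p : Fin n, s.rarr 5 p = I.weight (σ.symm p)

theorem IsSorting.exists_equiv {n : ℕ} {al : ℕ → ℝ} {rk od : ℕ → ℕ} (h : IsSorting n al rk od) :
    ∃ σ : Fin n ≃ Fin n, (∀ v : Fin n, rk v = σ v) ∧
      ∀ p : Fin n, od p = σ.symm p :=
  ⟨{ toFun := fun v => ⟨rk v, h.rk_lt v v.2⟩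
     invFun := fun p => ⟨od p, h.od_lt p p.2⟩
     left_inv := fun v => Fin.ext (h.od_rk v v.2)
     right_inv := fun p => Fin.ext (h.rk_od p p.2) }, fun _ => rfl, fun _ => rfl⟩

theorem nearOf_succ_eq_zero {px py : ℕ → ℝ} {od : ℕ → ℕ} {a b : ℕ} :
    nearOf px py od (a + 1) (b + 1) = 0 ↔ 1 < sqDist px py (od a) (od b) := by
  simp [nearOf]

/-- The geometric criterion, transported to positions: equal chain labels mean lying on the same
side of the diameter, and a zero in the table means distance greater than 1. -/
theorem neighboursSuffice {n : ℕ} (I : UDGInput n) {px py : ℕ → ℝ} {s t : ℕ} {od rk ch : ℕ → ℕ}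
    {nr : ℕ → ℕ → ℕ} (hx : ∀ v : Fin n, px v = I.pt v 0) (hy : ∀ v : Fin n, py v = I.pt v 1)
    (hs : s < n) (ht : t < n)
    (hd : ∀ a b, a < n → b < n → sqDist px py a b ≤ sqDist px py s t)
    (hsort : IsSorting n (along px py s t) rk od)
    (hch : ∀ p < n, ch p = if 0 ≤ across px py s t (od p) then 0 else 1)
    (hnr : ∀ a < n, ∀ b < n, nr (a + 1) (b + 1) = 0 ↔ 1 < sqDist px py (od a) (od b)) :
    NeighboursSuffice n ch nr := by
  have hside : ∀ p r, p < n → r < n →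
      (ch p = ch r ↔ (0 ≤ across px py s t (od p) ↔ 0 ≤ across px py s t (od r))) := by
    intro p r hp hr
    rw [hch p hp, hch r hr]
    split_ifs with h1 h2 h2 <;> simp [h1, h2]
  intro S hS h1 h2 p z hp hz hpz
  rw [hnr p (hS p hp) z (hS z hz)]
  refine far_of_neighbours I.convexPosition hx hy hs ht hd hsort.od_lt ?_ hsort.mono hS ?_ ?_ hp hz
    hpz
  · intro p hp q hq h
    rw [← hsort.rk_od p hp, ← hsort.rk_od q hq, h]
  · intro z r hz hr hrz h
    rw [← hnr r (hS r hr) z (hS z hz)]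
    exact h1 z r hz hr hrz fun p hp hpz hpr => h p hp hpz ((hside p r (hS p hp) (hS r hr)).1 hpr)
  · intro z r hz hr hrz hne h
    rw [← hnr r (hS r hr) z (hS z hz)]
    exact h2 z r hz hr hrz (fun h' => hne ((hside r z (hS r hr) (hS z hz)).1 h'))
      fun p hp hpz hpr => h p hp hpz ((hside p r (hS p hp) (hS r hr)).1 hpr)

theorem run_prepareP {w n : ℕ} {I : UDGInput n} {s : State} (hf : Fits w n I.k)
    (hI : HasInput I s) :
    Run w prepareP s (prepareTime n) (fun s' => Prepared w n I.k s' ∧ HasInput I s' ∧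
      ∃ σ : Fin n ≃ Fin n, Placed I σ s') := by
  refine Run.seq (run_sizesP hf hI.w0 hI.w1) ?_ le_rfl
  intro s₁ hs₁ hF₁
  have i₁ := hI.frame hF₁ rfl rfl rfl rfl rfl rfl
  refine Run.seq (run_diameterP hs₁) ?_ le_rfl
  rintro s₂ ⟨hS, hT, hd⟩ hF₂
  have hs₂ := hs₁.frame hF₂ rfl
  have i₂ := i₁.frame hF₂ rfl rfl rfl rfl rfl rfl
  rw [← hF₂.ra 0 rfl, ← hF₂.ra 1 rfl] at hd
  refine Run.seq (run_alongP hs₂) ?_ le_rfl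
  intro s₃ hal hF₃
  have hs₃ := hs₂.frame hF₃ rfl
  have i₃ := i₂.frame hF₃ rfl rfl rfl rfl rfl rfl
  refine Run.seq (run_acrossP hs₃) ?_ le_rfl
  intro s₄ hac hF₄
  have hs₄ := hs₃.frame hF₄ rfl
  have i₄ := i₃.frame hF₄ rfl rfl rfl rfl rfl rfl
  refine Run.seq (run_rankP hs₄) ?_ le_rfl
  intro s₅ hrk hF₅
  have hs₅ := hs₄.frame hF₅ rfl
  have i₅ := i₄.frame hF₅ rfl rfl rfl rfl rfl rfl
  refine Run.seq (run_orderP hs₅) ?_ le_rfl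
  intro s₆ hod hF₆
  have hs₆ := hs₅.frame hF₆ rfl
  have i₆ := i₅.frame hF₆ rfl rfl rfl rfl rfl rfl
  refine Run.seq (run_weightsP hs₆) ?_ le_rfl
  intro s₇ hwt hF₇
  have hs₇ := hs₆.frame hF₇ rfl
  have i₇ := i₆.frame hF₇ rfl rfl rfl rfl rfl rfl
  refine Run.seq (run_chainsP hs₇) ?_ le_rfl
  intro s₈ hch hF₈
  have hs₈ := hs₇.frame hF₈ rfl
  have i₈ := i₇.frame hF₈ rfl rfl rfl rfl rfl rfl
  refine Run.seq (run_nearP hs₈) ?_ le_rfl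
  intro s₉ hnr hF₉
  have hs₉ := hs₈.frame hF₉ rfl
  have i₉ := i₈.frame hF₉ rfl rfl rfl rfl rfl rfl
  refine (run_addElemP hs₉).frame.mono le_rfl ?_
  rintro s' ⟨hadd, hF'⟩
  have hs' := hs₉.frame hF' rfl
  have i' := i₉.frame hF' rfl rfl rfl rfl rfl rfl
  have x₂ : s₈.rarr 0 = s₂.rarr 0 := (hF₈.ra 0 rfl).trans <| (hF₇.ra 0 rfl).trans <|
    (hF₆.ra 0 rfl).trans <| (hF₅.ra 0 rfl).trans <| (hF₄.ra 0 rfl).trans (hF₃.ra 0 rfl)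
  have y₂ : s₈.rarr 1 = s₂.rarr 1 := (hF₈.ra 1 rfl).trans <| (hF₇.ra 1 rfl).trans <|
    (hF₆.ra 1 rfl).trans <| (hF₅.ra 1 rfl).trans <| (hF₄.ra 1 rfl).trans (hF₃.ra 1 rfl)
  rw [x₂, y₂, show s₈.warr 2 = s₆.warr 2 from (hF₈.wa 2 rfl).trans (hF₇.wa 2 rfl)] at hnr
  rw [show s₇.rarr 4 = s₄.rarr 4 from (hF₇.ra 4 rfl).trans <| (hF₆.ra 4 rfl).trans (hF₅.ra 4 rfl),
    show s₇.warr 2 = s₆.warr 2 from hF₇.wa 2 rfl] at hch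
  rw [hF₃.ra 0 rfl, hF₃.ra 1 rfl, hF₃.w 2 rfl, hF₃.w 3 rfl] at hac
  rw [hF₄.ra 3 rfl] at hrk
  have hsort₀ := isSorting_of_rankOf (al := s₃.rarr 3) (rk := s₅.warr 1) (od := s₆.warr 2) hrk
    fun p hp => hod p hp <| by
      obtain ⟨a, ha, h⟩ := exists_rankOf_eq (s₃.rarr 3) hp
      exact ⟨a, ha, (hrk a ha).trans h⟩
  have hsort : IsSorting n (along (s₂.rarr 0) (s₂.rarr 1) (s₂.wvar 2) (s₂.wvar 3)) (s₅.warr 1)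
      (s₆.warr 2) := { hsort₀ with
    mono := fun p q hpq hq => by
      rw [← hal _ (hsort₀.od_lt p (hpq.trans hq)), ← hal _ (hsort₀.od_lt q hq)]
      exact hsort₀.mono p q hpq hq }
  have hch' : ∀ p < n, s'.warr 3 p = if 0 ≤ across (s₂.rarr 0) (s₂.rarr 1) (s₂.wvar 2) (s₂.wvar 3)
      (s₆.warr 2 p) then 0 else 1 := fun p hp => by
    rw [hF'.wa 3 rfl, hF₉.wa 3 rfl, hch p hp, hac _ (hsort.od_lt p hp)]
  have hnr' : ∀ a < n + 1, ∀ b < n + 1, s'.warr 4 (a * (n + 1) + b) =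
      nearOf (s₂.rarr 0) (s₂.rarr 1) (s₆.warr 2) a b := fun a ha b hb => by
    have := hnr _ (digit_lt ha hb)
    rw [digit_div hb, digit_mod hb] at this
    rw [hF'.wa 4 rfl, this]
  have hnr'' : ∀ a < n, ∀ b < n, s'.warr 4 ((a + 1) * (n + 1) + (b + 1)) = 0 ↔
      1 < sqDist (s₂.rarr 0) (s₂.rarr 1) (s₆.warr 2 a) (s₆.warr 2 b) := fun a ha b hb => by
    rw [hnr' _ (by omega) _ (by omega), nearOf_succ_eq_zero]
  obtain ⟨σ, hσ₁, hσ₂⟩ := hsort.exists_equiv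
  have hwt' : ∀ p : Fin n, s'.rarr 5 p = I.weight (σ.symm p) := fun p => by
    rw [hF'.ra 5 rfl, hF₉.ra 5 rfl, hF₈.ra 5 rfl, hwt p p.2, hσ₂, i₆.weight]
  refine ⟨⟨hs', fun p hp => ?_, fun q hq => ?_, ?_, ?_, fun p hp => ?_⟩, i', σ, ?_, fun a b => ?_,
    hwt'⟩
  · rw [hch' p hp]; split_ifs <;> omega
  · have := hnr' 0 (by omega) q (by omega)
    rw [Nat.zero_mul, Nat.zero_add] at this
    rw [this, nearOf, if_pos (.inl rfl)]
  · exact neighboursSuffice I i₂.px i₂.py hS hT hd hsort hch' hnr''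
  · rw [hF'.wa 3 rfl, hF'.wa 4 rfl]; exact hadd
  · rw [hwt' ⟨p, hp⟩]; exact I.weight_nonneg _
  · intro v
    rw [hF'.wa 1 rfl, hF₉.wa 1 rfl, hF₈.wa 1 rfl, hF₇.wa 1 rfl, hF₆.wa 1 rfl]
    exact hσ₁ v
  · rw [hnr'' a a.2 b b.2, hσ₂, hσ₂, ← not_le, ← not_le]
    exact not_congr (sqDist_pt I.pt i₂.px i₂.py _ _)

end DiverseOpt

namespace DiverseOpt

open RealRAM

set_option linter.unusedSimpArgs false

/-! ### The solution spaces in terms of positions -/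

section

variable {n : ℕ} {I : UDGInput n} {σ : Fin n ≃ Fin n} {s : State}

/-- The vertices at the positions in `S`, or all other vertices. -/
def verticesAt (b : Bool) (σ : Fin n ≃ Fin n) (S : Finset (Fin n)) : Finset (Fin n) :=
  bif b then (S.map σ.symm.toEmbedding)ᶜ else S.map σ.symm.toEmbedding

/-- The two solution spaces. -/
def solutions (b : Bool) (I : UDGInput n) : Set (Finset (Fin n)) :=
  bif b then I.cMWVC else I.cMWIS

theorem mem_verticesAt {b : Bool} {S : Finset (Fin n)} {v : Fin n} :
    v ∈ verticesAt b σ S ↔ (bif b then σ v ∉ S else σ v ∈ S) := by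
  cases b <;> simp [verticesAt, Finset.mem_map_equiv]

theorem verticesAt_bijective (b : Bool) (σ : Fin n ≃ Fin n) :
    Function.Bijective (verticesAt b σ) := by
  rw [← Finite.injective_iff_bijective]
  intro S T h
  ext p
  have := Finset.ext_iff.1 h (σ.symm p)
  rw [mem_verticesAt, mem_verticesAt] at this
  cases b
  · simpa using this
  · simpa [not_iff_not] using this

/-- Two complements have the same symmetric difference as the sets themselves, and relabelling
preserves cardinalities. -/
theorem card_symmDiff_verticesAt (b : Bool) (σ : Fin n ≃ Fin n) (S T : Finset (Fin n)) :
    (symmDiff (verticesAt b σ S) (verticesAt b σ T)).card = (symmDiff S T).card := by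
  have : symmDiff (verticesAt b σ S) (verticesAt b σ T) =
      (symmDiff S T).map σ.symm.toEmbedding := by
    ext v
    rw [Finset.mem_map_equiv]
    simp only [Finset.mem_symmDiff, mem_verticesAt, Equiv.symm_symm]
    cases b
    · simp
    · simp; tauto
  rw [this, Finset.card_map]

/-- The conflict table is consulted only for p < z, which suffices because adjacency is symmetric.
-/
theorem Placed.mem_feasible_iff (h : Placed I σ s) {θ : ℝ} {S : Finset (Fin n)} :
    S ∈ Feasible n s θ ↔
      I.graph.IsIndepSet (S.map σ.symm.toEmbedding : Finset (Fin n)) ∧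
        θ ≤ I.totalWeight (S.map σ.symm.toEmbedding) := by
  have h1 : ∑ p ∈ S, s.rarr 5 p = I.totalWeight (S.map σ.symm.toEmbedding) := by
    rw [UDGInput.totalWeight, Finset.sum_map]
    exact Finset.sum_congr rfl fun p _ => h.weight p
  have hadj : ∀ {p z : Fin n}, p ≠ z →
      (s.warr 4 ((p + 1) * (n + 1) + (z + 1)) = 0 ↔ ¬ I.graph.Adj (σ.symm p) (σ.symm z)) := by
    intro p z hpz
    rw [h.near p z, ← not_le]
    refine not_congr ⟨fun h' => ⟨fun h'' => hpz (σ.symm.injective h''), h'⟩, fun h' => h'.2⟩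
  have h2 : (∀ p ∈ S, ∀ z ∈ S, p < z → s.warr 4 ((p + 1) * (n + 1) + (z + 1)) = 0) ↔
      I.graph.IsIndepSet (S.map σ.symm.toEmbedding : Finset (Fin n)) := by
    constructor
    · intro hS v hv u hu hvu
      obtain ⟨p, hp, rfl⟩ := Finset.mem_map.1 (Finset.mem_coe.1 hv)
      obtain ⟨z, hz, rfl⟩ := Finset.mem_map.1 (Finset.mem_coe.1 hu)
      have hpz : p ≠ z := fun h => hvu (by rw [h])
      rcases lt_or_gt_of_ne hpz with hlt | hlt
      · exact (hadj hpz).1 (hS p hp z hz hlt)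
      · exact fun h' => (hadj hpz.symm).1 (hS z hz p hp hlt) h'.symm
    · intro hS p hp z hz hlt
      exact (hadj hlt.ne).2 (hS (Finset.mem_coe.2 (Finset.mem_map_of_mem _ hp))
        (Finset.mem_coe.2 (Finset.mem_map_of_mem _ hz)) fun h' => hlt.ne (σ.symm.injective h'))
  rw [Feasible, Set.mem_ofPred_eq, h1, h2]

theorem totalWeight_nonneg (I : UDGInput n) (S : Finset (Fin n)) : 0 ≤ I.totalWeight S :=
  Finset.sum_nonneg fun v _ => I.weight_nonneg v

/-- The value in real variable `5` is the maximum weight of an independent set. -/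
def HasOptimum (I : UDGInput n) (s : State) : Prop :=
  IsGreatest (I.totalWeight '' {S : Finset (Fin n) | I.graph.IsIndepSet (S : Set (Fin n))})
    (s.rvar 5)

theorem Placed.hasOptimum (h : Placed I σ s) {s' : State}
    (h1 : ∃ X, Candidate n s 0 0 1 (s'.rvar 5) X)
    (h2 : ∀ X, Candidate n s 0 0 1 0 X →
      (∑ p ∈ Finset.range n, if X p = 1 then s.rarr 5 p else 0) ≤ s'.rvar 5) :
    HasOptimum I s' := by
  have hrow : ∀ l < 0, ∀ p < n, rowOf n s l p ≤ 1 := fun l hl => absurd hl (Nat.not_lt_zero _)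
  have hub : ∀ S : Finset (Fin n), I.graph.IsIndepSet (S : Set (Fin n)) →
      I.totalWeight S ≤ s'.rvar 5 := by
    intro S hS
    obtain ⟨T, rfl⟩ := (verticesAt_bijective false σ).2 S
    change I.graph.IsIndepSet (T.map σ.symm.toEmbedding : Finset (Fin n)) at hS
    change I.totalWeight (T.map σ.symm.toEmbedding) ≤ _
    obtain ⟨X, hX, rfl⟩ := exists_bitsOf T
    have hc : ∀ θ ≤ I.totalWeight ((bitsOf n X).map σ.symm.toEmbedding),
        Candidate n s 0 0 1 θ X := fun θ hθ =>
      (candidate_iff hX hrow).2 ⟨h.mem_feasible_iff.2 ⟨hS, hθ⟩, fun h' => by omega⟩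
    exact (hc _ le_rfl).le_weight.trans (h2 X (hc 0 (totalWeight_nonneg I _)))
  obtain ⟨X, hX⟩ := h1
  obtain ⟨g1, g2⟩ := h.mem_feasible_iff.1 ((candidate_iff hX.le_one hrow).1 hX).1
  refine ⟨⟨_, g1, le_antisymm (hub _ g1) g2⟩, ?_⟩
  rintro _ ⟨S, hS, rfl⟩
  exact hub S hS

theorem totalWeight_compl (I : UDGInput n) (S : Finset (Fin n)) :
    I.totalWeight Sᶜ = I.totalWeight Finset.univ - I.totalWeight S := by
  have := Finset.sum_add_sum_compl S I.weight
  simp only [UDGInput.totalWeight]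
  linarith

/-- The weight of an independent set that corresponds to a solution. -/
noncomputable def threshold (b : Bool) (I : UDGInput n) (opt : ℝ) : ℝ :=
  bif b then I.totalWeight Finset.univ - (I.totalWeight Finset.univ - opt) / I.c else I.c * opt

/-- Ensures that a maximum weight independent set meets the threshold, so that the family searched
is nonempty. -/
theorem threshold_le (b : Bool) (h : HasOptimum I s) : threshold b I (s.rvar 5) ≤ s.rvar 5 := by
  obtain ⟨⟨S, -, hS⟩, -⟩ := h
  have h0 : 0 ≤ s.rvar 5 := hS ▸ totalWeight_nonneg I S
  cases b
  · exact mul_le_of_le_one_left h0 I.c_le_one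
  · have h1 := totalWeight_compl I S
    have h2 := totalWeight_nonneg I Sᶜ
    have h3 : I.totalWeight Finset.univ - s.rvar 5 ≤
        (I.totalWeight Finset.univ - s.rvar 5) / I.c :=
      le_div_self (by linarith) I.c_pos I.c_le_one
    simp only [threshold, cond_true]
    linarith

/-- For covers, the minimum is W - opt, with W the total weight, because complementation exchanges
covers and independent sets. The condition W - w(S) ≤ (W - opt)/c is then solved for w(S). -/
theorem Placed.verticesAt_mem_iff (hp : Placed I σ s) (b : Bool) {s' : State}
    (h : HasOptimum I s') {S : Finset (Fin n)} :
    verticesAt b σ S ∈ solutions b I ↔ S ∈ Feasible n s (threshold b I (s'.rvar 5)) := by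
  rw [hp.mem_feasible_iff]
  cases b
  · change S.map σ.symm.toEmbedding ∈ cMax _ _ _ ↔ _
    refine and_congr Iff.rfl ⟨fun ⟨M, hM, hle⟩ => ?_, fun hle => ⟨_, h, hle⟩⟩
    rwa [hM.unique h] at hle
  · change (S.map σ.symm.toEmbedding)ᶜ ∈ cMin _ _ _ ↔ _
    have hleast : IsLeast (I.totalWeight ''
        {S : Finset (Fin n) | I.graph.IsVertexCover (S : Set (Fin n))})
        (I.totalWeight Finset.univ - s'.rvar 5) := by
      obtain ⟨⟨T, hT, hTw⟩, hub⟩ := h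
      refine ⟨⟨Tᶜ, ?_, ?_⟩, ?_⟩
      · change I.graph.IsVertexCover ((Tᶜ : Finset (Fin n)) : Set (Fin n))
        rw [Finset.coe_compl]
        exact SimpleGraph.isVertexCover_compl.2 hT
      · rw [totalWeight_compl, hTw]
      · rintro _ ⟨U, hU, rfl⟩
        have h1 : I.totalWeight Uᶜ ≤ s'.rvar 5 := hub ⟨Uᶜ, by
          change I.graph.IsIndepSet ((Uᶜ : Finset (Fin n)) : Set (Fin n))
          rw [Finset.coe_compl]
          exact SimpleGraph.isIndepSet_compl_iff_isVertexCover.2 hU, rfl⟩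
        rw [totalWeight_compl] at h1
        linarith
    refine and_congr ?_ ?_
    · change I.graph.IsVertexCover (((S.map σ.symm.toEmbedding)ᶜ : Finset (Fin n)) : Set (Fin n)) ↔ _
      rw [Finset.coe_compl]
      exact SimpleGraph.isVertexCover_compl
    · rw [totalWeight_compl]
      constructor
      · rintro ⟨m, hm, hle⟩
        rw [hm.unique hleast] at hle
        simp only [threshold, cond_true]
        rw [one_div_mul_eq_div] at hle
        linarith
      · intro hle
        refine ⟨_, hleast, ?_⟩
        simp only [threshold, cond_true] at hle
        rw [one_div_mul_eq_div]
        linarith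

theorem Placed.feasible_nonempty (hp : Placed I σ s) (b : Bool) {s' : State}
    (h : HasOptimum I s') : (Feasible n s (threshold b I (s'.rvar 5))).Nonempty := by
  obtain ⟨S, hS, hSw⟩ := h.1
  obtain ⟨T, rfl⟩ := (verticesAt_bijective false σ).2 S
  exact ⟨T, hp.mem_feasible_iff.2 ⟨hS, (threshold_le b h).trans hSw.ge⟩⟩

end

/-! ### Threshold and output -/

/-- Compute the threshold in real variable `2`. -/
def thresholdP (b : Bool) : Cmd :=
  .seq (.rset 6 (.const 0)) <|
  .seq (forLoop 4 0 (.rset 6 (.add (.var 6) (.get 2 (.var 4))))) <|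
  .rset 2 (bif b then .sub (.var 6) (.div (.sub (.var 6) (.var 5)) (.var 0))
    else .mul (.var 0) (.var 5))

theorem run_thresholdP {w n k : ℕ} {I : UDGInput n} (b : Bool) {s : State} (hs : Sized w n k s)
    (hI : HasInput I s) :
    Run w (thresholdP b) s ((n + 1) * 15 + 20)
      (fun s' => s'.rvar 2 = threshold b I (s.rvar 5)) := by
  have hlt := hs.toFits.succ_lt
  refine Run.seq (T₁ := 2) (T₂ := (n + 1) * 15 + 18) (R := fun s₁ => s₁ = s.setR 6 0)
    (Run.of_wp (by simp) (by decide)) ?_ (by omega)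
  rintro s₁ rfl -
  refine Run.seq (T₁ := (n + 1) * 15) (T₂ := 18)
    (R := fun s₁ => s₁.rvar 6 = I.totalWeight Finset.univ) ?_ ?_ (by omega)
  · refine Run.forLoop (Tb := 7) (fun l s' => s'.rvar 6 = ∑ v ∈ Finset.range l, s.rarr 2 v) rfl rfl
      (by simp [hs.w0]; omega) (by simp) ?_ (by simp [hs.w0]) ?_
    · intro l s' hl hF hx hsum
      refine Run.of_wp ?_ (by decide)
      simp [hx, hsum, Finset.sum_range_succ, hF.ra 2 rfl]
    · intro s' _ _ h
      rw [h, State.setR_wvar, hs.w0, Finset.sum_range]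
      exact Finset.sum_congr rfl fun v _ => hI.weight v
  · intro s₁ h hF
    have e0 : s₁.rvar 0 = I.c := (hF.r 0 rfl).trans (by simp [hI.r0])
    have e5 : s₁.rvar 5 = s.rvar 5 := (hF.r 5 rfl).trans (by simp)
    cases b
    · refine Run.of_wp ?_ (by decide)
      simp [threshold, e0, e5]
    · refine Run.of_wp ?_ (by decide)
      simp [threshold, e0, e5, h]

/-- Write the rows, or their complements, to the output array in the order of the input. -/
def outputP (b : Bool) : Cmd :=
  forLoop 4 20 <| .seq
    (.seq (.wset 28 (.get 6 (.add (.mul (.div (.var 4) (.var 0)) (.var 0))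
        (.get 1 (.mod (.var 4) (.var 0))))))
      (.wset 7 (bif b then .sub (.const 1) (.var 28) else .var 28)))
    (.wput 0 (.var 4) (.var 7))

theorem run_outputP {w n k : ℕ} {σ : Fin n ≃ Fin n} (b : Bool) {s : State}
    (hs : Sized w n k s) (hrank : ∀ v : Fin n, s.warr 1 v = σ v) (hbits : BitRows n k s) :
    Run w (outputP b) s ((k * n + 1) * 35) (fun s' => ∀ j,
      outputSets n k s' j = verticesAt b σ (rowsOf n k s j)) := by
  have hf := hs.toFits
  have hlt := hf.matrix_lt
  have hle : k * n ≤ (k + 1) * (n + 1) := Nat.mul_le_mul (by omega) (by omega)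
  have hn := hf.one_le_n
  have p1 : 1 < 2 ^ w := by have := hf.succ_lt; omega
  -- Output columns are indexed by input vertices, so the bit is fetched at the rank of the vertex.
  -- As rows hold only zeros and ones, 1 minus the bit is the complement.
  refine Run.fillW (Tb := 24) (fun t v => v =
      bif b then 1 - rowOf n s (t / n) (s.warr 1 (t % n)) else rowOf n s (t / n) (s.warr 1 (t % n)))
    ?_ ?_ ?_ (by rw [hs.w20]; omega) ?_ (by rw [hs.w20]) ?_
  · cases b <;> rfl
  · cases b <;> rfl
  · cases b <;> rfl
  · intro t s' ht hF hx _ _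
    rw [hs.w20] at ht
    have hj : t / n < k := (Nat.div_lt_iff_lt_mul hn).2 ht
    have hp : t % n < n := Nat.mod_lt _ hn
    have hr : s.warr 1 (t % n) < n := by rw [hrank ⟨t % n, hp⟩]; exact (σ _).2
    have hcell := cell_lt hf hj hr
    have e0 : s'.wvar 0 = n := (hF.w 0 (by cases b <;> rfl)).trans hs.w0
    have a6 : s'.warr 6 = s.warr 6 := hF.wa 6 (by cases b <;> rfl)
    have a1 : s'.warr 1 = s.warr 1 := hF.wa 1 (by cases b <;> rfl)
    cases b
    · refine Run.of_wp ?_ (by decide)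
      simp only [Cmd.wp, WExpr.Ok, WExpr.nat, cond_false, State.setW_wvar, reduceIte, hx, e0, a6, a1,
        and_self, true_and, rowOf, and_true]
      exact ⟨by omega, hcell⟩
    · refine Run.of_wp ?_ (by decide)
      simp only [Cmd.wp, WExpr.Ok, WExpr.nat, cond_true, State.setW_wvar, reduceIte, hx, e0, a6, a1,
        and_self, true_and, rowOf, and_true]
      exact ⟨⟨by omega, hcell⟩, p1⟩
  · intro s' _ h _ j
    rw [hs.w20] at h
    ext v
    have := h _ (digit_lt j.2 v.2)
    rw [digit_div v.2, digit_mod v.2, hrank] at this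
    have hb := hbits j j.2 (σ v) (σ v).2
    rw [mem_verticesAt, outputSets, Finset.mem_filter, this, rowsOf, bitsOf, Finset.mem_filter]
    cases b
    · simp only [Finset.mem_univ, true_and, cond_false]; omega
    · simp only [Finset.mem_univ, true_and, cond_true]; omega

/-! ### The whole program -/

/-- Approximately diverse solutions. -/
def diverseP (b : Bool) : Cmd :=
  .seq prepareP <| .seq optimumP <| .seq (thresholdP b) <| .seq initialP <|
  .seq searchP (outputP b)

/-- The running time of `diverseP`. -/
def diverseTime (n k : ℕ) : ℕ :=
  prepareTime n + ((tablesTime n k + 20) + (((n + 1) * 15 + 20) +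
    (((k + 1) * (2 * findTime n k + (k * n + 1) * 25 + 20) + 2) +
      (((n * (k * k) + 1) * (roundTime n k + 6) + 10) + (k * n + 1) * 35))))

theorem run_diverseP {w n : ℕ} {I : UDGInput n} (b : Bool) {s : State} (hf : Fits w n I.k)
    (hI : HasInput I s) :
    Run w (diverseP b) s (diverseTime n I.k) (fun s' =>
      IsApprox (solutions b I) (1 - 2 / ((I.k : ℝ) + 1)) (outputSets n I.k s')) := by
  refine Run.seq (run_prepareP hf hI) ?_ le_rfl
  rintro s₁ ⟨hs₁, i₁, σ, hσ⟩ -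
  refine Run.seq (run_optimumP hs₁) ?_ le_rfl
  rintro s₂ ⟨h1, h2⟩ hF₂
  have hs₂ := hs₁.frame hF₂ rfl
  have i₂ := i₁.frame hF₂ rfl rfl rfl rfl rfl rfl
  have hopt := hσ.hasOptimum h1 h2
  have rk₂ : s₂.warr 1 = s₁.warr 1 := hF₂.wa 1 rfl
  refine Run.seq (run_thresholdP b hs₂.toSized i₂) ?_ le_rfl
  intro s₃ hθ hF₃
  have hs₃ := hs₂.frame hF₃ (by cases b <;> rfl)
  have rk₃ : s₃.warr 1 = s₁.warr 1 := (hF₃.wa 1 (by cases b <;> rfl)).trans rk₂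
  set F := Feasible n s₃ (s₃.rvar 2) with hFdef
  have hF : F = Feasible n s₁ (threshold b I (s₂.rvar 5)) := by
    rw [hFdef, hθ]
    exact Feasible.congr ((hF₃.wa 4 (by cases b <;> rfl)).trans (hF₂.wa 4 rfl))
      ((hF₃.ra 5 (by cases b <;> rfl)).trans (hF₂.ra 5 rfl))
  refine Run.seq (run_initialP hs₃ (by rw [← hFdef, hF]; exact hσ.feasible_nonempty b hopt)) ?_ le_rfl
  intro s₄ hcol hF₄
  have hs₄ := hs₃.frame hF₄ rfl
  rw [← hFdef] at hcol
  have hFe : Feasible n s₄ (s₄.rvar 2) = F := by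
    rw [Feasible.congr (hF₄.wa 4 rfl) (hF₄.ra 5 rfl), hF₄.r 2 rfl]
  have hmem : ∀ j, rowsOf n I.k s₄ j ∈ F := fun j => hcol.mem j j.2
  have hinj : s₄.wvar 23 = 0 → Function.Injective (rowsOf n I.k s₄) := fun h0 j j' hjj => by
    by_contra hne
    exact (hcol.distinct.resolve_right fun h => by omega).2 j j.2 j' j'.2
      (fun h => hne (Fin.ext h)) hjj
  -- Flag 0 exhibits `k` distinct members of `F`, and flag 1 comes with the proof that there are
  -- fewer. So the mode chosen by the program is the one that admissibility prescribes.
  have hd : s₄.wvar 23 = 0 ↔ I.k ≤ F.ncard := by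
    constructor
    · intro h0
      have := Set.ncard_le_ncard (Set.range_subset_iff.2 hmem) F.toFinite
      rwa [Set.ncard_range_of_injective (hinj h0), Nat.card_fin] at this
    · intro h
      exact (hcol.distinct.resolve_right fun h' => by omega).1
  refine Run.seq (run_searchP hs₄ rfl (by rw [hFe]; exact ⟨hcol.bits, hmem, hinj⟩)) ?_ le_rfl
  rintro s₅ ⟨hst, hloc⟩ hF₅
  rw [hFe] at hst hloc
  have hs₅ := hs₄.frame hF₅ rfl
  have happ := hloc.isApprox I.one_le_k hd hst.mem hst.inj
  refine (run_outputP (σ := σ) b hs₅.toSized (fun v => ?_) hst.bits).mono le_rfl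
    fun s₆ h => ?_
  · rw [hF₅.wa 1 rfl, hF₄.wa 1 rfl, rk₃]; exact hσ.rank v
  · rw [show outputSets n I.k s₆ = fun j => verticesAt b σ (rowsOf n I.k s₅ j) from funext h]
    exact happ.image (verticesAt b σ) (verticesAt_bijective b σ) (card_symmDiff_verticesAt b σ)
      fun S => by rw [hF]; exact hσ.verticesAt_mem_iff b hopt

end DiverseOpt

namespace DiverseOpt

open RealRAM

/-! ### The running time and the word length -/

section

variable {n k : ℕ}

theorem pow_mul_pow_le_pow_mul_pow (hn : 1 ≤ n) (hk : 1 ≤ k) {i j i' j' : ℕ} (hi : i ≤ i')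
    (hj : j ≤ j') : n ^ i * k ^ j ≤ n ^ i' * k ^ j' :=
  Nat.mul_le_mul (Nat.pow_le_pow_right hn hi) (Nat.pow_le_pow_right hk hj)

theorem numStates_le (hn : 1 ≤ n) (hk : 1 ≤ k) : numStates n k ≤ 32 * (n ^ 4 * k) := by
  have h1 : n + 1 ≤ 2 * n := by omega
  have h2 : k + 1 ≤ 2 * k := by omega
  calc numStates n k
      ≤ (2 * k) * ((2 * n) * (2 * n) * (2 * n) * (2 * n)) := by
        unfold numStates numRecords; gcongr
    _ = _ := by ring

theorem numGains_le (hn : 1 ≤ n) (hk : 1 ≤ k) : numGains n k ≤ 2 * (n * k) := by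
  have := Nat.mul_le_mul hn hk
  unfold numGains; omega

/-- The table of best weights dominates: n bit counts, n^4 k states and n k gains. After
normalisation all other monomials are bounded by n^6 k^2. -/
theorem findTime_le (hn : 1 ≤ n) (hk : 1 ≤ k) : findTime n k ≤ 50000 * (n ^ 6 * k ^ 2) := by
  have h1 : n + 1 ≤ 2 * n := by omega
  have h2 : k + 1 ≤ 2 * k := by omega
  have hS := numStates_le hn hk
  have hG := numGains_le hn hk
  have key : findTime n k ≤
      (n * 2 + 1) * ((2 * k) * 38 + 23) +
      ((n * (2 * k) * 2 + 1) * ((2 * k) * ((2 * n) * 38 + 40) + 60) + (((2 * k) * 18 + 20) +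
      ((n * (32 * (n ^ 4 * k)) * 2 + 1) * 71 +
      ((2 * n) * (32 * (n ^ 4 * k)) * (2 * (n * k)) + 1) * 150))) +
      (((2 * (n * k) + 1) * 30 + 20) + ((2 * n) * 150 + 4)) := by
    unfold findTime tablesTime; gcongr
  have m := fun {i j} (hi : i ≤ 6) (hj : j ≤ 2) => pow_mul_pow_le_pow_mul_pow hn hk hi hj
  have m00 := m (i := 0) (j := 0) (by decide) (by decide)
  have m10 := m (i := 1) (j := 0) (by decide) (by decide)
  have m01 := m (i := 0) (j := 1) (by decide) (by decide)
  have m11 := m (i := 1) (j := 1) (by decide) (by decide)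
  have m12 := m (i := 1) (j := 2) (by decide) (by decide)
  have m22 := m (i := 2) (j := 2) (by decide) (by decide)
  have m51 := m (i := 5) (j := 1) (by decide) (by decide)
  refine key.trans ?_
  ring_nf at m00 m10 m01 m11 m12 m22 m51 ⊢
  omega

theorem tablesTime_le_findTime : tablesTime n k ≤ findTime n k := Nat.le_add_right ..

theorem roundTime_le (hn : 1 ≤ n) (hk : 1 ≤ k) : roundTime n k ≤ 101000 * (n ^ 6 * k ^ 3) := by
  have h1 : n + 1 ≤ 2 * n := by omega
  have h2 : k + 1 ≤ 2 * k := by omega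
  have key : roundTime n k ≤ (2 * k) * (50000 * (n ^ 6 * k ^ 2) +
      ((2 * n) * 25 + ((k * n + 1) * 25 + 20)) + 8) := by
    have := findTime_le hn hk
    unfold roundTime; gcongr
  have m := fun {i j} (hi : i ≤ 6) (hj : j ≤ 3) => pow_mul_pow_le_pow_mul_pow hn hk hi hj
  have m01 := m (i := 0) (j := 1) (by decide) (by decide)
  have m11 := m (i := 1) (j := 1) (by decide) (by decide)
  have m12 := m (i := 1) (j := 2) (by decide) (by decide)
  refine key.trans ?_
  ring_nf at m01 m11 m12 ⊢
  omega

theorem prepareTime_le (hn : 1 ≤ n) : prepareTime n ≤ 10000 * n ^ 5 := by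
  have h1 : n + 1 ≤ 2 * n := by omega
  have key : prepareTime n ≤ 100 + (((n * n + 1) * 88 + 10) + ((2 * n) * 51 + ((2 * n) * 51 +
      ((2 * n) * ((2 * n) * 48 + 13) + ((2 * n) * ((2 * n) * 28 + 13) + ((2 * n) * 21 +
      ((2 * n) * 31 + (((2 * n) * (2 * n) + 1) * 91 +
      (n * ((2 * n) * (2 * n) * (2 * n) * (2 * n)) + 1) * 161)))))))) := by
    unfold prepareTime numRecords; gcongr
  have m := fun {i} (hi : i ≤ 5) => Nat.pow_le_pow_right hn hi
  have m0 := m (i := 0) (by decide)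
  have m1 := m (i := 1) (by decide)
  have m2 := m (i := 2) (by decide)
  refine key.trans ?_
  ring_nf at m0 m1 m2 ⊢
  omega

/-- The local search dominates: about n k^2 rounds of order n^6 k^3 each. -/
theorem diverseTime_le (hn : 1 ≤ n) (hk : 1 ≤ k) :
    diverseTime n k ≤ 1000000 * (n ^ 7 * k ^ 5) := by
  have h1 : n + 1 ≤ 2 * n := by omega
  have h2 : k + 1 ≤ 2 * k := by omega
  have hf := findTime_le hn hk
  have key : diverseTime n k ≤ 10000 * n ^ 5 + ((50000 * (n ^ 6 * k ^ 2) + 20) +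
      (((2 * n) * 15 + 20) +
      (((2 * k) * (2 * (50000 * (n ^ 6 * k ^ 2)) + (k * n + 1) * 25 + 20) + 2) +
      (((n * (k * k) + 1) * (101000 * (n ^ 6 * k ^ 3) + 6) + 10) + (k * n + 1) * 35)))) := by
    have := prepareTime_le hn
    have := roundTime_le hn hk
    have := tablesTime_le_findTime.trans hf
    unfold diverseTime; gcongr
  have m := fun {i j} (hi : i ≤ 7) (hj : j ≤ 5) => pow_mul_pow_le_pow_mul_pow hn hk hi hj
  have m00 := m (i := 0) (j := 0) (by decide) (by decide)
  have m50 := m (i := 5) (j := 0) (by decide) (by decide)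
  have m10 := m (i := 1) (j := 0) (by decide) (by decide)
  have m01 := m (i := 0) (j := 1) (by decide) (by decide)
  have m11 := m (i := 1) (j := 1) (by decide) (by decide)
  have m12 := m (i := 1) (j := 2) (by decide) (by decide)
  have m62 := m (i := 6) (j := 2) (by decide) (by decide)
  have m63 := m (i := 6) (j := 3) (by decide) (by decide)
  refine key.trans ?_
  ring_nf at m00 m50 m10 m01 m11 m12 m62 m63 ⊢
  omega

/-- The largest table has at most (n+k)^8 entries; the ninth power makes the inequality strict, as n
+ k is at least 2. -/
theorem Fits.of_pow_le {w : ℕ} (hn : 1 ≤ n) (hk : 1 ≤ k) (h : (n + k) ^ 9 ≤ 2 ^ w) :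
    Fits w n k := by
  refine ⟨hn, hk, lt_of_le_of_lt ?_ ((Nat.pow_lt_pow_right (by omega) (by decide)).trans_le h :
    (n + k) ^ 8 < 2 ^ w)⟩
  have hn' : n + 1 ≤ n + k := by omega
  have hk' : k + 1 ≤ n + k := by omega
  have hg : n * k + 1 ≤ (n + k) * (n + k) := by nlinarith
  calc (n + 1) * numStates n k * numGains n k
      ≤ (n + k) * ((n + k) * ((n + k) * (n + k) * (n + k) * (n + k))) * ((n + k) * (n + k)) := by
        unfold numStates numRecords numGains; gcongr
    _ = _ := by ring

end

theorem hasInput_initialState {n : ℕ} (I : UDGInput n) : HasInput I I.initialState := by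
  constructor <;> simp [UDGInput.initialState]

theorem isApproxAlgorithm_diverseP (b : Bool) :
    IsApproxAlgorithm (fun {_} I => solutions b I) (diverseP b) := by
  refine ⟨9, 2000000, fun n I w hn hw => ?_⟩
  obtain ⟨s, t, he, ht, hs⟩ := run_diverseP b (.of_pow_le hn I.one_le_k hw) (hasInput_initialState I)
  refine ⟨s, t, he, ?_, hs⟩
  -- As k is at least 1, the logarithm is at least log 2 > 1/2, so doubling the constant absorbs it.
  have hlog : (1 : ℝ) / 2 ≤ Real.log ((I.k : ℝ) + 1) := by
    have hk : (1 : ℝ) ≤ I.k := by exact_mod_cast I.one_le_k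
    have := Real.log_le_log (by norm_num : (0 : ℝ) < 2) (by linarith : (2 : ℝ) ≤ I.k + 1)
    linarith [Real.log_two_gt_d9]
  calc (t : ℝ) ≤ 1000000 * ((n : ℝ) ^ 7 * (I.k : ℝ) ^ 5) := by
        exact_mod_cast ht.trans (diverseTime_le hn I.one_le_k)
    _ = 2000000 * (n : ℝ) ^ 7 * (I.k : ℝ) ^ 5 * (1 / 2) := by ring
    _ ≤ _ := by gcongr

end DiverseOpt

theorem mainTheorem9 :
    (∃ P : RealRAM.Cmd,
      DiverseOpt.IsApproxAlgorithm (fun {n} (I : DiverseOpt.UDGInput n) => I.cMWIS) P) ∧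
    (∃ P : RealRAM.Cmd,
      DiverseOpt.IsApproxAlgorithm (fun {n} (I : DiverseOpt.UDGInput n) => I.cMWVC) P) :=
  ⟨⟨_, DiverseOpt.isApproxAlgorithm_diverseP false⟩, ⟨_, DiverseOpt.isApproxAlgorithm_diverseP true⟩⟩
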